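/- **Setting.** Let $G$ be a (not necessarily connected) real Lie group with semisimple Lie algebra $\mathfrak g$, endowed with a $|k|$-grading $\mathfrak g=\mathfrak g_{-k}\oplus\dots\oplus\mathfrak g_k$, i.e. $[\mathfrak g_i,\mathfrak g_j]\subset\mathfrak g_{i+j}$ (with $\mathfrak g_i=0$ for $|i|>k$) and $\mathfrak g_-=\mathfrak g_{-k}\oplus\dots\oplus\mathfrak g_{-1}$ is generated by $\mathfrak g_{-1}$. Put $\mathfrak g^i=\bigoplus_{j\ge i}\mathfrak g_j$, $\mathfrak p=\mathfrak g^0$, and let $P=N_G(\mathfrak p)=\{g\in G:\operatorname{Ad}(g)\mathfrak p=\mathfrak p\}$. A parabolic geometry of type $(G,P)$ on a smooth manifold $M$ is a principal $P$-bundle $p:\mathcal G\to M$ with a Cartan connection $\omega\in\Omega^1(\mathcal G,\mathfrak g)$: each $\omega(u):T_u\mathcal G\to\mathfrak g$ is a linear isomorphism, $(r^h)^*\omega=\operatorname{Ad}(h)^{-1}\circ\omega$ for $h\in P$, and $\omega(\zeta_A)=A$ for the fundamental vector fields $\zeta_A$, $A\in\mathfrak p$. Its curvature is $K(\xi,\eta)=d\omega(\xi,\eta)+[\omega(\xi),\omega(\eta)]$.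 For $x\in M$ and any $u\in p^{-1}(x)$ put $T^i_xM=\{T_up\cdot\omega(u)^{-1}(X):X\in\mathfrak g^i\}$; this is independent of $u$ and defines a filtration $TM=T^{-k}M\supset\dots\supset T^{-1}M\supset T^0M=0$, with $T^iM=TM$ for $i\le -k$. Let $\operatorname{gr}_i(T_xM)=T^i_xM/T^{i+1}_xM$. For $i<0$, a point $u$ over $x$ gives a linear isomorphism $\varphi_u:\mathfrak g_i\to\operatorname{gr}_i(T_xM)$, $X\mapsto[T_up\cdot\omega(u)^{-1}(X)]$. The algebraic bracket $\{\ ,\ \}$ on $\operatorname{gr}(T_xM)=\bigoplus_{i<0}\operatorname{gr}_i(T_xM)$ is defined by $\{\varphi_u(X),\varphi_u(Y)\}=\varphi_u([X,Y])$; it is independent of $u$. The geometry is *regular* if for all $i,j<0$, all $u\in\mathcal G$ and all vector fields $\xi,\eta$ on $\mathcal G$ with $T_up\cdot\xi(u)\in T^iM$ and $T_up\cdot\eta(u)\in T^jM$ one has $K(\xi,\eta)(u)\in\mathfrak g^{i+j+1}$. The filtration makes $M$ a *filtered manifold* if the $T^iM$ are smooth subbundles and $[\xi,\eta]\in\Gamma(T^{i+j}M)$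 for all $\xi\in\Gamma(T^iM)$, $\eta\in\Gamma(T^jM)$, $i,j<0$. In that case the class of $[\xi,\eta](x)$ in $\operatorname{gr}_{i+j}(T_xM)$ depends only on the classes of $\xi(x)$ and $\eta(x)$ in $\operatorname{gr}_i(T_xM)$ and $\operatorname{gr}_j(T_xM)$, and the resulting bracket on $\operatorname{gr}(T_xM)$ is the *Levi bracket*; $\operatorname{gr}(T_xM)$ with this bracket is the *symbol algebra* at $x$. **Proposition.** A parabolic geometry $(p:\mathcal G\to M,\omega)$ of type $(G,P)$ is regular if and only if the induced filtration $\{T^iM\}$ makes $M$ into a filtered manifold such that, for every $x\in M$, the Levi bracket on $\operatorname{gr}(T_xM)$ coincides with $\{\ ,\ \}$. In particular, if the geometry is regular, then for every $x\in M$ the symbol algebra at $x$ is isomorphic to $\mathfrak g_-$ as a graded Lie algebra. -/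

import Mathlib

open scoped Manifold ContDiff

namespace ParabolicGeometry

/-! ### Subbundles and filtrations of the tangent bundle -/

noncomputable section Filtered

variable {E : Type*} [NormedAddCommGroup E] [NormedSpace ℝ E]
  {M : Type*} [TopologicalSpace M] [ChartedSpace E M]

/-- A family of linear subspaces `D x ⊆ T_x M` is a smooth subbundle of `TM` if, near every point,
it is spanned by smooth vector fields which are pointwise linearly independent. -/
def IsSmoothSubbundle [IsManifold 𝓘(ℝ, E) ∞ M]
    (D : ∀ x : M, Submodule ℝ (TangentSpace 𝓘(ℝ, E) x)) : Prop :=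
  ∀ x₀ : M, ∃ U : Set M, IsOpen U ∧ x₀ ∈ U ∧
    ∃ (r : ℕ) (s : Fin r → ∀ x : M, TangentSpace 𝓘(ℝ, E) x),
      (∀ a, ContMDiffOn 𝓘(ℝ, E) 𝓘(ℝ, E).tangent ∞
        (fun x ↦ (⟨x, s a x⟩ : TangentBundle 𝓘(ℝ, E) M)) U) ∧
      ∀ x ∈ U, LinearIndependent ℝ (fun a ↦ s a x) ∧
        Submodule.span ℝ (Set.range fun a ↦ s a x) = D x

/-- A smooth vector field on `M`. -/
def IsSmoothField [IsManifold 𝓘(ℝ, E) ∞ M] (ξ : ∀ x : M, TangentSpace 𝓘(ℝ, E) x) : Prop :=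
  ContMDiff 𝓘(ℝ, E) 𝓘(ℝ, E).tangent ∞ (fun x ↦ (⟨x, ξ x⟩ : TangentBundle 𝓘(ℝ, E) M))

/-- The space `Γ(D)` of smooth global sections of a family `D` of subspaces of `TM`. -/
def Sections [IsManifold 𝓘(ℝ, E) ∞ M] (D : ∀ x : M, Submodule ℝ (TangentSpace 𝓘(ℝ, E) x)) :=
  {ξ : ∀ x : M, TangentSpace 𝓘(ℝ, E) x // IsSmoothField ξ ∧ ∀ x, ξ x ∈ D x}

/-- `F i x` is the filtration component `T^i_x M ⊆ T_x M`, `i ∈ ℤ`. -/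
abbrev TangentFiltration (E : Type*) [NormedAddCommGroup E] [NormedSpace ℝ E]
    (M : Type*) [TopologicalSpace M] [ChartedSpace E M] :=
  ℤ → ∀ x : M, Submodule ℝ (TangentSpace 𝓘(ℝ, E) x)

/-- `gr_i(T_x M) = T^i_x M / T^{i+1}_x M`. -/
abbrev Gr (F : TangentFiltration E M) (x : M) (i : ℤ) : Type _ :=
  F i x ⧸ (F (i + 1) x).submoduleOf (F i x)

/-- The class in `gr_i(T_x M)` of an element of `T^i_x M`. -/
abbrev Gr.mk (F : TangentFiltration E M) (x : M) (i : ℤ) : F i x →ₗ[ℝ] Gr F x i :=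
  ((F (i + 1) x).submoduleOf (F i x)).mkQ

/-- The class in `gr_i(T_x M)` of the value at `x` of a section of `T^i M`. -/
def Sections.cls [IsManifold 𝓘(ℝ, E) ∞ M] {F : TangentFiltration E M} {i : ℤ}
    (ξ : Sections (F i)) (x : M) : Gr F x i :=
  Gr.mk F x i ⟨ξ.1 x, ξ.2.2 x⟩

/-- The filtration `TM = T^{-k}M ⊇ ⋯ ⊇ T^{-1}M ⊇ 0` makes `M` into a filtered manifold.  The
filtration is indexed by all integers, with `T^i M = TM` for `i ≤ -k` and `T^i M = 0` for
`i ≥ 0`. -/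
structure IsFilteredManifold [IsManifold 𝓘(ℝ, E) ∞ M] (k : ℕ) (F : TangentFiltration E M) :
    Prop where
  antitone : ∀ (x : M) (i j : ℤ), i ≤ j → F j x ≤ F i x
  eq_top : ∀ (x : M) (i : ℤ), i ≤ -(k : ℤ) → F i x = ⊤
  eq_bot : ∀ (x : M) (i : ℤ), 0 ≤ i → F i x = ⊥
  isSmoothSubbundle : ∀ i : ℤ, i < 0 → IsSmoothSubbundle (F i)
  lieBracket_mem : ∀ i j : ℤ, i < 0 → j < 0 → ∀ (ξ : Sections (F i)) (η : Sections (F j)) (x : M),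
    VectorField.mlieBracket 𝓘(ℝ, E) ξ.1 η.1 x ∈ F (i + j) x

variable [FiniteDimensional ℝ E] [IsManifold 𝓘(ℝ, E) ∞ M]

/-- Every element of a smooth subbundle is the value of a global section. -/
theorem IsSmoothSubbundle.exists_section [T2Space M]
    {D : ∀ x : M, Submodule ℝ (TangentSpace 𝓘(ℝ, E) x)}
    (hD : IsSmoothSubbundle D) (x : M) (v : TangentSpace 𝓘(ℝ, E) x) (hv : v ∈ D x) :
    ∃ ξ : Sections D, ξ.1 x = v := by
  obtain ⟨U, hU, hxU, r, s, hs, hspan⟩ := hD x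
  obtain ⟨c, hc⟩ : ∃ c : Fin r → ℝ, ∑ a, c a • s a x = v := by
    rw [← (hspan x hxU).2] at hv
    exact (Submodule.mem_span_range_iff_exists_fun ℝ).1 hv
  obtain ⟨ψ, -, hψ⟩ := (SmoothBumpFunction.nhds_basis_tsupport (I := 𝓘(ℝ, E)) x).mem_iff.1
    (hU.mem_nhds hxU)
  have hsum : ContMDiffOn 𝓘(ℝ, E) 𝓘(ℝ, E).tangent ∞
      (fun y ↦ (⟨y, ∑ a, c a • s a y⟩ : TangentBundle 𝓘(ℝ, E) M)) U := by
    refine ContMDiffOn.sum_section (V := fun y : M ↦ TangentSpace 𝓘(ℝ, E) y)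
      (t := fun a y ↦ c a • s a y) ?_
    intro a _
    exact (hs a).const_smul_section
  refine ⟨⟨fun y ↦ ψ y • ∑ a, c a • s a y, ?_, ?_⟩, ?_⟩
  · exact ContMDiffOn.smul_section_of_tsupport (V := fun y : M ↦ TangentSpace 𝓘(ℝ, E) y)
      (s := fun y ↦ ∑ a, c a • s a y) ψ.contMDiff.contMDiffOn hU hψ hsum
  · intro y
    by_cases hy : y ∈ U
    · refine Submodule.smul_mem _ _ ?_
      rw [← (hspan y hy).2]
      exact Submodule.sum_mem _ fun a _ ↦
        Submodule.smul_mem _ _ (Submodule.subset_span ⟨a, rfl⟩)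
    · have : ψ y = 0 := image_eq_zero_of_notMem_tsupport fun h ↦ hy (hψ h)
      simp [this]
  · simp [hc]

/-- A smooth section of a smooth subbundle is, near every point, a combination of a local frame
with differentiable coefficients, which vanish where the section vanishes. -/
theorem IsSmoothSubbundle.exists_coeff {D : ∀ x : M, Submodule ℝ (TangentSpace 𝓘(ℝ, E) x)}
    (hD : IsSmoothSubbundle D) (θ : Sections D) (x : M) :
    ∃ (r : ℕ) (s : Fin r → ∀ y : M, TangentSpace 𝓘(ℝ, E) y) (f : Fin r → M → ℝ),
      (∀ a, MDiffAt (T% (s a)) x) ∧ (∀ a, MDiffAt (f a) x) ∧ (∀ a, s a x ∈ D x) ∧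
      (∀ᶠ y in nhds x, θ.1 y = ∑ a, f a y • s a y) ∧ (θ.1 x = 0 → ∀ a, f a x = 0) := by
  obtain ⟨U, hU, hxU, r, s, hs, hspan⟩ := hD x
  have hsx : ∀ a, MDiffAt (T% (s a)) x := fun a ↦
    ((hs a).contMDiffAt (hU.mem_nhds hxU)).mdifferentiableAt (by simp)
  have hθx : MDiffAt (T% θ.1) x := θ.2.1.contMDiffAt.mdifferentiableAt (by simp)
  let e := trivializationAt E (TangentSpace 𝓘(ℝ, E) : M → Type _) x
  let st : Fin r → M → E := fun a y ↦ (e ⟨y, s a y⟩).2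
  let θt : M → E := fun y ↦ (e ⟨y, θ.1 y⟩).2
  have hst : ∀ a, MDiffAt (st a) x := fun a ↦ (mdifferentiableAt_section _ (s a)).1 (hsx a)
  have hθt : MDiffAt θt x := (mdifferentiableAt_section _ θ.1).1 hθx
  let S : M → ((Fin r → ℝ) →L[ℝ] E) := fun y ↦
    ∑ a, (ContinuousLinearMap.proj (R := ℝ) (φ := fun _ : Fin r ↦ ℝ) a).smulRight (st a y)
  have hSapp : ∀ y c, S y c = ∑ a, c a • st a y := fun y c ↦ by
    simp [S]
  have hS : MDiffAt S x := by
    have hlin : ∀ a, Differentiable ℝ (fun v : E ↦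
        (ContinuousLinearMap.proj (R := ℝ) (φ := fun _ : Fin r ↦ ℝ) a).smulRight v) := fun a ↦
      (ContinuousLinearMap.smulRightL ℝ (Fin r → ℝ) E
        (ContinuousLinearMap.proj (R := ℝ) (φ := fun _ : Fin r ↦ ℝ) a)).differentiable
    have h : Differentiable ℝ (fun v : Fin r → E ↦
        ∑ a, (ContinuousLinearMap.proj (R := ℝ) (φ := fun _ : Fin r ↦ ℝ) a).smulRight (v a)) :=
      Differentiable.fun_sum fun a _ ↦ (hlin a).comp (differentiable_apply a)
    have h2 : MDifferentiableAt 𝓘(ℝ, E) 𝓘(ℝ, Fin r → E) (fun y a ↦ st a y) x :=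
      (contMDiffAt_pi_space.2 fun a ↦ (Bundle.contMDiffAt_section x).1
        (((hs a).contMDiffAt (hU.mem_nhds hxU)))).mdifferentiableAt (by simp)
    exact (h.differentiableAt.mdifferentiableAt).comp x h2
  have hxe : x ∈ e.baseSet := FiberBundle.mem_baseSet_trivializationAt E _ x
  have hlin : ∀ y ∈ e.baseSet, ∀ c : Fin r → ℝ,
      (e ⟨y, ∑ a, c a • s a y⟩).2 = S y c := by
    intro y hy c
    have := map_sum (e.linearMapAt ℝ y) (fun a ↦ c a • s a y) Finset.univ
    rw [hSapp]
    have h2 : ∀ v, (e.linearMapAt ℝ y) v = (e ⟨y, v⟩).2 := fun v ↦ by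
      rw [e.linearMapAt_apply, if_pos hy]
    rw [h2] at this
    rw [this]
    exact Finset.sum_congr rfl fun a _ ↦ by rw [map_smul, h2]
  have hinj : Function.Injective (S x) := by
    rw [injective_iff_map_eq_zero]
    intro c hc
    rw [← hlin x hxe c] at hc
    have h0 : e.linearMapAt ℝ x (∑ a, c a • s a x) = 0 := by
      rw [e.linearMapAt_apply, if_pos hxe]; exact hc
    have h1 : ∑ a, c a • s a x = 0 := by
      have := e.symmₗ_linearMapAt (R := ℝ) hxe (∑ a, c a • s a x)
      rw [h0, map_zero] at this
      exact this.symm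
    funext a
    exact Fintype.linearIndependent_iff.1 (hspan x hxU).1 c h1 a
  obtain ⟨L₀, hL₀⟩ := (S x).toLinearMap.exists_leftInverse_of_injective
    (LinearMap.ker_eq_bot.2 hinj)
  let L : E →L[ℝ] (Fin r → ℝ) := L₀.toContinuousLinearMap
  let A : M → ((Fin r → ℝ) →L[ℝ] (Fin r → ℝ)) := fun y ↦ L ∘L S y
  have hAx : A x = 1 := by
    ext1 c
    exact LinearMap.congr_fun hL₀ c
  have hA : MDiffAt A x :=
    ((ContinuousLinearMap.compL ℝ (Fin r → ℝ) E (Fin r → ℝ) L).differentiableAt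
      |>.mdifferentiableAt).comp x hS
  have hAunit : ∀ᶠ y in nhds x, IsUnit (A y) := by
    have : {T : (Fin r → ℝ) →L[ℝ] (Fin r → ℝ) | IsUnit T} ∈ nhds (A x) :=
      Units.isOpen.mem_nhds (by rw [hAx]; exact isUnit_one)
    exact hA.continuousAt this
  let g : M → (Fin r → ℝ) := fun y ↦ Ring.inverse (A y) (L (θt y))
  have hg : MDifferentiableAt 𝓘(ℝ, E) 𝓘(ℝ, Fin r → ℝ) g x := by
    have h1 : MDiffAt (fun y ↦ Ring.inverse (A y)) x := by
      have : DifferentiableAt ℝ (Ring.inverse : ((Fin r → ℝ) →L[ℝ] (Fin r → ℝ)) → _) (A x) := by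
        rw [hAx]; exact differentiableAt_inverse isUnit_one
      exact this.mdifferentiableAt.comp x hA
    have h2 : MDifferentiableAt 𝓘(ℝ, E) 𝓘(ℝ, Fin r → ℝ) (fun y ↦ L (θt y)) x :=
      L.differentiableAt.mdifferentiableAt.comp x hθt
    exact h1.clm_apply h2
  refine ⟨r, s, fun a y ↦ g y a, hsx, fun a ↦ ?_, ?_, ?_, ?_⟩
  · exact (ContinuousLinearMap.proj (R := ℝ) (φ := fun _ : Fin r ↦ ℝ) a).differentiableAt
      |>.mdifferentiableAt.comp x hg
  · intro a
    rw [← (hspan x hxU).2]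
    exact Submodule.subset_span ⟨a, rfl⟩
  · filter_upwards [hAunit, hU.mem_nhds hxU, e.open_baseSet.mem_nhds hxe] with y hyA hyU hye
    have hmem := θ.2.2 y
    rw [← (hspan y hyU).2] at hmem
    obtain ⟨c, hc⟩ := (Submodule.mem_span_range_iff_exists_fun ℝ).1 hmem
    have : g y = c := by
      have h1 : L (θt y) = A y c := by
        change L (e ⟨y, θ.1 y⟩).2 = L (S y c)
        rw [← hlin y hye c, hc]
      change Ring.inverse (A y) (L (θt y)) = c
      rw [h1, ← mul_apply_eq_comp, Ring.inverse_mul_cancel _ hyA]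
      rfl
    rw [this, hc]
  · intro h0 a
    have : θt x = 0 := by
      change (e ⟨x, θ.1 x⟩).2 = 0
      have := (e.linearMapAt ℝ x).map_zero
      rw [e.linearMapAt_apply, if_pos hxe] at this
      rw [h0]; exact this
    change Ring.inverse (A x) (L (θt x)) a = 0
    rw [this]; simp

/-- If a section `θ` of a smooth subbundle `D` vanishes at `x`, then `[θ, η](x) ∈ D x` for every
smooth vector field `η`. -/
theorem IsSmoothSubbundle.lieBracket_mem_of_eq_zero
    {D : ∀ x : M, Submodule ℝ (TangentSpace 𝓘(ℝ, E) x)}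
    (hD : IsSmoothSubbundle D) (θ : Sections D) (x : M) (hθ : θ.1 x = 0)
    (η : ∀ y : M, TangentSpace 𝓘(ℝ, E) y) :
    VectorField.mlieBracket 𝓘(ℝ, E) θ.1 η x ∈ D x := by
  have : IsManifold 𝓘(ℝ, E) (minSmoothness ℝ 2) M := by
    rw [minSmoothness_of_isRCLikeNormedField]; infer_instance
  obtain ⟨r, s, f, hs, hf, hsD, hev, hf0⟩ := hD.exists_coeff θ x
  have hsum : ∀ t : Finset (Fin r),
      MDiffAt (T% (∑ a ∈ t, f a • s a)) x ∧
      VectorField.mlieBracket 𝓘(ℝ, E) (∑ a ∈ t, f a • s a) η x ∈ D x := by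
    classical
    intro t
    induction t using Finset.induction_on with
    | empty =>
      refine ⟨?_, ?_⟩
      · exact (Bundle.mdifferentiable_zeroSection (𝕜 := ℝ) (IB := 𝓘(ℝ, E)) (F := E)
          (TangentSpace 𝓘(ℝ, E) : M → Type _)) x
      · simp
    | insert a t ha ih =>
      rw [Finset.sum_insert ha]
      have h1 : MDiffAt (T% (f a • s a)) x := (hf a).smul_section (hs a)
      refine ⟨mdifferentiableAt_add_section h1 ih.1, ?_⟩
      rw [VectorField.mlieBracket_add_left h1 ih.1, VectorField.mlieBracket_smul_left (hf a) (hs a),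
        hf0 hθ a, zero_smul, add_zero]
      exact (D x).add_mem ((D x).smul_mem _ (hsD a)) ih.2
  have heq : VectorField.mlieBracket 𝓘(ℝ, E) θ.1 η x =
      VectorField.mlieBracket 𝓘(ℝ, E) (∑ a, f a • s a) η x := by
    refine Filter.EventuallyEq.mlieBracket_vectorField_eq ?_ Filter.EventuallyEq.rfl
    filter_upwards [hev] with y hy
    rw [hy, Finset.sum_apply]; rfl
  rw [heq]
  exact (hsum Finset.univ).2

/-- If `α` is a section of `T^i M` with `α(x) ∈ T^{i+1}_x M` and `β` is a section of `T^j M`, then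
`[α, β](x) ∈ T^{i+j+1}_x M`. -/
theorem IsFilteredManifold.lieBracket_mem_succ [T2Space M] {k : ℕ} {F : TangentFiltration E M}
    (hF : IsFilteredManifold k F) {i j : ℤ} (hi : i < 0) (hj : j < 0)
    (α : Sections (F i)) (β : Sections (F j)) (x : M) (hα : α.1 x ∈ F (i + 1) x) :
    VectorField.mlieBracket 𝓘(ℝ, E) α.1 β.1 x ∈ F (i + j + 1) x := by
  have : IsManifold 𝓘(ℝ, E) (minSmoothness ℝ 2) M := by
    rw [minSmoothness_of_isRCLikeNormedField]; infer_instance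
  have hle : F i x ≤ F (i + j + 1) x := hF.antitone x _ _ (by omega)
  rcases (show i + 1 < 0 ∨ i + 1 = 0 by omega) with h | h
  · obtain ⟨ζ, hζ⟩ := (hF.isSmoothSubbundle (i + 1) h).exists_section x _ hα
    let θ : Sections (F i) := ⟨α.1 - ζ.1, α.2.1.sub_section ζ.2.1, fun y ↦
      (F i y).sub_mem (α.2.2 y) (hF.antitone y _ _ (by omega) (ζ.2.2 y))⟩
    have hθ : θ.1 x = 0 := by
      change α.1 x - ζ.1 x = 0
      rw [hζ, sub_self]
    have hsum : α.1 = θ.1 + ζ.1 := by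
      change α.1 = (α.1 - ζ.1) + ζ.1
      rw [sub_add_cancel]
    rw [hsum, VectorField.mlieBracket_add_left
      (θ.2.1.contMDiffAt.mdifferentiableAt (by simp)) (ζ.2.1.contMDiffAt.mdifferentiableAt (by simp))]
    refine Submodule.add_mem _ (hle ?_) ?_
    · exact (hF.isSmoothSubbundle i hi).lieBracket_mem_of_eq_zero θ x hθ _
    · have := hF.lieBracket_mem (i + 1) j h hj ζ β x
      rwa [show i + 1 + j = i + j + 1 by ring] at this
  · rw [h, hF.eq_bot x 0 le_rfl, Submodule.mem_bot] at hα
    exact hle ((hF.isSmoothSubbundle i hi).lieBracket_mem_of_eq_zero α x hα _)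

theorem IsFilteredManifold.exists_cls_eq [T2Space M] {k : ℕ} {F : TangentFiltration E M}
    (hF : IsFilteredManifold k F) {x : M} {i : ℤ} (hi : i < 0) (a : Gr F x i) :
    ∃ ξ : Sections (F i), ξ.cls x = a := by
  obtain ⟨⟨v, hv⟩, rfl⟩ := Submodule.mkQ_surjective _ a
  obtain ⟨ξ, hξ⟩ := (hF.isSmoothSubbundle i hi).exists_section x v hv
  refine ⟨ξ, ?_⟩
  simp only [Sections.cls, hξ]

/-- The class of `[ξ, η](x)` in `gr_{i+j}(T_x M)` depends only on the classes of `ξ(x)` and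
`η(x)`. -/
theorem IsFilteredManifold.lieBracket_cls_congr [T2Space M] {k : ℕ} {F : TangentFiltration E M}
    (hF : IsFilteredManifold k F) (x : M) {i j : ℤ} (hi : i < 0) (hj : j < 0)
    (ξ' ξ : Sections (F i)) (η' η : Sections (F j))
    (hξ' : ξ'.cls x = ξ.cls x) (hη' : η'.cls x = η.cls x) :
    Gr.mk F x (i + j) ⟨_, hF.lieBracket_mem i j hi hj ξ' η' x⟩ =
      Gr.mk F x (i + j) ⟨_, hF.lieBracket_mem i j hi hj ξ η x⟩ := by
  have : IsManifold 𝓘(ℝ, E) (minSmoothness ℝ 2) M := by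
    rw [minSmoothness_of_isRCLikeNormedField]; infer_instance
  have key : ∀ {l : ℤ} (σ τ : Sections (F l)), σ.cls x = τ.cls x → σ.1 x - τ.1 x ∈ F (l + 1) x := by
    intro l σ τ h
    exact (Submodule.Quotient.eq ((F (l + 1) x).submoduleOf (F l x))).1 h
  have md : ∀ {l : ℤ} (σ : Sections (F l)), MDiffAt (T% σ.1) x := fun σ ↦
    σ.2.1.contMDiffAt.mdifferentiableAt (by simp)
  have sub : ∀ {l : ℤ} (σ τ : Sections (F l)), ∃ ρ : Sections (F l), ρ.1 = σ.1 - τ.1 :=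
    fun {l} σ τ ↦ ⟨⟨σ.1 - τ.1, σ.2.1.sub_section τ.2.1, fun y ↦
      (F l y).sub_mem (σ.2.2 y) (τ.2.2 y)⟩, rfl⟩
  obtain ⟨α, hα⟩ := sub ξ' ξ
  obtain ⟨β, hβ⟩ := sub η' η
  have h1 := hF.lieBracket_mem_succ hi hj α η' x (by rw [hα]; exact key _ _ hξ')
  have h2 := hF.lieBracket_mem_succ hj hi β ξ x (by rw [hβ]; exact key _ _ hη')
  refine (Submodule.Quotient.eq _).2 ?_
  change VectorField.mlieBracket 𝓘(ℝ, E) ξ'.1 η'.1 x - VectorField.mlieBracket 𝓘(ℝ, E) ξ.1 η.1 x ∈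
    F (i + j + 1) x
  have e1 : ξ'.1 = α.1 + ξ.1 := by rw [hα, sub_add_cancel]
  have e2 : η'.1 = β.1 + η.1 := by rw [hβ, sub_add_cancel]
  have e3 : VectorField.mlieBracket 𝓘(ℝ, E) ξ'.1 η'.1 x =
      VectorField.mlieBracket 𝓘(ℝ, E) α.1 η'.1 x + VectorField.mlieBracket 𝓘(ℝ, E) ξ.1 η'.1 x := by
    conv_lhs => rw [e1]
    exact VectorField.mlieBracket_add_left (md α) (md ξ)
  have e4 : VectorField.mlieBracket 𝓘(ℝ, E) ξ.1 η'.1 x =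
      VectorField.mlieBracket 𝓘(ℝ, E) ξ.1 β.1 x + VectorField.mlieBracket 𝓘(ℝ, E) ξ.1 η.1 x := by
    conv_lhs => rw [e2]
    exact VectorField.mlieBracket_add_right (md β) (md η)
  rw [e3, e4, VectorField.mlieBracket_swap_apply (V := ξ.1) (W := β.1)]
  rw [add_comm j i] at h2
  convert! Submodule.sub_mem _ h1 h2 using 1
  abel

/-- The Levi bracket `gr_i(T_x M) × gr_j(T_x M) → gr_{i+j}(T_x M)` of a filtered manifold, the
bracket of the symbol algebra at `x`: it sends the classes of `ξ(x)` and `η(x)`, for sections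
`ξ ∈ Γ(T^i M)` and `η ∈ Γ(T^j M)`, to the class of `[ξ, η](x)`. It does not depend on the choice of
the sections, see `IsFilteredManifold.leviBracket_cls`. -/
def IsFilteredManifold.leviBracket [T2Space M] {k : ℕ} {F : TangentFiltration E M}
    (hF : IsFilteredManifold k F) {x : M} {i j : ℤ} (hi : i < 0) (hj : j < 0)
    (a : Gr F x i) (b : Gr F x j) : Gr F x (i + j) :=
  Gr.mk F x (i + j) ⟨_, hF.lieBracket_mem i j hi hj
    (hF.exists_cls_eq hi a).choose (hF.exists_cls_eq hj b).choose x⟩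

theorem IsFilteredManifold.leviBracket_cls [T2Space M] {k : ℕ} {F : TangentFiltration E M}
    (hF : IsFilteredManifold k F) (x : M) {i j : ℤ} (hi : i < 0) (hj : j < 0)
    (ξ : Sections (F i)) (η : Sections (F j)) :
    hF.leviBracket hi hj (ξ.cls x) (η.cls x) =
      Gr.mk F x (i + j) ⟨_, hF.lieBracket_mem i j hi hj ξ η x⟩ :=
  hF.lieBracket_cls_congr x hi hj _ _ _ _ (hF.exists_cls_eq hi _).choose_spec
    (hF.exists_cls_eq hj _).choose_spec

end Filtered

/-! ### Gradings of semisimple Lie algebras and parabolic subgroups -/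

section Grading

/-- A `|k|`-grading `𝔤 = 𝔤_{-k} ⊕ ⋯ ⊕ 𝔤_0 ⊕ ⋯ ⊕ 𝔤_k` of a Lie algebra, such that `𝔤_-` is generated
by `𝔤_{-1}`. The components are indexed by all integers, with `𝔤_i = 0` for `|i| > k`. -/
structure KGrading (k : ℕ) (𝔤 : Type*) [LieRing 𝔤] [LieAlgebra ℝ 𝔤] where
  component : ℤ → Submodule ℝ 𝔤
  component_eq_bot : ∀ i : ℤ, (k : ℤ) < |i| → component i = ⊥
  isInternal : DirectSum.IsInternal component
  lie_mem : ∀ i j : ℤ, ∀ X ∈ component i, ∀ Y ∈ component j, ⁅X, Y⁆ ∈ component (i + j)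
  generated : (LieSubalgebra.lieSpan ℝ 𝔤 (component (-1) : Set 𝔤)).toSubmodule =
    ⨆ (i : ℤ) (_ : i < 0), component i

variable {k : ℕ} {𝔤 : Type*} [LieRing 𝔤] [LieAlgebra ℝ 𝔤]

/-- The filtration component `𝔤^i = 𝔤_i ⊕ ⋯ ⊕ 𝔤_k`. -/
def KGrading.filtration (γ : KGrading k 𝔤) (i : ℤ) : Submodule ℝ 𝔤 :=
  ⨆ (j : ℤ) (_ : i ≤ j), γ.component j

/-- The parabolic subalgebra `𝔭 = 𝔤^0`. -/
def KGrading.parabolic (γ : KGrading k 𝔤) : Submodule ℝ 𝔤 := γ.filtration 0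

theorem KGrading.component_le_filtration (γ : KGrading k 𝔤) (i : ℤ) :
    γ.component i ≤ γ.filtration i :=
  le_iSup₂_of_le i le_rfl le_rfl

end Grading

noncomputable section Groups

variable {EG : Type*} [NormedAddCommGroup EG] [NormedSpace ℝ EG]
  {G : Type*} [TopologicalSpace G] [ChartedSpace EG G] [Group G]

instance [LieGroup 𝓘(ℝ, EG) ∞ G] : LieGroup 𝓘(ℝ, EG) (minSmoothness ℝ 3) G := by
  rw [minSmoothness_of_isRCLikeNormedField]; infer_instance

/-- The adjoint action `Ad(g)` on the Lie algebra of `G`: the derivative at the identity of the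
conjugation by `g`. -/
def Ad (g : G) : GroupLieAlgebra 𝓘(ℝ, EG) G →L[ℝ] GroupLieAlgebra 𝓘(ℝ, EG) G :=
  mfderiv 𝓘(ℝ, EG) 𝓘(ℝ, EG) (fun h : G ↦ g * h * g⁻¹) 1

/-- The derivative at the identity of a homomorphism of Lie groups. -/
def lieMap {EP : Type*} [NormedAddCommGroup EP] [NormedSpace ℝ EP]
    {P : Type*} [TopologicalSpace P] [ChartedSpace EP P] [Group P] (ι : P →* G) :
    GroupLieAlgebra 𝓘(ℝ, EP) P →L[ℝ] GroupLieAlgebra 𝓘(ℝ, EG) G :=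
  mfderiv 𝓘(ℝ, EP) 𝓘(ℝ, EG) ι 1

/-- `ι : P → G` exhibits the Lie group `P` as the parabolic subgroup `N_G(𝔭)` of `G` determined by
the grading `γ`, with its structure of an embedded Lie subgroup of `G`. -/
structure IsParabolicSubgroup [FiniteDimensional ℝ EG] [LieGroup 𝓘(ℝ, EG) ∞ G] {k : ℕ}
    (γ : KGrading k (GroupLieAlgebra 𝓘(ℝ, EG) G))
    (EP : Type*) [NormedAddCommGroup EP] [NormedSpace ℝ EP]
    {P : Type*} [TopologicalSpace P] [ChartedSpace EP P] [Group P] [LieGroup 𝓘(ℝ, EP) ∞ P]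
    (ι : P →* G) : Prop where
  isSmoothEmbedding : Manifold.IsSmoothEmbedding 𝓘(ℝ, EP) 𝓘(ℝ, EG) ∞ ι
  range_eq : Set.range ι = {g : G | γ.parabolic.map (Ad g).toLinearMap = γ.parabolic}

end Groups

/-! ### Cartan geometries -/

noncomputable section Cartan

/-- A smooth principal bundle `p : 𝓖 → M` with structure group `P`; `act u h` is the principal
right action. -/
structure PrincipalBundle
    (EP : Type*) [NormedAddCommGroup EP] [NormedSpace ℝ EP]
    (P : Type*) [TopologicalSpace P] [ChartedSpace EP P] [Group P] [LieGroup 𝓘(ℝ, EP) ∞ P]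
    (EM : Type*) [NormedAddCommGroup EM] [NormedSpace ℝ EM]
    (M : Type*) [TopologicalSpace M] [ChartedSpace EM M] [IsManifold 𝓘(ℝ, EM) ∞ M]
    (ET : Type*) [NormedAddCommGroup ET] [NormedSpace ℝ ET]
    (𝓖 : Type*) [TopologicalSpace 𝓖] [ChartedSpace ET 𝓖] [IsManifold 𝓘(ℝ, ET) ∞ 𝓖] where
  proj : 𝓖 → M
  act : 𝓖 → P → 𝓖
  act_one : ∀ u, act u 1 = u
  act_mul : ∀ u g h, act u (g * h) = act (act u g) h
  contMDiff_proj : ContMDiff 𝓘(ℝ, ET) 𝓘(ℝ, EM) ∞ proj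
  contMDiff_act : ContMDiff (𝓘(ℝ, ET).prod 𝓘(ℝ, EP)) 𝓘(ℝ, ET) ∞ (fun q : 𝓖 × P ↦ act q.1 q.2)
  /-- Local triviality: near every point there is an equivariant diffeomorphism
  `p⁻¹(U) → U × P` over `U`. -/
  locallyTrivial : ∀ x : M, ∃ U : Set M, IsOpen U ∧ x ∈ U ∧
    ∃ φ : OpenPartialHomeomorph 𝓖 (M × P),
      φ.source = proj ⁻¹' U ∧ φ.target = U ×ˢ Set.univ ∧
      ContMDiffOn 𝓘(ℝ, ET) (𝓘(ℝ, EM).prod 𝓘(ℝ, EP)) ∞ φ φ.source ∧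
      ContMDiffOn (𝓘(ℝ, EM).prod 𝓘(ℝ, EP)) 𝓘(ℝ, ET) ∞ φ.symm φ.target ∧
      ∀ u ∈ proj ⁻¹' U, (φ u).1 = proj u ∧
        ∀ h : P, act u h ∈ proj ⁻¹' U ∧ φ (act u h) = ((φ u).1, (φ u).2 * h)

namespace PrincipalBundle

variable {EP : Type*} [NormedAddCommGroup EP] [NormedSpace ℝ EP]
  {P : Type*} [TopologicalSpace P] [ChartedSpace EP P] [Group P] [LieGroup 𝓘(ℝ, EP) ∞ P]
  {EM : Type*} [NormedAddCommGroup EM] [NormedSpace ℝ EM]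
  {M : Type*} [TopologicalSpace M] [ChartedSpace EM M] [IsManifold 𝓘(ℝ, EM) ∞ M]
  {ET : Type*} [NormedAddCommGroup ET] [NormedSpace ℝ ET]
  {𝓖 : Type*} [TopologicalSpace 𝓖] [ChartedSpace ET 𝓖] [IsManifold 𝓘(ℝ, ET) ∞ 𝓖]
  (B : PrincipalBundle EP P EM M ET 𝓖)

/-- The fundamental vector field `ζ_A(u) = d/dt|₀ (u · exp(tA))`, that is, the image of `A` under the
derivative at the identity of the orbit map `h ↦ u · h`. -/
def fundamentalField (A : GroupLieAlgebra 𝓘(ℝ, EP) P) (u : 𝓖) : TangentSpace 𝓘(ℝ, ET) u :=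
  mfderiv 𝓘(ℝ, EP) 𝓘(ℝ, ET) (fun h ↦ B.act u h) 1 A

theorem proj_surjective : Function.Surjective B.proj := by
  intro x
  obtain ⟨U, -, hx, φ, hs, ht, -, -, h⟩ := B.locallyTrivial x
  have hmem : (x, (1 : P)) ∈ φ.target := by rw [ht]; exact ⟨hx, trivial⟩
  have hsrc := φ.map_target hmem
  rw [hs] at hsrc
  refine ⟨φ.symm (x, 1), ?_⟩
  rw [← (h _ hsrc).1, φ.right_inv hmem]

end PrincipalBundle

/-- A Cartan geometry of type `(G, P)` on `M`, where the Lie group `P` is regarded as a subgroup of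
`G` by means of `ι`: a principal `P`-bundle `p : 𝓖 → M` together with a Cartan connection
`ω ∈ Ω¹(𝓖, 𝔤)`. -/
structure CartanGeometry
    (EG : Type*) [NormedAddCommGroup EG] [NormedSpace ℝ EG]
    {G : Type*} [TopologicalSpace G] [ChartedSpace EG G] [Group G] [LieGroup 𝓘(ℝ, EG) ∞ G]
    (EP : Type*) [NormedAddCommGroup EP] [NormedSpace ℝ EP]
    {P : Type*} [TopologicalSpace P] [ChartedSpace EP P] [Group P] [LieGroup 𝓘(ℝ, EP) ∞ P]
    (ι : P →* G)
    (EM : Type*) [NormedAddCommGroup EM] [NormedSpace ℝ EM]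
    (M : Type*) [TopologicalSpace M] [ChartedSpace EM M] [IsManifold 𝓘(ℝ, EM) ∞ M]
    (ET : Type*) [NormedAddCommGroup ET] [NormedSpace ℝ ET]
    (𝓖 : Type*) [TopologicalSpace 𝓖] [ChartedSpace ET 𝓖] [IsManifold 𝓘(ℝ, ET) ∞ 𝓖]
    extends PrincipalBundle EP P EM M ET 𝓖 where
  /-- The value `ω(u) : T_u 𝓖 → 𝔤` of the Cartan connection, a linear isomorphism. -/
  form : ∀ u : 𝓖, TangentSpace 𝓘(ℝ, ET) u ≃L[ℝ] GroupLieAlgebra 𝓘(ℝ, EG) G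
  /-- The one-form `ω` is smooth: it is smooth as a function on `T𝓖`. -/
  contMDiff_form : ContMDiff (M' := EG) 𝓘(ℝ, ET).tangent 𝓘(ℝ, EG) ∞
    (fun v : TangentBundle 𝓘(ℝ, ET) 𝓖 ↦ form v.1 v.2)
  /-- `(r^h)^* ω = Ad(h)⁻¹ ∘ ω`. -/
  form_act : ∀ (u : 𝓖) (h : P) (v : TangentSpace 𝓘(ℝ, ET) u),
    form (act u h) (mfderiv 𝓘(ℝ, ET) 𝓘(ℝ, ET) (fun w ↦ act w h) u v) = Ad (ι h)⁻¹ (form u v)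
  /-- `ω(ζ_A) = A` for all `A` in the Lie algebra of `P`. -/
  form_fundamental : ∀ (A : GroupLieAlgebra 𝓘(ℝ, EP) P) (u : 𝓖),
    form u (toPrincipalBundle.fundamentalField A u) = lieMap ι A

namespace CartanGeometry

variable {EG : Type*} [NormedAddCommGroup EG] [NormedSpace ℝ EG] [FiniteDimensional ℝ EG]
  {G : Type*} [TopologicalSpace G] [ChartedSpace EG G] [Group G] [LieGroup 𝓘(ℝ, EG) ∞ G]
  {EP : Type*} [NormedAddCommGroup EP] [NormedSpace ℝ EP]
  {P : Type*} [TopologicalSpace P] [ChartedSpace EP P] [Group P] [LieGroup 𝓘(ℝ, EP) ∞ P]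
  {ι : P →* G}
  {EM : Type*} [NormedAddCommGroup EM] [NormedSpace ℝ EM]
  {M : Type*} [TopologicalSpace M] [ChartedSpace EM M] [IsManifold 𝓘(ℝ, EM) ∞ M]
  {ET : Type*} [NormedAddCommGroup ET] [NormedSpace ℝ ET]
  {𝓖 : Type*} [TopologicalSpace 𝓖] [ChartedSpace ET 𝓖] [IsManifold 𝓘(ℝ, ET) ∞ 𝓖]
  (C : CartanGeometry EG EP ι EM M ET 𝓖)

/-- The function `ω(η) : 𝓖 → 𝔤` for a vector field `η` on `𝓖`. -/
def formField (η : ∀ u : 𝓖, TangentSpace 𝓘(ℝ, ET) u) : 𝓖 → EG := fun u ↦ C.form u (η u)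

/-- The exterior derivative `dω(ξ, η) = ξ·ω(η) - η·ω(ξ) - ω([ξ, η])`. -/
def extDerivForm (ξ η : ∀ u : 𝓖, TangentSpace 𝓘(ℝ, ET) u) (u : 𝓖) : GroupLieAlgebra 𝓘(ℝ, EG) G :=
  let ξη : GroupLieAlgebra 𝓘(ℝ, EG) G := mfderiv 𝓘(ℝ, ET) 𝓘(ℝ, EG) (C.formField η) u (ξ u)
  let ηξ : GroupLieAlgebra 𝓘(ℝ, EG) G := mfderiv 𝓘(ℝ, ET) 𝓘(ℝ, EG) (C.formField ξ) u (η u)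
  ξη - ηξ - C.form u (VectorField.mlieBracket 𝓘(ℝ, ET) ξ η u)

/-- The curvature `K(ξ, η) = dω(ξ, η) + [ω(ξ), ω(η)]`. -/
def curvature (ξ η : ∀ u : 𝓖, TangentSpace 𝓘(ℝ, ET) u) (u : 𝓖) : GroupLieAlgebra 𝓘(ℝ, EG) G :=
  C.extDerivForm ξ η u + ⁅C.form u (ξ u), C.form u (η u)⁆

variable {k : ℕ} (γ : KGrading k (GroupLieAlgebra 𝓘(ℝ, EG) G))

/-- The tangent map `T_u p`, as a map to `T_x M` for `x = p(u)`. -/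
def tangentProj {x : M} (u : 𝓖) (_hu : C.proj u = x) :
    TangentSpace 𝓘(ℝ, ET) u →L[ℝ] TangentSpace 𝓘(ℝ, EM) x :=
  mfderiv 𝓘(ℝ, ET) 𝓘(ℝ, EM) C.proj u

/-- The induced filtration of the tangent bundle, `T^i M = 𝓐^i M / 𝓐⁰ M`, where `𝓐M = 𝓖 ×_P 𝔤` is
the adjoint tractor bundle and `𝓐^i M = 𝓖 ×_P 𝔤^i`. The isomorphism `TM ≅ 𝓖 ×_P 𝔤/𝔭 = 𝓐M/𝓐⁰M`
sends the class of `(u, X)` to `T_u p (ω(u)⁻¹ X)`, hence `T^i_x M` consists of the vectors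
`T_u p (ω(u)⁻¹ X)` with `X ∈ 𝔤^i` and `u` over `x`; by equivariance of `ω` and `P`-invariance of
`𝔤^i`, each of the subspaces in the supremum below is already all of `T^i_x M`. -/
def tangentFiltration : TangentFiltration EM M := fun i x ↦
  ⨆ (u : 𝓖) (hu : C.proj u = x),
    ((γ.filtration i).comap (C.form u).toLinearMap).map (C.tangentProj u hu).toLinearMap

/-- Regularity: `κ(T^i M, T^j M) ⊆ 𝓐^{i+j+1} M` for all `i, j < 0`, where the value of the curvature
two-form `κ ∈ Ω²(M, 𝓐M)` on `v, w ∈ T_x M` is the class in `𝓐_x M` of `(u, K(ξ, η)(u))`, for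
any point `u` over `x` and any smooth vector fields `ξ, η` such that `ξ(u), η(u)` are lifts of
`v, w`. -/
def IsRegular : Prop :=
  ∀ i j : ℤ, i < 0 → j < 0 → ∀ ξ η : ∀ u : 𝓖, TangentSpace 𝓘(ℝ, ET) u,
    IsSmoothField ξ → IsSmoothField η → ∀ u : 𝓖,
      C.tangentProj u rfl (ξ u) ∈ C.tangentFiltration γ i (C.proj u) →
      C.tangentProj u rfl (η u) ∈ C.tangentFiltration γ j (C.proj u) →
      C.curvature ξ η u ∈ γ.filtration (i + j + 1)

theorem tangentProj_mem {x : M} (u : 𝓖) (hu : C.proj u = x) (i : ℤ) (X : γ.component i) :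
    C.tangentProj u hu ((C.form u).symm X) ∈ C.tangentFiltration γ i x := by
  refine (le_iSup₂_of_le (f := fun (u : 𝓖) (hu : C.proj u = x) ↦
    ((γ.filtration i).comap (C.form u).toLinearMap).map (C.tangentProj u hu).toLinearMap)
    u hu le_rfl) ?_
  refine ⟨(C.form u).symm X, ?_, rfl⟩
  have := γ.component_le_filtration i X.2
  simpa using this

/-- The isomorphism `𝔤_i → gr_i(T_x M)`, `i < 0`, determined by a point `u` of `𝓖` over `x`: it
sends `X` to the class of `T_u p (ω(u)⁻¹ X)`. These are the components of the identification
`gr(TM) ≅ 𝓖 ×_P gr(𝔤/𝔭) ≅ 𝓖₀ ×_{G₀} 𝔤_-`. -/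
def grFrame {x : M} (u : 𝓖) (hu : C.proj u = x) (i : ℤ) :
    γ.component i →ₗ[ℝ] Gr (C.tangentFiltration γ) x i :=
  Gr.mk (C.tangentFiltration γ) x i ∘ₗ
    LinearMap.codRestrict _
      ((C.tangentProj u hu).toLinearMap ∘ₗ (C.form u).symm.toLinearMap ∘ₗ
        (γ.component i).subtype)
      (C.tangentProj_mem γ u hu i)

/-- The tensorial bracket `{ , } : gr_i(T_x M) × gr_j(T_x M) → gr_{i+j}(T_x M)`, `i, j < 0`,
induced by the Lie bracket `𝔤_i × 𝔤_j → 𝔤_{i+j}` through the isomorphisms `𝔤_l ≅ gr_l(T_x M)`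
determined by a point `u` over `x`; that is, `{[T_u p ω(u)⁻¹ X], [T_u p ω(u)⁻¹ Y]}` is
`[T_u p ω(u)⁻¹ [X, Y]]`. By the `P`-invariance of the bracket on the associated graded of `𝔤` it is
the same for all points `u` over `x`. -/
def algBracket {x : M} {i j : ℤ} (a : Gr (C.tangentFiltration γ) x i)
    (b : Gr (C.tangentFiltration γ) x j) : Gr (C.tangentFiltration γ) x (i + j) :=
  let u := (C.proj_surjective x).choose
  let hu : C.proj u = x := (C.proj_surjective x).choose_spec
  let X : γ.component i := Function.invFun (C.grFrame γ u hu i) a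
  let Y : γ.component j := Function.invFun (C.grFrame γ u hu j) b
  C.grFrame γ u hu (i + j) ⟨⁅(X : GroupLieAlgebra 𝓘(ℝ, EG) G), (Y : GroupLieAlgebra 𝓘(ℝ, EG) G)⁆,
    γ.lie_mem i j X X.2 Y Y.2⟩

end CartanGeometry

/-- An isomorphism of graded Lie algebras from the symbol algebra at `x` of a filtered manifold to
the negative part `𝔤_- = ⨁_{i < 0} 𝔤_i` of a graded Lie algebra. -/
structure SymbolAlgebraIso
    {EM : Type*} [NormedAddCommGroup EM] [NormedSpace ℝ EM] [FiniteDimensional ℝ EM]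
    {M : Type*} [TopologicalSpace M] [ChartedSpace EM M] [IsManifold 𝓘(ℝ, EM) ∞ M] [T2Space M]
    {k : ℕ} {F : TangentFiltration EM M} (hF : IsFilteredManifold k F) (x : M)
    {𝔤 : Type*} [LieRing 𝔤] [LieAlgebra ℝ 𝔤] (γ : KGrading k 𝔤) where
  equiv : ∀ i : ℤ, i < 0 → Gr F x i ≃ₗ[ℝ] γ.component i
  map_bracket : ∀ (i j : ℤ) (hi : i < 0) (hj : j < 0) (a : Gr F x i) (b : Gr F x j),
    (equiv (i + j) (by omega) (hF.leviBracket hi hj a b) : 𝔤) =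
      ⁅(equiv i hi a : 𝔤), (equiv j hj b : 𝔤)⁆

end Cartan

end ParabolicGeometry

/-! The theorem rests on one computation. Let `ξ`, `η` be sections of `T^i M`, `T^j M` with local
lifts `ξ'`, `η'` to `𝓖`, and let `X`, `Y` be the values of `ω(ξ')`, `ω(η')` at `u`. The definition
of curvature reads `ω([ξ', η']) = ξ'·ω(η') - η'·ω(ξ') + [ω(ξ'), ω(η')] - K(ξ', η')`. Near `u` the
functions `ω(ξ')` and `ω(η')` take values in the fixed subspaces `𝔤^i` and `𝔤^j`, so their
derivatives stay there, and both subspaces lie in `𝔤^{i+j+1}` because `i, j ≤ -1`. Since `[ξ', η']`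
projects to `[ξ, η]`, the vector `[ξ, η](x)` is represented by `[X, Y] - K(X, Y)` modulo `𝔤^{i+j+1}`
(`exists_anchor_eq_mlieBracket`). Hence `K(X, Y) ∈ 𝔤^{i+j+1}` exactly when the class of `[ξ, η](x)`
is that of `[X, Y]`, which is the algebraic bracket. Both directions follow, and in the regular case
a frame `𝔤_i ≅ gr_i(T_x M)` carries the bracket of `𝔤_-` to the Levi bracket.

The computation needs `T^i M` to be described at a single point `u`: a vector represented by `X`
lies in `T^i M` iff `X ∈ 𝔤^i` (`anchor_mem_tangentFiltration_iff`). Two facts about `P = N_G(𝔭)`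
give this.

The first is that `Ad(P)` preserves every `𝔤^i` with `i ≤ 0`, although `P` is only assumed to
preserve `𝔭`. The filtration is recovered from `𝔭`: `𝔤^1` is the Killing complement of `𝔭`, and for
`i < 0` an element lies in `𝔤^i` iff `𝔤^1` brackets it into `𝔤^{i+1}`. The latter holds because no
non-zero element of `𝔤_i`, `i < 0`, commutes with `𝔤_1`, which is shown by a trace argument with the
Killing form (`eq_bot_of_stable`).

The second is that the Lie algebra of `P` is `𝔭`, so that vertical vectors are those with `ω`-value
in `𝔭`. One inclusion comes from integral curves of left-invariant fields and a linear ODE, the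
other from `𝔭` being its own normalizer (`range_lieMap`). -/

namespace ParabolicGeometry

/-! ### Algebra of `|k|`-gradings -/

section GradingAlgebra

/-- The trace of a diagonalizable endomorphism with negative eigenvalues is negative. -/
theorem trace_neg_of_eigenvalues_neg {V : Type*} [AddCommGroup V] [Module ℝ V]
    [FiniteDimensional ℝ V] [Nontrivial V] (T : Module.End ℝ V)
    (htop : ⨆ μ, T.eigenspace μ = ⊤) (hneg : ∀ μ, T.HasEigenvalue μ → μ < 0) :
    LinearMap.trace ℝ V T < 0 := by
  have hint : DirectSum.IsInternal T.eigenspace :=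
    DirectSum.isInternal_submodule_of_iSupIndep_of_iSup_eq_top T.eigenspaces_iSupIndep htop
  have hfin : {μ | T.eigenspace μ ≠ ⊥}.Finite :=
    WellFoundedGT.finite_ne_bot_of_iSupIndep T.eigenspaces_iSupIndep
  have hmap : ∀ μ, Set.MapsTo T (T.eigenspace μ) (T.eigenspace μ) := by
    intro μ v hv
    have hv' : T v = μ • v := Module.End.mem_eigenspace_iff.1 hv
    rw [hv']
    exact (T.eigenspace μ).smul_mem _ hv
  rw [LinearMap.trace_eq_sum_trace_restrict' hint hfin hmap]
  have hterm : ∀ μ, LinearMap.trace ℝ _ (T.restrict (hmap μ)) =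
      μ * Module.finrank ℝ (T.eigenspace μ) := by
    intro μ
    have : T.restrict (hmap μ) = μ • LinearMap.id := by
      ext v
      exact Module.End.mem_eigenspace_iff.1 v.2
    rw [this, map_smul, LinearMap.trace_id, smul_eq_mul]
  refine Finset.sum_neg (fun μ hμ ↦ ?_) ?_
  · have hμ' : T.eigenspace μ ≠ ⊥ := by simpa using hμ
    rw [hterm]
    refine mul_neg_of_neg_of_pos (hneg μ hμ') ?_
    have : Nontrivial (T.eigenspace μ) := Submodule.nontrivial_iff_ne_bot.2 hμ'
    exact_mod_cast Module.finrank_pos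
  -- If every eigenspace were zero, their supremum could not be all of the non-trivial space `V`.
  · by_contra h
    rw [Finset.not_nonempty_iff_eq_empty] at h
    have hb : ∀ μ, T.eigenspace μ = ⊥ := by
      intro μ
      by_contra hμ
      have : μ ∈ hfin.toFinset := by simpa using hμ
      rw [h] at this
      simp at this
    simp only [hb, iSup_bot] at htop
    exact bot_ne_top htop

variable {k : ℕ} {𝔤 : Type*} [LieRing 𝔤] [LieAlgebra ℝ 𝔤] (γ : KGrading k 𝔤)

namespace KGrading

/-- The projection of `𝔤` onto `𝔤_i`. -/
noncomputable def proj (i : ℤ) : 𝔤 →ₗ[ℝ] 𝔤 :=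
  (γ.component i).subtype ∘ₗ DirectSum.component ℝ ℤ (fun i ↦ γ.component i) i ∘ₗ
    (LinearEquiv.ofBijective (DirectSum.coeLinearMap γ.component) γ.isInternal).symm.toLinearMap

theorem proj_mem (i : ℤ) (X : 𝔤) : γ.proj i X ∈ γ.component i := Subtype.prop _

theorem ofBijective_symm_of_mem {i : ℤ} {X : 𝔤} (hX : X ∈ γ.component i) :
    (LinearEquiv.ofBijective (DirectSum.coeLinearMap γ.component) γ.isInternal).symm X =
      DirectSum.lof ℝ ℤ (fun i ↦ γ.component i) i ⟨X, hX⟩ := by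
  rw [LinearEquiv.symm_apply_eq]
  exact (DirectSum.coeLinearMap_lof γ.component i ⟨X, hX⟩).symm

theorem proj_of_mem {i : ℤ} {X : 𝔤} (hX : X ∈ γ.component i) : γ.proj i X = X := by
  simp only [proj, LinearMap.comp_apply, LinearEquiv.coe_coe, γ.ofBijective_symm_of_mem hX,
    DirectSum.component.lof_self, Submodule.subtype_apply]

theorem proj_of_mem_ne {i j : ℤ} (hij : i ≠ j) {X : 𝔤} (hX : X ∈ γ.component i) :
    γ.proj j X = 0 := by
  simp only [proj, LinearMap.comp_apply, LinearEquiv.coe_coe, γ.ofBijective_symm_of_mem hX,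
    DirectSum.component.of]
  simp [hij]

theorem iSup_component : ⨆ i, γ.component i = ⊤ := γ.isInternal.submodule_iSup_eq_top

/-- Two linear maps agreeing on all components agree. -/
theorem linearMap_ext {V : Type*} [AddCommGroup V] [Module ℝ V] {f g : 𝔤 →ₗ[ℝ] V}
    (h : ∀ i, ∀ X ∈ γ.component i, f X = g X) : f = g := by
  have : ⊤ ≤ LinearMap.eqLocus f g := by
    rw [← γ.iSup_component]
    exact iSup_le fun i X hX ↦ h i X hX
  ext X
  exact this (Submodule.mem_top : X ∈ ⊤)

theorem component_eq_bot_of_notMem {i : ℤ} (hi : i ∉ Finset.Icc (-(k : ℤ)) k) :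
    γ.component i = ⊥ := by
  refine γ.component_eq_bot i ?_
  by_contra h
  rw [not_lt, abs_le] at h
  exact hi (Finset.mem_Icc.2 h)

theorem sum_proj (X : 𝔤) : ∑ i ∈ Finset.Icc (-(k : ℤ)) k, γ.proj i X = X := by
  have : ∑ i ∈ Finset.Icc (-(k : ℤ)) k, γ.proj i = LinearMap.id := by
    refine γ.linearMap_ext fun i X hX ↦ ?_
    rw [LinearMap.sum_apply, LinearMap.id_apply]
    by_cases hi : i ∈ Finset.Icc (-(k : ℤ)) k
    · rw [Finset.sum_eq_single_of_mem i hi fun j _ hj ↦ γ.proj_of_mem_ne hj.symm hX,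
        γ.proj_of_mem hX]
    · rw [γ.component_eq_bot_of_notMem hi, Submodule.mem_bot] at hX
      simp [hX]
  simpa using LinearMap.congr_fun this X

theorem ext_proj {X Y : 𝔤} (h : ∀ i, γ.proj i X = γ.proj i Y) : X = Y := by
  rw [← γ.sum_proj X, ← γ.sum_proj Y]
  exact Finset.sum_congr rfl fun i _ ↦ h i

theorem mem_filtration_iff {i : ℤ} {X : 𝔤} :
    X ∈ γ.filtration i ↔ ∀ j < i, γ.proj j X = 0 := by
  constructor
  · intro hX j hj
    have : γ.filtration i ≤ LinearMap.ker (γ.proj j) :=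
      iSup₂_le fun l hl Y hY ↦ γ.proj_of_mem_ne (by omega) hY
    exact this hX
  · intro h
    rw [← γ.sum_proj X]
    refine Submodule.sum_mem _ fun j _ ↦ ?_
    by_cases hj : j < i
    · rw [h j hj]; exact Submodule.zero_mem _
    · exact (le_iSup₂_of_le (f := fun j (_ : i ≤ j) ↦ γ.component j) j (not_lt.1 hj) le_rfl)
        (γ.proj_mem j X)

theorem filtration_antitone {i j : ℤ} (h : i ≤ j) : γ.filtration j ≤ γ.filtration i :=
  iSup₂_le fun l hl ↦ le_iSup₂_of_le l (h.trans hl) le_rfl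

theorem filtration_eq_top {i : ℤ} (h : i ≤ -(k : ℤ)) : γ.filtration i = ⊤ := by
  refine eq_top_iff.2 fun X _ ↦ ?_
  rw [← γ.sum_proj X]
  refine Submodule.sum_mem _ fun j hj ↦ ?_
  rw [Finset.mem_Icc] at hj
  exact γ.filtration_antitone (h.trans hj.1) (γ.component_le_filtration j (γ.proj_mem j X))

theorem lie_mem_filtration {i j : ℤ} {X Y : 𝔤} (hX : X ∈ γ.filtration i)
    (hY : Y ∈ γ.filtration j) : ⁅X, Y⁆ ∈ γ.filtration (i + j) := by
  have h1 : ∀ l, i ≤ l → ∀ X ∈ γ.component l, ∀ Y ∈ γ.filtration j,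
      ⁅X, Y⁆ ∈ γ.filtration (i + j) := by
    intro l hl X hX
    have : γ.filtration j ≤ (γ.filtration (i + j)).comap (LieAlgebra.ad ℝ 𝔤 X) :=
      iSup₂_le fun m hm Y hY ↦ γ.filtration_antitone (by omega : i + j ≤ l + m)
        (γ.component_le_filtration _ (γ.lie_mem l m X hX Y hY))
    exact fun Y hY ↦ this hY
  have : γ.filtration i ≤ (γ.filtration (i + j)).comap (LieAlgebra.ad ℝ 𝔤 Y) := by
    refine iSup₂_le fun l hl X hX ↦ ?_
    rw [Submodule.mem_comap, LieAlgebra.ad_apply, ← lie_skew]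
    exact Submodule.neg_mem _ (h1 l hl X hX Y hY)
  rw [← lie_skew]
  exact Submodule.neg_mem _ (this hX)

/-- The bracket descends to the associated graded of the filtration. This is what makes the
algebraic bracket insensitive to the choice of representatives. -/
theorem lie_sub_lie_mem_filtration {i j : ℤ} {X X' Y Y' : 𝔤} (hX : X ∈ γ.filtration i)
    (hY' : Y' ∈ γ.filtration j) (hXX' : X - X' ∈ γ.filtration (i + 1))
    (hYY' : Y - Y' ∈ γ.filtration (j + 1)) : ⁅X, Y⁆ - ⁅X', Y'⁆ ∈ γ.filtration (i + j + 1) := by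
  have h : ⁅X, Y⁆ - ⁅X', Y'⁆ = ⁅X, Y - Y'⁆ + ⁅X - X', Y'⁆ := by
    rw [lie_sub, sub_lie]; abel
  rw [h]
  refine Submodule.add_mem _ ?_ ?_
  · rw [add_assoc]; exact γ.lie_mem_filtration hX hYY'
  · rw [add_right_comm]; exact γ.lie_mem_filtration hXX' hY'

theorem sub_proj_mem_filtration {i : ℤ} {X : 𝔤} (hX : X ∈ γ.filtration i) :
    X - γ.proj i X ∈ γ.filtration (i + 1) := by
  rw [mem_filtration_iff] at hX ⊢
  intro j hj
  rw [map_sub, sub_eq_zero]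
  rcases (show j < i ∨ j = i by omega) with h | rfl
  · rw [hX j h, γ.proj_of_mem_ne h.ne' (γ.proj_mem i X)]
  · rw [γ.proj_of_mem (γ.proj_mem j X)]

theorem proj_lie {i j : ℤ} {X Y : 𝔤} (hX : X ∈ γ.component i) :
    γ.proj (i + j) ⁅X, Y⁆ = ⁅X, γ.proj j Y⁆ := by
  have : γ.proj (i + j) ∘ₗ (LieAlgebra.ad ℝ 𝔤 X) = (LieAlgebra.ad ℝ 𝔤 X) ∘ₗ γ.proj j := by
    refine γ.linearMap_ext fun l Z hZ ↦ ?_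
    simp only [LinearMap.comp_apply, LieAlgebra.ad_apply]
    by_cases hl : l = j
    · subst hl
      rw [γ.proj_of_mem hZ, γ.proj_of_mem (γ.lie_mem _ _ _ hX _ hZ)]
    · rw [γ.proj_of_mem_ne hl hZ, γ.proj_of_mem_ne (by omega) (γ.lie_mem _ _ _ hX _ hZ), lie_zero]
  exact LinearMap.congr_fun this Y

/-- The derivation multiplying the elements of `𝔤_i` by `i`. -/
noncomputable def degree : 𝔤 →ₗ[ℝ] 𝔤 := ∑ i ∈ Finset.Icc (-(k : ℤ)) k, (i : ℝ) • γ.proj i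

theorem degree_of_mem {i : ℤ} {X : 𝔤} (hX : X ∈ γ.component i) : γ.degree X = (i : ℝ) • X := by
  rw [degree, LinearMap.sum_apply]
  by_cases hi : i ∈ Finset.Icc (-(k : ℤ)) k
  · rw [Finset.sum_eq_single_of_mem i hi fun j _ hj ↦ ?_, LinearMap.smul_apply, γ.proj_of_mem hX]
    rw [LinearMap.smul_apply, γ.proj_of_mem_ne hj.symm hX, smul_zero]
  · rw [γ.component_eq_bot_of_notMem hi, Submodule.mem_bot] at hX
    simp [hX]

/-- Degrees add under the bracket, so the Leibniz rule holds on homogeneous elements. The sign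
pattern is the one required by `LieDerivation`. -/
theorem degree_lie (X Y : 𝔤) : γ.degree ⁅X, Y⁆ = ⁅X, γ.degree Y⁆ - ⁅Y, γ.degree X⁆ := by
  rw [← γ.sum_proj X]
  simp only [map_sum, sum_lie, lie_sum, ← Finset.sum_sub_distrib]
  refine Finset.sum_congr rfl fun i _ ↦ ?_
  have : γ.degree ∘ₗ (LieAlgebra.ad ℝ 𝔤 (γ.proj i X)) =
      (LieAlgebra.ad ℝ 𝔤 (γ.proj i X)) ∘ₗ γ.degree +
        LieAlgebra.ad ℝ 𝔤 (γ.degree (γ.proj i X)) := by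
    refine γ.linearMap_ext fun j Z hZ ↦ ?_
    have hX := γ.proj_mem i X
    simp only [LinearMap.comp_apply, LinearMap.add_apply, LieAlgebra.ad_apply]
    rw [γ.degree_of_mem hX, γ.degree_of_mem hZ, γ.degree_of_mem (γ.lie_mem _ _ _ hX _ hZ),
      lie_smul, smul_lie, ← add_smul]
    push_cast
    rw [add_comm]
  have h := LinearMap.congr_fun this Y
  simp only [LinearMap.comp_apply, LinearMap.add_apply, LieAlgebra.ad_apply] at h
  rw [h, ← lie_skew Y, sub_neg_eq_add]

/-- A set of elements commuting with `𝔤_{-1}` commutes with all of `𝔤_-`. -/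
theorem lie_eq_zero_of_lie_neg_one {F : 𝔤} (h : ∀ X ∈ γ.component (-1), ⁅F, X⁆ = 0) {i : ℤ}
    (hi : i < 0) {X : 𝔤} (hX : X ∈ γ.component i) : ⁅F, X⁆ = 0 := by
  have hX' : X ∈ (LieSubalgebra.lieSpan ℝ 𝔤 (γ.component (-1) : Set 𝔤)).toSubmodule := by
    rw [γ.generated]
    exact (le_iSup₂_of_le (f := fun i (_ : i < 0) ↦ γ.component i) i hi le_rfl) hX
  -- The centralizer of `F` is a subalgebra, and `𝔤_{-1}` generates `𝔤_-`.
  refine LieSubalgebra.lieSpan_induction ℝ (p := fun X _ ↦ ⁅F, X⁆ = 0) h (lie_zero F) ?_ ?_ ?_ hX'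
  · intro x y _ _ hx hy
    rw [lie_add, hx, hy, add_zero]
  · intro a x _ hx
    rw [lie_smul, hx, smul_zero]
  · intro x y _ _ hx hy
    rw [leibniz_lie, hx, hy, zero_lie, lie_zero, add_zero]

variable [FiniteDimensional ℝ 𝔤] [LieAlgebra.IsKilling ℝ 𝔤]

/-- The grading element of a `|k|`-graded semisimple Lie algebra. -/
theorem exists_gradingElement : ∃ E ∈ γ.component 0, ∀ i, ∀ X ∈ γ.component i,
    ⁅E, X⁆ = (i : ℝ) • X := by
  let D : LieDerivation ℝ 𝔤 𝔤 := ⟨γ.degree, γ.degree_lie⟩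
  -- Every derivation is inner when the Killing form is non-degenerate.
  have hD : D ∈ (LieDerivation.ad ℝ 𝔤).range := by
    rw [LieDerivation.IsKilling.range_ad_eq_top]; exact LieSubalgebra.mem_top D
  obtain ⟨E, hE⟩ := hD
  have hED : ∀ X, ⁅E, X⁆ = γ.degree X := fun X ↦ by
    exact (LieDerivation.ad_apply_apply ℝ 𝔤 E X).symm.trans (LieDerivation.congr_fun hE X)
  refine ⟨E, ?_, fun i X hX ↦ by rw [hED, γ.degree_of_mem hX]⟩
  -- `[E, E] = 0` says that each component of `E` is annihilated by its degree, so only the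
  -- component in degree zero survives.
  have h0 : γ.degree E = 0 := by rw [← hED, lie_self]
  have h1 : ∀ i, γ.proj i ∘ₗ γ.degree = (i : ℝ) • γ.proj i := by
    refine fun i ↦ γ.linearMap_ext fun j X hX ↦ ?_
    rw [LinearMap.comp_apply, γ.degree_of_mem hX, map_smul, LinearMap.smul_apply]
    by_cases hij : j = i
    · rw [hij]
    · rw [γ.proj_of_mem_ne hij hX, smul_zero, smul_zero]
  have h2 : E = γ.proj 0 E := by
    refine γ.ext_proj fun i ↦ ?_
    by_cases hi : i = 0
    · rw [hi, γ.proj_of_mem (γ.proj_mem 0 E)]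
    · rw [γ.proj_of_mem_ne (Ne.symm hi) (γ.proj_mem 0 E)]
      have := LinearMap.congr_fun (h1 i) E
      rw [LinearMap.comp_apply, h0, map_zero, LinearMap.smul_apply] at this
      exact (smul_eq_zero.1 this.symm).resolve_left (by exact_mod_cast hi)
  rw [h2]
  exact γ.proj_mem 0 E

/-- Invariance of the Killing form `B` under the grading element, `B([X, E], Y) = B(X, [E, Y])`,
gives `-i B(X, Y) = j B(X, Y)`. -/
theorem killingForm_eq_zero {i j : ℤ} (hij : i + j ≠ 0) {X Y : 𝔤} (hX : X ∈ γ.component i)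
    (hY : Y ∈ γ.component j) : killingForm ℝ 𝔤 X Y = 0 := by
  obtain ⟨E, -, hE⟩ := γ.exists_gradingElement
  have h := LieModule.traceForm_apply_lie_apply ℝ 𝔤 𝔤 X E Y
  rw [← lie_skew, hE i X hX, hE j Y hY, map_neg, LinearMap.neg_apply, map_smul, map_smul,
    LinearMap.smul_apply, smul_eq_mul, smul_eq_mul] at h
  have h2 : ((i + j : ℤ) : ℝ) * killingForm ℝ 𝔤 X Y = 0 := by
    push_cast
    change -((i : ℝ) * killingForm ℝ 𝔤 X Y) = (j : ℝ) * killingForm ℝ 𝔤 X Y at h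
    linarith
  exact (mul_eq_zero.1 h2).resolve_left (by exact_mod_cast hij)

theorem killingForm_proj {i : ℤ} {Y : 𝔤} (hY : Y ∈ γ.component (-i)) (X : 𝔤) :
    killingForm ℝ 𝔤 (γ.proj i X) Y = killingForm ℝ 𝔤 X Y := by
  have : (killingForm ℝ 𝔤).flip Y ∘ₗ γ.proj i = (killingForm ℝ 𝔤).flip Y := by
    refine γ.linearMap_ext fun j Z hZ ↦ ?_
    change killingForm ℝ 𝔤 (γ.proj i Z) Y = killingForm ℝ 𝔤 Z Y
    by_cases hj : j = i
    · subst hj; rw [γ.proj_of_mem hZ]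
    · rw [γ.proj_of_mem_ne hj hZ, γ.killingForm_eq_zero (by omega) hZ hY, map_zero,
        LinearMap.zero_apply]
  exact LinearMap.congr_fun this X

/-- The Killing form pairs `𝔤_i` and `𝔤_{-i}` non-degenerately. -/
theorem eq_zero_of_killingForm {i : ℤ} {X : 𝔤} (hX : X ∈ γ.component i)
    (h : ∀ Y ∈ γ.component (-i), killingForm ℝ 𝔤 X Y = 0) : X = 0 := by
  refine (LieAlgebra.IsKilling.killingForm_nondegenerate ℝ 𝔤).1 X fun Y ↦ ?_
  rw [← γ.sum_proj Y, map_sum]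
  refine Finset.sum_eq_zero fun j _ ↦ ?_
  by_cases hj : j = -i
  · subst hj; exact h _ (γ.proj_mem _ Y)
  · exact γ.killingForm_eq_zero (by omega) hX (γ.proj_mem j Y)

/-- A subspace of `𝔤_-` which is stable under `𝔤_{-1}`, `𝔤_0` and `𝔤_1` is trivial. -/
theorem eq_bot_of_stable (J : Submodule ℝ 𝔤) (hJ : J ≤ ⨆ (i : ℤ) (_ : i < 0), γ.component i)
    (hstab : ∀ i : ℤ, |i| ≤ 1 → ∀ Z ∈ γ.component i, ∀ X ∈ J, ⁅Z, X⁆ ∈ J) : J = ⊥ := by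
  obtain ⟨E, hE0, hE⟩ := γ.exists_gradingElement
  by_contra hJb
  have : Nontrivial J := Submodule.nontrivial_iff_ne_bot.2 hJb
  have hEJ : ∀ X ∈ J, LieAlgebra.ad ℝ 𝔤 E X ∈ J := hstab 0 (by simp) E hE0
  -- `N` is the normalizer of `J`, and `ρ` its action on `J`. The trace of `ρ` is represented
  -- through the Killing form by an element whose degree-zero part `F₀` turns out to commute with
  -- `𝔤_-` and `𝔤_+`. Then `B(F₀, E) = 0`, whereas this number is the trace of `E` on `J`, which is
  -- negative unless `J = 0`.
  let N : Submodule ℝ 𝔤 :=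
    { carrier := {Z | ∀ X ∈ J, ⁅Z, X⁆ ∈ J}
      add_mem' := fun {a b} ha hb X hX ↦ by rw [add_lie]; exact J.add_mem (ha X hX) (hb X hX)
      zero_mem' := fun X _ ↦ by rw [zero_lie]; exact J.zero_mem
      smul_mem' := fun c a ha X hX ↦ by rw [smul_lie]; exact J.smul_mem c (ha X hX) }
  let ρ : N →ₗ[ℝ] Module.End ℝ J :=
    { toFun := fun Z ↦ (LieAlgebra.ad ℝ 𝔤 (Z : 𝔤)).restrict Z.2
      map_add' := fun Z Z' ↦ LinearMap.ext fun X ↦ Subtype.ext (add_lie (Z : 𝔤) Z' (X : 𝔤))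
      map_smul' := fun c Z ↦ LinearMap.ext fun X ↦ Subtype.ext (smul_lie c (Z : 𝔤) (X : 𝔤)) }
  -- The extension of the trace functional from `N` to `𝔤` is arbitrary. It is evaluated only at
  -- elements of `N`.
  obtain ⟨χ, hχ⟩ := LinearMap.exists_extend (LinearMap.trace ℝ J ∘ₗ ρ)
  have hχN : ∀ (Z : 𝔤) (hZ : Z ∈ N), χ Z = LinearMap.trace ℝ J (ρ ⟨Z, hZ⟩) := fun Z hZ ↦
    LinearMap.congr_fun hχ ⟨Z, hZ⟩
  let F := (LinearMap.BilinForm.toDual (killingForm ℝ 𝔤)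
    (LieAlgebra.IsKilling.killingForm_nondegenerate ℝ 𝔤)).symm χ
  have hF : ∀ Z, killingForm ℝ 𝔤 F Z = χ Z := fun Z ↦
    LinearMap.BilinForm.apply_toDual_symm_apply (hB :=
      LieAlgebra.IsKilling.killingForm_nondegenerate ℝ 𝔤) χ Z
  let F₀ := γ.proj 0 F
  have hF₀mem : F₀ ∈ γ.component 0 := γ.proj_mem 0 F
  have hF₀ : ∀ Z ∈ γ.component 0, killingForm ℝ 𝔤 F₀ Z = χ Z := fun Z hZ ↦ by
    rw [γ.killingForm_proj (by simpa using hZ), hF]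
  -- For `Y ∈ 𝔤_1`, `B([F₀, X], Y) = B(F₀, [X, Y])` is the trace on `J` of a commutator, hence zero.
  -- Non-degeneracy of the pairing of `𝔤_{-1}` with `𝔤_1` concludes.
  have hF₀neg : ∀ X ∈ γ.component (-1), ⁅F₀, X⁆ = 0 := by
    intro X hX
    refine γ.eq_zero_of_killingForm (i := -1)
      (by simpa using γ.lie_mem 0 (-1) _ hF₀mem X hX) fun Y hY ↦ ?_
    have hY1 : Y ∈ γ.component 1 := by simpa using hY
    have hXN : X ∈ N := fun W hW ↦ hstab (-1) (by simp) X hX W hW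
    have hYN : Y ∈ N := fun W hW ↦ hstab 1 (by simp) Y hY1 W hW
    have hXYN : ⁅X, Y⁆ ∈ N := fun W hW ↦ by
      rw [lie_lie]
      exact J.sub_mem (hXN _ (hYN W hW)) (hYN _ (hXN W hW))
    have hρ : ρ ⟨⁅X, Y⁆, hXYN⟩ = ρ ⟨X, hXN⟩ * ρ ⟨Y, hYN⟩ - ρ ⟨Y, hYN⟩ * ρ ⟨X, hXN⟩ := by
      ext W
      exact lie_lie X Y (W : 𝔤)
    rw [killingForm, LieModule.traceForm_apply_lie_apply]
    change killingForm ℝ 𝔤 F₀ ⁅X, Y⁆ = 0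
    rw [hF₀ _ (by simpa using γ.lie_mem (-1) 1 X hX Y hY1), hχN _ hXYN, hρ, map_sub,
      LinearMap.trace_mul_comm, sub_self]
  have hF₀neg' : ∀ i : ℤ, i < 0 → ∀ X ∈ γ.component i, ⁅F₀, X⁆ = 0 := fun i hi X hX ↦
    γ.lie_eq_zero_of_lie_neg_one hF₀neg hi hX
  -- By invariance, `B([F₀, X], Y) = -B(X, [F₀, Y])`, and `[F₀, Y] = 0` for `Y` in the dual
  -- component `𝔤_{-i}`.
  have hF₀pos : ∀ i : ℤ, 0 < i → ∀ X ∈ γ.component i, ⁅F₀, X⁆ = 0 := by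
    intro i hi X hX
    refine γ.eq_zero_of_killingForm (i := i)
      (by simpa using γ.lie_mem 0 i _ hF₀mem X hX) fun Y hY ↦ ?_
    rw [← lie_skew, map_neg, LinearMap.neg_apply, killingForm,
      LieModule.traceForm_apply_lie_apply, hF₀neg' (-i) (by omega) Y hY, map_zero, neg_zero]
  -- `ad F₀ ∘ ad E = 0`: the factor `ad E` kills `𝔤_0`, and `ad F₀` kills all the other components.
  have hzero : killingForm ℝ 𝔤 F₀ E = 0 := by
    have : (LieAlgebra.ad ℝ 𝔤 F₀) ∘ₗ (LieAlgebra.ad ℝ 𝔤 E) = 0 := by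
      refine γ.linearMap_ext fun i X hX ↦ ?_
      rw [LinearMap.comp_apply, LieAlgebra.ad_apply, LieAlgebra.ad_apply, hE i X hX, lie_smul,
        LinearMap.zero_apply]
      rcases lt_trichotomy i 0 with h | h | h
      · rw [hF₀neg' i h X hX, smul_zero]
      · simp [h]
      · rw [hF₀pos i h X hX, smul_zero]
    rw [killingForm_apply_apply, this, map_zero]
  rw [hF₀ E hE0, hχN E hEJ] at hzero
  -- `ad E` is diagonalizable with the degrees as eigenvalues, and only negative degrees occur in `J
  -- ⊆ 𝔤_-`.
  refine (trace_neg_of_eigenvalues_neg (ρ ⟨E, hEJ⟩) ?_ ?_).ne hzero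
  · refine Module.End.genEigenspace_restrict_eq_top (k := 1) (h := hEJ) ?_
    rw [eq_top_iff, ← γ.iSup_component]
    refine iSup_le fun i ↦ le_iSup_of_le (i : ℝ) fun X hX ↦ ?_
    exact Module.End.mem_eigenspace_iff.2 (hE i X hX)
  · intro μ hμ
    obtain ⟨⟨X, hX⟩, hX0⟩ := hμ.exists_hasEigenvector
    have h1 : ⁅E, X⁆ = μ • X := congrArg Subtype.val hX0.apply_eq_smul
    have hX0' : X ≠ 0 := fun h ↦ hX0.2 (Subtype.ext h)
    obtain ⟨i, hi⟩ : ∃ i, γ.proj i X ≠ 0 := by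
      by_contra! h
      exact hX0' (γ.ext_proj fun i ↦ by rw [h i, map_zero])
    have hi0 : i < 0 := by
      by_contra hi0
      have : (⨆ (i : ℤ) (_ : i < 0), γ.component i) ≤ LinearMap.ker (γ.proj i) :=
        iSup₂_le fun j hj Y hY ↦ γ.proj_of_mem_ne (by omega) hY
      exact hi (this (hJ hX))
    have h2 : (i : ℝ) • γ.proj i X = μ • γ.proj i X := by
      rw [← hE i _ (γ.proj_mem i X), ← γ.proj_lie hE0, h1, zero_add, map_smul]
    rw [← smul_left_injective ℝ hi h2]
    exact_mod_cast hi0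

/-- An element of `𝔤_i`, `i < 0`, commuting with `𝔤_1` vanishes. -/
theorem eq_zero_of_lie_one {i : ℤ} (hi : i < 0) {X : 𝔤} (hX : X ∈ γ.component i)
    (h : ∀ Z ∈ γ.component 1, ⁅Z, X⁆ = 0) : X = 0 := by
  -- `S` drops stability under `𝔤_{-1}` from the hypotheses of `eq_bot_of_stable`. Its largest
  -- member is shown to have that stability automatically, hence to vanish.
  let S : Set (Submodule ℝ 𝔤) := {J | J ≤ (⨆ (i : ℤ) (_ : i < 0), γ.component i) ∧
    ∀ j : ℤ, 0 ≤ j → j ≤ 1 → ∀ Z ∈ γ.component j, J ≤ J.comap (LieAlgebra.ad ℝ 𝔤 Z)}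
  have hsup : sSup S ∈ S := by
    refine ⟨sSup_le fun J hJ ↦ hJ.1, fun j h0 h1 Z hZ ↦ sSup_le fun J hJ ↦ ?_⟩
    exact (hJ.2 j h0 h1 Z hZ).trans (Submodule.comap_mono (le_sSup hJ))
  have hS : sSup S = ⊥ := by
    refine γ.eq_bot_of_stable _ hsup.1 fun j hj Z hZ ↦ ?_
    rw [abs_le] at hj
    by_cases hj0 : 0 ≤ j
    · exact fun X hX ↦ hsup.2 j hj0 hj.2 Z hZ hX
    obtain rfl : j = -1 := by omega
    -- Adding `[𝔤_{-1}, sSup S]` stays inside `S`: in `[Y, [W, V]] = [[Y, W], V] + [W, [Y, V]]` the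
    -- element `[Y, W]` lies in `𝔤_{-1}` for `Y ∈ 𝔤_0` and in `𝔤_0` for `Y ∈ 𝔤_1`. Maximality then
    -- absorbs the added part.
    let J : Submodule ℝ 𝔤 := sSup S ⊔
      ⨆ (W : 𝔤) (_ : W ∈ γ.component (-1)), (sSup S).map (LieAlgebra.ad ℝ 𝔤 W)
    have hJ : J ∈ S := by
      refine ⟨sup_le hsup.1 (iSup₂_le fun W hW ↦ ?_), fun j h0 h1 Y hY ↦ ?_⟩
      · rw [Submodule.map_le_iff_le_comap]
        refine hsup.1.trans (iSup₂_le fun l hl V hV ↦ ?_)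
        exact (le_iSup₂_of_le (f := fun i (_ : i < 0) ↦ γ.component i) (-1 + l) (by omega) le_rfl)
          (γ.lie_mem (-1) l W hW V hV)
      · refine sup_le ((hsup.2 j h0 h1 Y hY).trans (Submodule.comap_mono le_sup_left))
          (iSup₂_le fun W hW ↦ ?_)
        rw [Submodule.map_le_iff_le_comap]
        intro V hV
        have hJmem : ∀ W ∈ γ.component (-1), ∀ V ∈ sSup S, ⁅W, V⁆ ∈ J := fun W hW V hV ↦
          (le_sup_right : _ ≤ J) ((le_iSup₂_of_le (f := fun W (_ : W ∈ γ.component (-1)) ↦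
            (sSup S).map (LieAlgebra.ad ℝ 𝔤 W)) W hW le_rfl) ⟨V, hV, rfl⟩)
        change ⁅Y, ⁅W, V⁆⁆ ∈ J
        rw [leibniz_lie]
        refine J.add_mem ?_ (hJmem W hW _ (hsup.2 j h0 h1 Y hY hV))
        have hYW := γ.lie_mem j (-1) Y hY W hW
        rcases (show j = 0 ∨ j = 1 by omega) with rfl | rfl
        · exact hJmem _ (by simpa using hYW) V hV
        · exact (le_sup_left : _ ≤ J) (hsup.2 0 le_rfl (by norm_num) _ (by simpa using hYW) hV)
    intro X hX
    refine le_sSup hJ ((le_sup_right : _ ≤ J) ?_)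
    exact (le_iSup₂_of_le (f := fun W (_ : W ∈ γ.component (-1)) ↦
            (sSup S).map (LieAlgebra.ad ℝ 𝔤 W)) Z hZ le_rfl) ⟨X, hX, rfl⟩
  -- The elements of `𝔤_i` killed by `𝔤_1` form a `𝔤_0`-stable subspace because `[𝔤_1, 𝔤_0] ⊆ 𝔤_1`,
  -- so they form a member of `S`.
  let V : Submodule ℝ 𝔤 :=
    { carrier := {X | X ∈ γ.component i ∧ ∀ Z ∈ γ.component 1, ⁅Z, X⁆ = 0}
      add_mem' := fun {a b} ha hb ↦ ⟨Submodule.add_mem _ ha.1 hb.1, fun Z hZ ↦ by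
        rw [lie_add, ha.2 Z hZ, hb.2 Z hZ, add_zero]⟩
      zero_mem' := ⟨Submodule.zero_mem _, fun Z _ ↦ lie_zero Z⟩
      smul_mem' := fun c a ha ↦ ⟨Submodule.smul_mem _ c ha.1, fun Z hZ ↦ by
        rw [lie_smul, ha.2 Z hZ, smul_zero]⟩ }
  have hV : V ∈ S := by
    refine ⟨fun Y hY ↦ (le_iSup₂_of_le (f := fun i (_ : i < 0) ↦ γ.component i) i hi le_rfl) hY.1,
      fun j h0 h1 Y hY W hW ↦ ?_⟩
    rcases (show j = 0 ∨ j = 1 by omega) with rfl | rfl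
    · refine ⟨by simpa using γ.lie_mem 0 i Y hY W hW.1, fun Z hZ ↦ ?_⟩
      rw [LieAlgebra.ad_apply, leibniz_lie, hW.2 Z hZ, lie_zero, add_zero]
      exact hW.2 _ (by simpa using γ.lie_mem 1 0 Z hZ Y hY)
    · rw [Submodule.mem_comap, LieAlgebra.ad_apply, hW.2 Y hY]
      exact V.zero_mem
  have hXV : X ∈ V := ⟨hX, h⟩
  have := le_sSup hV hXV
  rwa [hS, Submodule.mem_bot] at this

/-- `𝔤^1` is the orthogonal complement of `𝔭` for the Killing form. -/
theorem mem_filtration_one_iff {X : 𝔤} :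
    X ∈ γ.filtration 1 ↔ ∀ Y ∈ γ.parabolic, killingForm ℝ 𝔤 X Y = 0 := by
  constructor
  · intro hX Y hY
    have h1 : ∀ i : ℤ, 0 ≤ i → ∀ Y ∈ γ.component i, ∀ X ∈ γ.filtration 1,
        killingForm ℝ 𝔤 X Y = 0 := by
      intro i hi Y hY
      have : γ.filtration 1 ≤ LinearMap.ker ((killingForm ℝ 𝔤).flip Y) :=
        iSup₂_le fun l hl Z hZ ↦ γ.killingForm_eq_zero (by omega) hZ hY
      exact fun X hX ↦ this hX
    have : γ.parabolic ≤ LinearMap.ker (killingForm ℝ 𝔤 X) :=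
      iSup₂_le fun l hl Z hZ ↦ h1 l hl Z hZ X hX
    exact this hY
  · intro h
    rw [mem_filtration_iff]
    intro j hj
    refine γ.eq_zero_of_killingForm (γ.proj_mem j X) fun Y hY ↦ ?_
    rw [γ.killingForm_proj hY]
    exact h Y (γ.filtration_antitone (by omega) (γ.component_le_filtration _ hY))

/-- For `i < 0`, `𝔤^i` consists of the elements which `𝔤^1` brackets into `𝔤^{i+1}`. -/
theorem mem_filtration_neg_iff {i : ℤ} (hi : i < 0) {X : 𝔤} :
    X ∈ γ.filtration i ↔ ∀ Z ∈ γ.filtration 1, ⁅Z, X⁆ ∈ γ.filtration (i + 1) := by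
  constructor
  · intro hX Z hZ
    rw [add_comm]
    exact γ.lie_mem_filtration hZ hX
  · intro h
    rw [mem_filtration_iff]
    intro j hj
    -- For `j < i` and `Z ∈ 𝔤_1`, the bracket of `Z` with the degree `j` part of `X` is the degree
    -- `1 + j` part of `[Z, X] ∈ 𝔤^{i+1}`, which vanishes.
    refine γ.eq_zero_of_lie_one (by omega) (γ.proj_mem j X) fun Z hZ ↦ ?_
    rw [← γ.proj_lie hZ]
    exact γ.mem_filtration_iff.1 (h Z (γ.component_le_filtration 1 hZ)) _ (by omega)

/-- The subspaces `𝔤^i`, `i ≤ 0`, are invariant under automorphisms preserving `𝔭`. -/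
theorem map_mem_filtration (φ : 𝔤 ≃ₗ⁅ℝ⁆ 𝔤) (hφ : ∀ X, φ X ∈ γ.parabolic ↔ X ∈ γ.parabolic)
    {i : ℤ} (hi : i ≤ 0) (X : 𝔤) : φ X ∈ γ.filtration i ↔ X ∈ γ.filtration i := by
  -- Automorphisms preserve the Killing form, hence also the complement `𝔤^1` of `𝔭`.
  have h1 : ∀ Z, φ Z ∈ γ.filtration 1 ↔ Z ∈ γ.filtration 1 := by
    intro Z
    rw [mem_filtration_one_iff, mem_filtration_one_iff]
    constructor
    · intro h Y hY
      rw [← LieAlgebra.killingForm_of_equiv_apply φ]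
      exact h _ ((hφ Y).2 hY)
    · intro h Y hY
      obtain ⟨Y, rfl⟩ : ∃ Y', φ Y' = Y := φ.surjective Y
      rw [LieAlgebra.killingForm_of_equiv_apply φ]
      exact h _ ((hφ Y).1 hY)
  obtain ⟨n, rfl⟩ : ∃ n : ℕ, i = -n := ⟨i.natAbs, by omega⟩
  clear hi
  -- Downward induction from `𝔤^0 = 𝔭`: each `𝔤^i` with `i < 0` is expressed by the bracket, `𝔤^1`
  -- and `𝔤^{i+1}`.
  induction n generalizing X with
  | zero => simpa [parabolic] using hφ X
  | succ n ih =>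
    have hn : (-((n + 1 : ℕ) : ℤ)) + 1 = -n := by push_cast; ring
    rw [γ.mem_filtration_neg_iff (by omega), γ.mem_filtration_neg_iff (by omega), hn]
    constructor
    · intro h Z hZ
      refine (ih _).1 ?_
      rw [LieEquiv.map_lie]
      exact h _ ((h1 Z).2 hZ)
    · intro h Z hZ
      obtain ⟨Z, rfl⟩ : ∃ Z', φ Z' = Z := φ.surjective Z
      rw [← LieEquiv.map_lie]
      refine (ih _).2 ?_
      exact h _ ((h1 Z).1 hZ)

/-- `𝔭` is its own normalizer. -/
theorem mem_parabolic_of_lie_mem {X : 𝔤} (h : ∀ Y ∈ γ.parabolic, ⁅X, Y⁆ ∈ γ.parabolic) :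
    X ∈ γ.parabolic := by
  obtain ⟨E, hE0, hE⟩ := γ.exists_gradingElement
  -- Testing against the grading element suffices: the degree `j` part of `[E, X]` is `j` times that
  -- of `X`.
  have hXE := h E (γ.component_le_filtration 0 hE0)
  rw [← lie_skew, Submodule.neg_mem_iff] at hXE
  rw [parabolic, mem_filtration_iff] at hXE ⊢
  intro j hj
  have := hXE j hj
  rw [show j = 0 + j by ring, γ.proj_lie hE0, hE j _ (γ.proj_mem j X)] at this
  exact (smul_eq_zero.1 this).resolve_left (by exact_mod_cast hj.ne)

end KGrading

end GradingAlgebra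

/-! ### Lie brackets of related vector fields -/

section Related

open VectorField Set Filter Topology

/-- Differentiating `Df·U = U' ∘ f` along `v` gives `DU'(Df v) = D²f(v, U) + Df(DU v)`. In the
bracket the second-order terms cancel because `D²f` is symmetric. -/
theorem fderiv_lieBracket_of_related {E F : Type*} [NormedAddCommGroup E] [NormedSpace ℝ E]
    [NormedAddCommGroup F] [NormedSpace ℝ F] {f : E → F} {V W : E → E} {V' W' : F → F} {x : E}
    (hf : ContDiffAt ℝ 2 f x) (hV : DifferentiableAt ℝ V x) (hW : DifferentiableAt ℝ W x)
    (hV' : DifferentiableAt ℝ V' (f x)) (hW' : DifferentiableAt ℝ W' (f x))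
    (hVV' : ∀ᶠ y in 𝓝 x, fderiv ℝ f y (V y) = V' (f y))
    (hWW' : ∀ᶠ y in 𝓝 x, fderiv ℝ f y (W y) = W' (f y)) :
    fderiv ℝ f x (lieBracket ℝ V W x) = lieBracket ℝ V' W' (f x) := by
  have hdf : DifferentiableAt ℝ (fderiv ℝ f) x :=
    (hf.fderiv_right (m := 1) (by norm_num)).differentiableAt (by norm_num)
  have hfx : DifferentiableAt ℝ f x := hf.differentiableAt (by norm_num)
  have key : ∀ {U : E → E} {U' : F → F}, DifferentiableAt ℝ U x → DifferentiableAt ℝ U' (f x) →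
      (∀ᶠ y in 𝓝 x, fderiv ℝ f y (U y) = U' (f y)) → ∀ v,
      fderiv ℝ U' (f x) (fderiv ℝ f x v) =
        fderiv ℝ (fderiv ℝ f) x v (U x) + fderiv ℝ f x (fderiv ℝ U x v) := by
    intro U U' hU hU' h v
    have h1 : HasFDerivAt (fun y ↦ U' (f y)) ((fderiv ℝ U' (f x)).comp (fderiv ℝ f x)) x :=
      hU'.hasFDerivAt.comp x hfx.hasFDerivAt
    have h2 := (hdf.hasFDerivAt.clm_apply hU.hasFDerivAt).congr_of_eventuallyEq
      (f₁ := fun y ↦ U' (f y)) (h.mono fun y hy ↦ hy.symm)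
    have h3 := DFunLike.congr_fun (h1.unique h2) v
    simpa [add_comm] using h3
  have hsymm := hf.isSymmSndFDerivAt (by simp) (V x) (W x)
  rw [lieBracket_eq, lieBracket_eq]
  simp only [map_sub]
  rw [← hVV'.self_of_nhds, ← hWW'.self_of_nhds, key hW hW' hWW', key hV hV' hVV', hsymm]
  abel

variable {E : Type*} [NormedAddCommGroup E] [NormedSpace ℝ E]
  {H : Type*} [TopologicalSpace H] {I : ModelWithCorners ℝ E H}
  {M : Type*} [TopologicalSpace M] [ChartedSpace H M] [IsManifold I ∞ M]

/-- The representative of a vector field in a chart. -/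
noncomputable def chartField (I : ModelWithCorners ℝ E H) (x : M)
    (V : ∀ y : M, TangentSpace I y) : E → E := fun z ↦
  mpullbackWithin 𝓘(ℝ, E) I (extChartAt I x).symm V (range I) z

theorem mfderivWithin_chartField (x : M) (V : ∀ y : M, TangentSpace I y) {z : E}
    (hz : z ∈ (extChartAt I x).target) :
    mfderivWithin 𝓘(ℝ, E) I (extChartAt I x).symm (range I) z (chartField (E := E) I x V z) =
      V ((extChartAt I x).symm z) := by
  obtain ⟨e, he⟩ := isInvertible_mfderivWithin_extChartAt_symm (I := I) hz
  change mfderivWithin 𝓘(ℝ, E) I (extChartAt I x).symm (range I) z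
    ((mfderivWithin 𝓘(ℝ, E) I (extChartAt I x).symm (range I) z).inverse _) = _
  rw [← he, ContinuousLinearMap.inverse_equiv]
  exact e.apply_symm_apply _

theorem chartField_extChartAt (x : M) (V : ∀ y : M, TangentSpace I y) {y : M}
    (hy : y ∈ (extChartAt I x).source) :
    chartField I x V (extChartAt I x y) = mfderiv I 𝓘(ℝ, E) (extChartAt I x) y (V y) := by
  have h := mfderivWithin_chartField x V ((extChartAt I x).map_source hy)
  have h2 := mfderiv_extChartAt_comp_mfderivWithin_extChartAt_symm (I := I)
    ((extChartAt I x).map_source hy)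
  have h3 := DFunLike.congr_fun h2 (chartField I x V (extChartAt I x y))
  change mfderiv I 𝓘(ℝ, E) (extChartAt I x) ((extChartAt I x).symm (extChartAt I x y))
    (mfderivWithin 𝓘(ℝ, E) I (extChartAt I x).symm (range I) (extChartAt I x y)
      (chartField (E := E) I x V (extChartAt I x y))) = chartField I x V (extChartAt I x y) at h3
  rw [h, (extChartAt I x).left_inv hy] at h3
  exact h3.symm

variable [I.Boundaryless]

theorem mlieBracket_eq_chartField (V W : ∀ y : M, TangentSpace I y) (x : M) :
    mfderiv I 𝓘(ℝ, E) (extChartAt I x) x (mlieBracket I V W x) =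
      lieBracket ℝ (chartField I x V) (chartField I x W) (extChartAt I x x) := by
  obtain ⟨e, he⟩ := isInvertible_mfderiv_extChartAt (I := I) (mem_extChartAt_source (I := I) x)
  rw [← mlieBracketWithin_univ, mlieBracketWithin_apply, ← he, ContinuousLinearMap.inverse_equiv]
  refine (e.apply_symm_apply _).trans ?_
  change lieBracketWithin ℝ (chartField I x V) (chartField I x W)
    ((extChartAt I x).symm ⁻¹' univ ∩ range I) (extChartAt I x x) = _
  rw [preimage_univ, univ_inter, I.range_eq_univ, lieBracketWithin_univ]

variable [CompleteSpace E]

theorem differentiableAt_chartField {V : ∀ y : M, TangentSpace I y} {x : M}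
    (hV : MDiffAt (T% V) x) : DifferentiableAt ℝ (chartField I x V) (extChartAt I x x) := by
  have : IsManifold I 2 M := .of_le (n := ∞) (by norm_cast)
  have h : DifferentiableWithinAt ℝ (chartField I x V)
      ((extChartAt I x).symm ⁻¹' univ ∩ range I) (extChartAt I x x) :=
    MDifferentiableWithinAt.differentiableWithinAt_mpullbackWithin_vectorField
      (mdifferentiableWithinAt_univ.2 hV)
  rwa [preimage_univ, univ_inter, I.range_eq_univ, differentiableWithinAt_univ] at h

variable {E' : Type*} [NormedAddCommGroup E'] [NormedSpace ℝ E'] [CompleteSpace E']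
  {H' : Type*} [TopologicalSpace H'] {I' : ModelWithCorners ℝ E' H'} [I'.Boundaryless]
  {N : Type*} [TopologicalSpace N] [ChartedSpace H' N] [IsManifold I' ∞ N]

/-- The Lie bracket is compatible with related vector fields: if `V, W` are `f`-related to
`V', W'`, then so are their Lie brackets. -/
theorem mfderiv_mlieBracket_of_related {f : M → N} {x : M} (hf : ContMDiffAt I I' 2 f x)
    {V W : ∀ y : M, TangentSpace I y} {V' W' : ∀ y : N, TangentSpace I' y}
    (hV : MDiffAt (T% V) x) (hW : MDiffAt (T% W) x)
    (hV' : MDiffAt (T% V') (f x)) (hW' : MDiffAt (T% W') (f x))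
    (hVV' : ∀ᶠ y in 𝓝 x, mfderiv I I' f y (V y) = V' (f y))
    (hWW' : ∀ᶠ y in 𝓝 x, mfderiv I I' f y (W y) = W' (f y)) :
    mfderiv I I' f x (mlieBracket I V W x) = mlieBracket I' V' W' (f x) := by
  let φ := extChartAt I x
  let ψ := extChartAt I' (f x)
  let F : E → E' := ψ ∘ f ∘ φ.symm
  have hxφ : φ.symm (φ x) = x := extChartAt_to_inv x
  have hFx : F (φ x) = ψ (f x) := by simp only [F, Function.comp_apply, hxφ]
  have hFf : ∀ᶠ y in 𝓝 x, MDifferentiableAt I I' f y :=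
    ((contMDiffAt_iff_contMDiffAt_nhds (by norm_num)).1 hf).mono fun y hy ↦
      hy.mdifferentiableAt (by norm_num)
  have hsrc : ∀ᶠ y in 𝓝 x, y ∈ φ.source := extChartAt_source_mem_nhds x
  have hsrc' : ∀ᶠ y in 𝓝 x, f y ∈ ψ.source :=
    hf.continuousAt (extChartAt_source_mem_nhds (f x))
  -- The chain rule for `F ∘ φ = ψ ∘ f`. It moves relatedness into the charts and the resulting
  -- bracket identity back.
  have hderiv : ∀ y ∈ φ.source, f y ∈ ψ.source → MDifferentiableAt I I' f y → ∀ v,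
      fderiv ℝ F (φ y) (mfderiv I 𝓘(ℝ, E) φ y v) =
        mfderiv I' 𝓘(ℝ, E') ψ (f y) (mfderiv I I' f y v) := by
    intro y hy hfy hfd v
    have hφy : φ.symm (φ y) = y := φ.left_inv hy
    have hφd : MDifferentiableAt I 𝓘(ℝ, E) φ y :=
      mdifferentiableAt_extChartAt (by rwa [← extChartAt_source I])
    have hψd : MDifferentiableAt I' 𝓘(ℝ, E') ψ (f y) :=
      mdifferentiableAt_extChartAt (by rwa [← extChartAt_source I'])
    have hφsd : MDifferentiableAt 𝓘(ℝ, E) I φ.symm (φ y) := by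
      have := mdifferentiableWithinAt_extChartAt_symm (I := I) (φ.map_source hy)
      rwa [I.range_eq_univ, mdifferentiableWithinAt_univ] at this
    have hFd : MDifferentiableAt 𝓘(ℝ, E) 𝓘(ℝ, E') F (φ y) := by
      refine MDifferentiableAt.comp (I' := I') (φ y) (g := ψ) (f := f ∘ φ.symm) ?_ ?_
      · rw [Function.comp_apply, hφy]; exact hψd
      · refine MDifferentiableAt.comp (I' := I) (φ y) (g := f) (f := φ.symm) ?_ hφsd
        rw [hφy]; exact hfd
    have heq : F ∘ φ =ᶠ[𝓝 y] ψ ∘ f := by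
      filter_upwards [(isOpen_extChartAt_source (I := I) x).mem_nhds hy] with z hz
      simp only [F, Function.comp_apply, φ.left_inv hz]
    have h1 := heq.mfderiv_eq (I := I) (I' := 𝓘(ℝ, E'))
    rw [mfderiv_comp y hFd hφd, mfderiv_comp y hψd hfd, mfderiv_eq_fderiv] at h1
    exact DFunLike.congr_fun h1 v
  have hF : ContDiffAt ℝ 2 F (φ x) := by
    have := (contMDiffAt_iff.1 hf).2
    rwa [I.range_eq_univ, contDiffWithinAt_univ] at this
  have hrel : ∀ {U : ∀ y : M, TangentSpace I y} {U' : ∀ y : N, TangentSpace I' y},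
      (∀ᶠ y in 𝓝 x, mfderiv I I' f y (U y) = U' (f y)) →
      ∀ᶠ z in 𝓝 (φ x), fderiv ℝ F z (chartField I x U z) = chartField I' (f x) U' (F z) := by
    intro U U' h
    have : ∀ᶠ y in 𝓝 x, fderiv ℝ F (φ y) (chartField I x U (φ y)) =
        chartField I' (f x) U' (F (φ y)) := by
      filter_upwards [h, hFf, hsrc, hsrc'] with y hy hfy hys hfys
      have e1 : F (φ y) = ψ (f y) := by
        simp only [F, Function.comp_apply, φ.left_inv hys]
      rw [e1, chartField_extChartAt x U hys, chartField_extChartAt (f x) U' hfys]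
      erw [hderiv y hys hfys hfy]
      rw [hy]
    have ht : φ.target ∈ 𝓝 (φ x) := extChartAt_target_mem_nhds x
    have hc : Tendsto φ.symm (𝓝 (φ x)) (𝓝 x) := by
      have := continuousAt_extChartAt_symm (I := I) x
      rwa [ContinuousAt, hxφ] at this
    filter_upwards [hc.eventually this, ht] with z hz hzt
    rwa [φ.right_inv hzt] at hz
  have hmain := fderiv_lieBracket_of_related (f := F) hF (differentiableAt_chartField hV)
    (differentiableAt_chartField hW) (by rw [hFx]; exact differentiableAt_chartField hV')
    (by rw [hFx]; exact differentiableAt_chartField hW') (hrel hVV') (hrel hWW')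
  rw [hFx] at hmain
  have h1 := mlieBracket_eq_chartField V W x
  have h2 := mlieBracket_eq_chartField V' W' (f x)
  obtain ⟨e, he⟩ := isInvertible_mfderiv_extChartAt (I := I') (mem_extChartAt_source (I := I') (f x))
  have h3 := hderiv x (mem_extChartAt_source x) (mem_extChartAt_source _) hFf.self_of_nhds
    (mlieBracket I V W x)
  have : Function.Injective (mfderiv I' 𝓘(ℝ, E') ψ (f x)) := by
    rw [← he]; exact e.injective
  apply this
  rw [h2, ← h3, h1]
  exact hmain

end Related

/-! ### Brackets on products, invariant fields on Lie groups and the derivative of the adjoint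
representation. -/

section LieGroups

open VectorField Set Filter Topology Bundle

section Fields

variable {E : Type*} [NormedAddCommGroup E] [NormedSpace ℝ E]
  {H : Type*} [TopologicalSpace H] {I : ModelWithCorners ℝ E H}
  {M : Type*} [TopologicalSpace M] [ChartedSpace H M]

theorem mvfderiv_clm_comp {F F' : Type*} [NormedAddCommGroup F] [NormedSpace ℝ F]
    [NormedAddCommGroup F'] [NormedSpace ℝ F'] (L : F →L[ℝ] F') {f : M → F} {x : M}
    (hf : MDiffAt f x) (v : TangentSpace I x) :
    mvfderiv I (fun y ↦ L (f y)) x v = L (mvfderiv I f x v) := by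
  have h := mfderiv_comp_apply (I := I) (I' := 𝓘(ℝ, F)) (I'' := 𝓘(ℝ, F')) x (g := L) (f := f)
    L.differentiableAt.mdifferentiableAt hf v
  rw [mfderiv_eq_fderiv, L.fderiv] at h
  exact h

variable [IsManifold I ∞ M]

theorem mdifferentiableAt_sum_smul {ι : Type*} (t : Finset ι) {f : ι → M → ℝ}
    {W : ι → ∀ y : M, TangentSpace I y} {x : M}
    (hf : ∀ a, MDiffAt (f a) x) (hW : ∀ a, MDiffAt (T% (W a)) x) :
    MDiffAt (T% (∑ a ∈ t, f a • W a)) x := by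
  classical
  induction t using Finset.induction_on with
  | empty =>
    exact (Bundle.mdifferentiable_zeroSection (𝕜 := ℝ) (IB := I) (F := E)
      (TangentSpace I : M → Type _)) x
  | insert a t ha ih =>
    rw [Finset.sum_insert ha]
    exact mdifferentiableAt_add_section ((hf a).smul_section (hW a)) ih

/-- The Leibniz rule for a field expanded in a frame. It is used for the right-invariant frame of a
group and for the frame of constant fields on `𝓖`. -/
theorem mlieBracket_sum_smul_right [CompleteSpace E] {ι : Type*} (t : Finset ι) {f : ι → M → ℝ}
    {V : ∀ y : M, TangentSpace I y} {W : ι → ∀ y : M, TangentSpace I y} {x : M}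
    (hf : ∀ a, MDiffAt (f a) x) (hW : ∀ a, MDiffAt (T% (W a)) x) :
    mlieBracket I V (∑ a ∈ t, f a • W a) x =
      ∑ a ∈ t, (mvfderiv I (f a) x (V x) • W a x + f a x • mlieBracket I V (W a) x) := by
  have : IsManifold I (minSmoothness ℝ 2) M := by
    rw [minSmoothness_of_isRCLikeNormedField]; infer_instance
  classical
  induction t using Finset.induction_on with
  | empty => simp
  | insert a t ha ih =>
    rw [Finset.sum_insert ha, Finset.sum_insert ha, mlieBracket_add_right
      ((hf a).smul_section (hW a)) (mdifferentiableAt_sum_smul t hf hW), ih,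
      mlieBracket_smul_right (hf a) (hW a)]

variable {E' : Type*} [NormedAddCommGroup E'] [NormedSpace ℝ E']
  {H' : Type*} [TopologicalSpace H'] {I' : ModelWithCorners ℝ E' H'}
  {N : Type*} [TopologicalSpace N] [ChartedSpace H' N] [IsManifold I' ∞ N]

/-- The vector field `(V, W)` on a product of manifolds. -/
def prodField (V : ∀ y : M, TangentSpace I y) (W : ∀ y : N, TangentSpace I' y) (q : M × N) :
    TangentSpace (I.prod I') q := (V q.1, W q.2)

theorem mdifferentiableAt_prodField {V : ∀ y : M, TangentSpace I y}
    {W : ∀ y : N, TangentSpace I' y} {n : ℕ} (hn : n ≠ 0) (hV : ContMDiff I I.tangent n (T% V))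
    (hW : ContMDiff I' I'.tangent n (T% W)) (q : M × N) :
    MDiffAt (T% (prodField V W)) q := by
  have h1 : ContMDiff (I.prod I') (I.tangent.prod I'.tangent) n
      (fun q : M × N ↦ ((⟨q.1, V q.1⟩ : TangentBundle I M), (⟨q.2, W q.2⟩ : TangentBundle I' N))) :=
    (hV.comp contMDiff_fst).prodMk (hW.comp contMDiff_snd)
  have h2 : ContMDiff (I.tangent.prod I'.tangent) (I.prod I').tangent n
      (equivTangentBundleProd I M I' N).symm := contMDiff_equivTangentBundleProd_symm
  exact (h2.comp h1).mdifferentiable (by exact_mod_cast hn) q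

/-- Under each projection one of the two fields is related to zero, so both components of the
bracket vanish. -/
theorem mlieBracket_prodField_zero {V : ∀ y : M, TangentSpace I y}
    {W : ∀ y : N, TangentSpace I' y} [CompleteSpace E] [CompleteSpace E'] [I.Boundaryless] [I'.Boundaryless]
    {n : ℕ} (hn : n ≠ 0) (hV : ContMDiff I I.tangent n (T% V))
    (hW : ContMDiff I' I'.tangent n (T% W)) (q : M × N) :
    mlieBracket (I.prod I') (prodField (I' := I') (N := N) 0 W) (prodField V 0) q = 0 := by
  have h0 : ContMDiff I I.tangent n (T% (0 : ∀ y : M, TangentSpace I y)) :=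
    Bundle.contMDiff_zeroSection ℝ (TangentSpace I : M → Type _)
  have h0' : ContMDiff I' I'.tangent n (T% (0 : ∀ y : N, TangentSpace I' y)) :=
    Bundle.contMDiff_zeroSection ℝ (TangentSpace I' : N → Type _)
  have d1 := mdifferentiableAt_prodField hn h0 hW q
  have d2 := mdifferentiableAt_prodField hn hV h0' q
  have hn' : ((n : ℕ) : ℕ∞ω) ≠ 0 := by exact_mod_cast hn
  have e1 := mfderiv_mlieBracket_of_related (I := I.prod I') (I' := I) (f := Prod.fst) (x := q)
    (contMDiff_fst.contMDiffAt) d1 d2 ((h0 q.1).mdifferentiableAt hn')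
    ((hV q.1).mdifferentiableAt hn') (.of_forall fun y ↦ by rw [mfderiv_fst]; rfl)
    (.of_forall fun y ↦ by rw [mfderiv_fst]; rfl)
  have e2 := mfderiv_mlieBracket_of_related (I := I.prod I') (I' := I') (f := Prod.snd) (x := q)
    (contMDiff_snd.contMDiffAt) d1 d2 ((hW q.2).mdifferentiableAt hn')
    ((h0' q.2).mdifferentiableAt hn') (.of_forall fun y ↦ by rw [mfderiv_snd]; rfl)
    (.of_forall fun y ↦ by rw [mfderiv_snd]; rfl)
  rw [mfderiv_fst, mlieBracket_zero_left] at e1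
  rw [mfderiv_snd, mlieBracket_zero_right] at e2
  exact Prod.ext e1 e2

end Fields

section Groups

variable {E : Type*} [NormedAddCommGroup E] [NormedSpace ℝ E]
  {G : Type*} [TopologicalSpace G] [ChartedSpace E G] [Group G]

/-- The right-invariant vector field with value `Z` at the identity. -/
noncomputable def rightInvariantField (Z : GroupLieAlgebra 𝓘(ℝ, E) G) (g : G) :
    TangentSpace 𝓘(ℝ, E) g :=
  mfderiv 𝓘(ℝ, E) 𝓘(ℝ, E) (fun h ↦ h * g) 1 Z

theorem Ad_one : Ad (1 : G) = ContinuousLinearMap.id ℝ (GroupLieAlgebra 𝓘(ℝ, E) G) := by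
  have : (fun h : G ↦ 1 * h * 1⁻¹) = id := by ext h; simp
  rw [Ad, this, mfderiv_id]

theorem rightInvariantField_one (X : GroupLieAlgebra 𝓘(ℝ, E) G) :
    rightInvariantField X 1 = X := by
  have : (fun x : G ↦ x * 1) = id := by ext x; simp
  rw [rightInvariantField, this, mfderiv_id]; rfl

theorem mulInvariantVectorField_one (X : GroupLieAlgebra 𝓘(ℝ, E) G) :
    mulInvariantVectorField X 1 = X := by
  have : (fun x : G ↦ 1 * x) = id := by ext x; simp
  rw [mulInvariantVectorField, this, mfderiv_id]; rfl

variable [LieGroup 𝓘(ℝ, E) ∞ G]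

/-- The value at `g` is the tangent map of multiplication at `(1, g)` applied to `(Z, 0)`. Class
`C^1` is all that the brackets below require. -/
theorem contMDiff_rightInvariantField (Z : GroupLieAlgebra 𝓘(ℝ, E) G) :
    ContMDiff 𝓘(ℝ, E) 𝓘(ℝ, E).tangent 1 (T% (rightInvariantField Z)) := by
  have h1 : ContMDiff 𝓘(ℝ, E) (𝓘(ℝ, E).tangent.prod 𝓘(ℝ, E).tangent) 1
      (fun g : G ↦ ((⟨1, Z⟩ : TangentBundle 𝓘(ℝ, E) G), (⟨g, 0⟩ : TangentBundle 𝓘(ℝ, E) G))) :=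
    contMDiff_const.prodMk
      (Bundle.contMDiff_zeroSection ℝ (TangentSpace 𝓘(ℝ, E) : G → Type _))
  have h2 : ContMDiff (𝓘(ℝ, E).tangent.prod 𝓘(ℝ, E).tangent) (𝓘(ℝ, E).prod 𝓘(ℝ, E)).tangent 1
      (equivTangentBundleProd 𝓘(ℝ, E) G 𝓘(ℝ, E) G).symm := contMDiff_equivTangentBundleProd_symm
  have h3 : ContMDiff (𝓘(ℝ, E).prod 𝓘(ℝ, E)).tangent 𝓘(ℝ, E).tangent 1
      (tangentMap (𝓘(ℝ, E).prod 𝓘(ℝ, E)) 𝓘(ℝ, E) (fun p : G × G ↦ p.1 * p.2)) :=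
    (contMDiff_mul 𝓘(ℝ, E) ∞).contMDiff_tangentMap (by norm_cast)
  convert! (h3.comp h2).comp h1 with g
  · exact (one_mul g).symm
  · change mfderiv 𝓘(ℝ, E) 𝓘(ℝ, E) (fun h ↦ h * g) 1 Z =
      mfderiv (𝓘(ℝ, E).prod 𝓘(ℝ, E)) 𝓘(ℝ, E) (fun p : G × G ↦ p.1 * p.2) (1, g) (Z, 0)
    refine Eq.trans ?_ (mfderiv_prod_eq_add_apply
      ((contMDiff_mul 𝓘(ℝ, E) ∞).mdifferentiable (by simp) ((1 : G), g))).symm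
    simp +instances only [left_eq_add]
    exact map_zero _

theorem mdifferentiable_mul_left' (g : G) : MDifferentiable 𝓘(ℝ, E) 𝓘(ℝ, E) (fun h ↦ g * h) :=
  (contMDiff_mul_left (I := 𝓘(ℝ, E)) (n := ∞)).mdifferentiable (by simp)

theorem mdifferentiable_mul_right' (g : G) : MDifferentiable 𝓘(ℝ, E) 𝓘(ℝ, E) (fun h ↦ h * g) :=
  (contMDiff_mul_right (I := 𝓘(ℝ, E)) (n := ∞)).mdifferentiable (by simp)

theorem contMDiff_conj (g : G) : ContMDiff 𝓘(ℝ, E) 𝓘(ℝ, E) ∞ (fun h ↦ g * h * g⁻¹) :=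
  (contMDiff_mul_right (I := 𝓘(ℝ, E)) (n := ∞) (a := g⁻¹)).comp
    (contMDiff_mul_left (I := 𝓘(ℝ, E)) (n := ∞) (a := g))

theorem mdifferentiable_conj (g : G) : MDifferentiable 𝓘(ℝ, E) 𝓘(ℝ, E) (fun h ↦ g * h * g⁻¹) :=
  (contMDiff_conj g).mdifferentiable (by simp)

theorem Ad_mul (g h : G) (X : GroupLieAlgebra 𝓘(ℝ, E) G) : Ad (g * h) X = Ad g (Ad h X) := by
  have : (fun x : G ↦ g * h * x * (g * h)⁻¹) = (fun x ↦ g * x * g⁻¹) ∘ (fun x ↦ h * x * h⁻¹) := by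
    ext x; simp [mul_assoc]
  rw [Ad, this]
  exact mfderiv_comp_apply_of_eq _ (mdifferentiable_conj g _) (mdifferentiable_conj h _)
    (by simp) X

theorem Ad_inv_Ad (g : G) (X : GroupLieAlgebra 𝓘(ℝ, E) G) : Ad g⁻¹ (Ad g X) = X := by
  rw [← Ad_mul, inv_mul_cancel, Ad_one]; rfl

theorem Ad_Ad_inv (g : G) (X : GroupLieAlgebra 𝓘(ℝ, E) G) : Ad g (Ad g⁻¹ X) = X := by
  rw [← Ad_mul, mul_inv_cancel, Ad_one]; rfl

theorem rightInvariantField_Ad (g : G) (X : GroupLieAlgebra 𝓘(ℝ, E) G) :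
    rightInvariantField (Ad g X) g = mulInvariantVectorField X g := by
  have : (fun x : G ↦ g * x) = (fun x ↦ x * g) ∘ (fun x ↦ g * x * g⁻¹) := by
    ext x; simp
  rw [mulInvariantVectorField, this]
  exact (mfderiv_comp_apply_of_eq _ (mdifferentiable_mul_right' g 1) (mdifferentiable_conj g _)
    (by simp) X).symm

theorem mfderiv_mul_left_mulInvariantVectorField (g h : G) (X : GroupLieAlgebra 𝓘(ℝ, E) G) :
    mfderiv 𝓘(ℝ, E) 𝓘(ℝ, E) (fun x ↦ g * x) h (mulInvariantVectorField X h) =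
      mulInvariantVectorField X (g * h) := by
  have : (fun x : G ↦ g * h * x) = (fun x ↦ g * x) ∘ (fun x ↦ h * x) := by
    ext x; simp [mul_assoc]
  rw [mulInvariantVectorField, mulInvariantVectorField, this]
  exact (mfderiv_comp_apply_of_eq _ (mdifferentiable_mul_left' g _) (mdifferentiable_mul_left' h _)
    (mul_one h) X).symm

theorem mfderiv_mul_right_rightInvariantField (g h : G) (X : GroupLieAlgebra 𝓘(ℝ, E) G) :
    mfderiv 𝓘(ℝ, E) 𝓘(ℝ, E) (fun x ↦ x * g) h (rightInvariantField X h) =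
      rightInvariantField X (h * g) := by
  have : (fun x : G ↦ x * (h * g)) = (fun x ↦ x * g) ∘ (fun x ↦ x * h) := by
    ext x; simp [mul_assoc]
  rw [rightInvariantField, rightInvariantField, this]
  exact (mfderiv_comp_apply_of_eq _ (mdifferentiable_mul_right' g _) (mdifferentiable_mul_right' h _)
    (one_mul h) X).symm

theorem mfderiv_conj_mulInvariantVectorField (g h : G) (X : GroupLieAlgebra 𝓘(ℝ, E) G) :
    mfderiv 𝓘(ℝ, E) 𝓘(ℝ, E) (fun x ↦ g * x * g⁻¹) h (mulInvariantVectorField X h) =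
      mulInvariantVectorField (Ad g X) (g * h * g⁻¹) := by
  have h1 : (fun x : G ↦ g * x * g⁻¹) ∘ (fun x ↦ h * x) =
      (fun x ↦ g * h * g⁻¹ * x) ∘ (fun x ↦ g * x * g⁻¹) := by
    ext x; simp [mul_assoc]
  have h2 := mfderiv_comp_apply_of_eq _ (mdifferentiable_conj g h)
    (mdifferentiable_mul_left' h 1) (mul_one h) X
  have h3 := mfderiv_comp_apply_of_eq _ (mdifferentiable_mul_left' (g * h * g⁻¹) 1)
    (mdifferentiable_conj g 1) (by simp) X
  rw [h1] at h2
  exact h2.symm.trans h3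

/-- The map `g ↦ Ad(g) Y`. -/
noncomputable def adOrbit (Y : GroupLieAlgebra 𝓘(ℝ, E) G) : G → E := fun g ↦ Ad g Y

/-- `Ad(g)` is the derivative at `1` of a family of maps that is jointly smooth in `(g, h)`, and
such derivatives depend smoothly on the parameter. -/
theorem contMDiff_adOrbit (Y : GroupLieAlgebra 𝓘(ℝ, E) G) :
    ContMDiff 𝓘(ℝ, E) 𝓘(ℝ, E) ∞ (adOrbit Y) := by
  intro g₀
  have h1 : ContMDiff (𝓘(ℝ, E).prod 𝓘(ℝ, E)) 𝓘(ℝ, E) ∞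
      (Function.uncurry fun g h : G ↦ g * h * g⁻¹) :=
    (contMDiff_fst.mul contMDiff_snd).mul contMDiff_fst.inv
  have h2 := ContMDiffAt.mfderiv (x₀ := g₀) (m := ∞) (fun g h : G ↦ g * h * g⁻¹) (fun _ ↦ 1)
    (h1.contMDiffAt) contMDiffAt_const (by simp)
  have h3 := h2.clm_apply (contMDiffAt_const (M' := E) (c := Y))
  refine h3.congr_of_eventuallyEq (.of_forall fun g ↦ ?_)
  -- Source and target base points are both constantly `1`, so the coordinate changes built into
  -- `inTangentCoordinates` are identities.
  have key : ∀ (f : G → G) (ϕ : G → E →L[ℝ] E), f = (fun _ ↦ 1) →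
      inTangentCoordinates 𝓘(ℝ, E) 𝓘(ℝ, E) (fun _ ↦ (1 : G)) f ϕ g₀ g = ϕ g := by
    rintro f ϕ rfl
    rw [inTangentCoordinates_eq (x₀ := g₀) (x := g) _ _ _ (mem_chart_source _ _) (mem_chart_source _ _)]
    ext v
    simp only [ContinuousLinearMap.comp_apply]
    rw [(tangentBundleCore 𝓘(ℝ, E) G).coordChange_self _ _ (mem_chart_source _ _),
      (tangentBundleCore 𝓘(ℝ, E) G).coordChange_self _ _ (mem_chart_source _ _)]
  exact (DFunLike.congr_fun (key _ _ (by ext; simp)) Y).symm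

variable [FiniteDimensional ℝ E]

/-- Conjugation by `g` relates the left-invariant field of `X` to that of `Ad(g) X`. The brackets
are compared at the identity. -/
theorem Ad_lie (g : G) (X Y : GroupLieAlgebra 𝓘(ℝ, E) G) : Ad g ⁅X, Y⁆ = ⁅Ad g X, Ad g Y⁆ := by
  have : CompleteSpace E := FiniteDimensional.complete ℝ E
  have h := mfderiv_mlieBracket_of_related (I := 𝓘(ℝ, E)) (I' := 𝓘(ℝ, E)) (x := (1 : G))
    (f := fun x ↦ g * x * g⁻¹) ((contMDiff_conj g).of_le (by norm_cast) 1)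
    (mdifferentiableAt_mulInvariantVectorField X) (mdifferentiableAt_mulInvariantVectorField Y)
    (mdifferentiableAt_mulInvariantVectorField (Ad g X))
    (mdifferentiableAt_mulInvariantVectorField (Ad g Y))
    (.of_forall fun h ↦ mfderiv_conj_mulInvariantVectorField g h X)
    (.of_forall fun h ↦ mfderiv_conj_mulInvariantVectorField g h Y)
  have h2 : ∀ x : G, x = 1 → (mlieBracket 𝓘(ℝ, E) (mulInvariantVectorField (Ad g X))
      (mulInvariantVectorField (Ad g Y)) x : E) = (⁅Ad g X, Ad g Y⁆ : GroupLieAlgebra 𝓘(ℝ, E) G) := by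
    rintro x rfl
    rfl
  exact h.trans (h2 _ (by simp))

/-- The adjoint action of a group element as an automorphism of the Lie algebra. -/
noncomputable def adEquiv (g : G) :
    GroupLieAlgebra 𝓘(ℝ, E) G ≃ₗ⁅ℝ⁆ GroupLieAlgebra 𝓘(ℝ, E) G :=
  { (Ad g).toLinearMap with
    map_lie' := Ad_lie g _ _
    invFun := Ad g⁻¹
    left_inv := Ad_inv_Ad g
    right_inv := Ad_Ad_inv g }

/-- Multiplication `G × G → G` relates `(0, X^L)` to `X^L` and `(Z^R, 0)` to `Z^R`, and the two
fields on the product commute. -/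
theorem mlieBracket_mulInvariant_rightInvariant (X Z : GroupLieAlgebra 𝓘(ℝ, E) G) (g : G) :
    mlieBracket 𝓘(ℝ, E) (mulInvariantVectorField X) (rightInvariantField Z) g = 0 := by
  have : CompleteSpace E := FiniteDimensional.complete ℝ E
  have hX : ContMDiff 𝓘(ℝ, E) 𝓘(ℝ, E).tangent (1 : ℕ) (T% (mulInvariantVectorField X)) :=
    (contMDiff_mulInvariantVectorField X).of_le (by simp)
  have hZ : ContMDiff 𝓘(ℝ, E) 𝓘(ℝ, E).tangent (1 : ℕ) (T% (rightInvariantField Z)) :=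
    contMDiff_rightInvariantField Z
  have h0 : ContMDiff 𝓘(ℝ, E) 𝓘(ℝ, E).tangent (1 : ℕ)
      (T% (0 : ∀ g : G, TangentSpace 𝓘(ℝ, E) g)) :=
    Bundle.contMDiff_zeroSection ℝ (TangentSpace 𝓘(ℝ, E) : G → Type _)
  have hm : ContMDiff (𝓘(ℝ, E).prod 𝓘(ℝ, E)) 𝓘(ℝ, E) ∞ (fun p : G × G ↦ p.1 * p.2) :=
    contMDiff_mul 𝓘(ℝ, E) ∞
  have h := mfderiv_mlieBracket_of_related (I := 𝓘(ℝ, E).prod 𝓘(ℝ, E)) (I' := 𝓘(ℝ, E))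
    (x := ((1 : G), g)) (f := fun p ↦ p.1 * p.2) (hm.of_le (by norm_cast) _)
    (mdifferentiableAt_prodField one_ne_zero h0 hX _)
    (mdifferentiableAt_prodField one_ne_zero hZ h0 _)
    (hX.mdifferentiable (by simp) _) (hZ.mdifferentiable (by simp) _)
    (.of_forall fun p ↦ by
      rw [mfderiv_prod_eq_add_apply (hm.mdifferentiable (by simp) _)]
      simp only [prodField, Pi.zero_apply, map_zero, zero_add]
      exact mfderiv_mul_left_mulInvariantVectorField p.1 p.2 X)
    (.of_forall fun p ↦ by
      rw [mfderiv_prod_eq_add_apply (hm.mdifferentiable (by simp) _)]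
      simp only [prodField, Pi.zero_apply, map_zero, add_zero]
      exact mfderiv_mul_right_rightInvariantField p.2 p.1 Z)
  rw [mlieBracket_prodField_zero one_ne_zero hZ hX, map_zero] at h
  have h2 : ∀ x : G, x = g → mlieBracket 𝓘(ℝ, E) (mulInvariantVectorField X)
      (rightInvariantField Z) x = 0 →
      mlieBracket 𝓘(ℝ, E) (mulInvariantVectorField X) (rightInvariantField Z) g = 0 := by
    rintro x rfl h
    exact h
  exact h2 _ (one_mul g) h.symm

/-- The derivative of the adjoint representation is the Lie bracket. -/
theorem mvfderiv_adOrbit_one (X Y : GroupLieAlgebra 𝓘(ℝ, E) G) :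
    mvfderiv 𝓘(ℝ, E) (adOrbit Y) (1 : G) X = ⁅X, Y⁆ := by
  have : CompleteSpace E := FiniteDimensional.complete ℝ E
  let b : Module.Basis (Fin (Module.finrank ℝ E)) ℝ (GroupLieAlgebra 𝓘(ℝ, E) G) :=
    Module.finBasis ℝ E
  let L : Fin (Module.finrank ℝ E) → E →L[ℝ] ℝ := fun i ↦
    LinearMap.toContinuousLinearMap ((Module.finBasis ℝ E).coord i)
  let a : Fin (Module.finrank ℝ E) → G → ℝ := fun i g ↦ L i (adOrbit Y g)
  have ha : ∀ i, MDiffAt (a i) (1 : G) := fun i ↦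
    (L i).differentiableAt.mdifferentiableAt.comp (1 : G)
      ((contMDiff_adOrbit Y).mdifferentiable (by simp) 1)
  have hR : ∀ i, MDiffAt (T% (rightInvariantField (b i))) (1 : G) := fun i ↦
    (contMDiff_rightInvariantField _).mdifferentiable (by simp) 1
  -- In the right-invariant frame the left-invariant field of `Y` has the coordinates of `Ad(g) Y`
  -- as coefficients. Since the frame commutes with left-invariant fields, the bracket with that of
  -- `X` merely differentiates these coefficients.
  have hY : (mulInvariantVectorField Y : ∀ g : G, TangentSpace 𝓘(ℝ, E) g) =
      ∑ i, a i • rightInvariantField (b i) := by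
    funext g
    rw [← rightInvariantField_Ad, Finset.sum_apply]
    have h1 : (Ad g Y : GroupLieAlgebra 𝓘(ℝ, E) G) = ∑ i, a i g • b i :=
      (b.sum_repr (Ad g Y)).symm
    rw [h1]
    rw [rightInvariantField, map_sum]
    exact Finset.sum_congr rfl fun i _ ↦ map_smul _ _ _
  have hda : ∀ i, mvfderiv 𝓘(ℝ, E) (a i) (1 : G) X =
      L i (mvfderiv 𝓘(ℝ, E) (F := E) (adOrbit Y) (1 : G) X : E) := by
    intro i
    exact mvfderiv_clm_comp (F := E) (f := adOrbit Y) (L i)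
      ((contMDiff_adOrbit Y).mdifferentiable (by simp) 1) X
  rw [GroupLieAlgebra.bracket_def, hY, mlieBracket_sum_smul_right _ ha hR]
  have hterm : ∀ i, mvfderiv 𝓘(ℝ, E) (a i) (1 : G) (mulInvariantVectorField X 1) •
        rightInvariantField (b i) 1 +
      a i 1 • mlieBracket 𝓘(ℝ, E) (mulInvariantVectorField X)
        (rightInvariantField (b i)) 1 =
      L i (mvfderiv 𝓘(ℝ, E) (F := E) (adOrbit Y) (1 : G) X : E) • b i := by
    intro i
    rw [mlieBracket_mulInvariant_rightInvariant, smul_zero, add_zero, mulInvariantVectorField_one,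
      rightInvariantField_one, hda]
  rw [Finset.sum_congr rfl fun i _ ↦ hterm i]
  exact (b.sum_repr _).symm

end Groups

end LieGroups

/-! ### The Lie algebra of `P` and the invariance of the filtration under `Ad(P)`. -/

section ParabolicSubgroup

open VectorField Set Filter Topology Bundle

/-- An immersion has a local left inverse. -/
theorem _root_.Manifold.IsImmersionAt.exists_mdifferentiableAt_leftInverse
    {E : Type*} [NormedAddCommGroup E] [NormedSpace ℝ E]
    {M : Type*} [TopologicalSpace M] [ChartedSpace E M] [IsManifold 𝓘(ℝ, E) ∞ M]
    {E' : Type*} [NormedAddCommGroup E'] [NormedSpace ℝ E']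
    {N : Type*} [TopologicalSpace N] [ChartedSpace E' N] [IsManifold 𝓘(ℝ, E') ∞ N]
    {f : M → N} {x : M} (h : Manifold.IsImmersionAt 𝓘(ℝ, E) 𝓘(ℝ, E') ∞ f x) :
    ∃ r : N → M, MDifferentiableAt 𝓘(ℝ, E') 𝓘(ℝ, E) r (f x) ∧ ∀ᶠ y in 𝓝 x, r (f y) = y := by
  have hw : ∀ y ∈ h.domChart.source, h.codChart (f y) = h.equiv (h.domChart y, 0) := by
    intro y hy
    have h1 : (h.codChart.extend 𝓘(ℝ, E')) (f ((h.domChart.extend 𝓘(ℝ, E)).symm (h.domChart y))) =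
        h.equiv (h.domChart y, 0) :=
      h.writtenInCharts (by simpa using h.domChart.map_source hy)
    simpa [h.domChart.left_inv hy] using h1
  have hr : ∀ y ∈ h.domChart.source,
      h.domChart.symm (h.equiv.symm (h.codChart (f y))).1 = y := by
    intro y hy
    rw [hw y hy]
    simp [h.domChart.left_inv hy]
  -- In adapted charts the immersion is `v ↦ (v, 0)`, so projection to the first factor inverts it.
  refine ⟨fun z ↦ h.domChart.symm (h.equiv.symm (h.codChart z)).1, ?_, ?_⟩
  · have hx := h.mem_domChart_source
    have d1 := (contMDiffAt_of_mem_maximalAtlas h.codChart_mem_maximalAtlas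
      h.mem_codChart_source).mdifferentiableAt (n := ∞) (by simp)
    have d2 : MDifferentiableAt 𝓘(ℝ, E') 𝓘(ℝ, E) (fun v ↦ (h.equiv.symm v).1)
        (h.codChart (f x)) :=
      ((ContinuousLinearMap.fst ℝ E h.complement).comp
        h.equiv.symm.toContinuousLinearMap).differentiableAt.mdifferentiableAt
    have d3 : MDifferentiableAt 𝓘(ℝ, E) 𝓘(ℝ, E) h.domChart.symm
        (h.equiv.symm (h.codChart (f x))).1 := by
      rw [hw x hx]
      simp only [ContinuousLinearEquiv.symm_apply_apply]
      exact (contMDiffAt_symm_of_mem_maximalAtlas h.domChart_mem_maximalAtlas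
        (h.domChart.map_source hx)).mdifferentiableAt (n := ∞) (by simp)
    exact d3.comp (f x) (d2.comp (f x) d1)
  · filter_upwards [h.domChart.open_source.mem_nhds h.mem_domChart_source] with y hy
    exact hr y hy

variable {E : Type*} [NormedAddCommGroup E] [NormedSpace ℝ E] [FiniteDimensional ℝ E]
  {G : Type*} [TopologicalSpace G] [ChartedSpace E G] [Group G] [LieGroup 𝓘(ℝ, E) ∞ G]

theorem _root_.Submodule.exists_continuousLinearMap_mem_iff_eq_zero (p : Submodule ℝ E) :
    ∃ L : E →L[ℝ] E, ∀ Y, Y ∈ p ↔ L Y = 0 := by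
  obtain ⟨q, hq⟩ := p.exists_isCompl
  refine ⟨(q.projection p hq.symm).toContinuousLinearMap, fun Y ↦ ?_⟩
  conv_lhs => rw [← Submodule.ker_projection hq.symm]
  rfl

/-- Reduces to the identity element through `Ad(gx) Y = Ad(g) (Ad(x) Y)`. -/
theorem mvfderiv_adOrbit (g : G) (X Y : GroupLieAlgebra 𝓘(ℝ, E) G) :
    mvfderiv 𝓘(ℝ, E) (adOrbit Y) g (mulInvariantVectorField X g) = Ad g ⁅X, Y⁆ := by
  have h1 : adOrbit Y ∘ (fun x : G ↦ g * x) = fun x ↦ Ad g (Ad x Y) := by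
    ext x; exact Ad_mul g x Y
  have h2 := mfderiv_comp_apply_of_eq (1 : G) (y := g)
    ((contMDiff_adOrbit Y).mdifferentiable (by simp) g)
    (mdifferentiable_mul_left' g 1) (mul_one g) X
  rw [h1] at h2
  have h3 := mvfderiv_clm_comp (F := E) (F' := E) (f := adOrbit Y) (id (Ad g) : E →L[ℝ] E)
    ((contMDiff_adOrbit Y).mdifferentiable (by simp) 1) X
  have h4 := congrArg (Ad g) (mvfderiv_adOrbit_one X Y)
  exact (h2.symm.trans h3).trans h4

/-- If `c` is an integral curve of the left-invariant vector field generated by `X` and `𝔭` is a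
subspace with `[X, 𝔭] ⊆ 𝔭`, then `Ad(c(t))` preserves `𝔭`. -/
theorem eventually_Ad_mem_of_isMIntegralCurveAt {c : ℝ → G} {X : GroupLieAlgebra 𝓘(ℝ, E) G}
    (hc0 : c 0 = 1) (hc : IsMIntegralCurveAt c (mulInvariantVectorField X) 0)
    (p : Submodule ℝ (GroupLieAlgebra 𝓘(ℝ, E) G)) (hp : ∀ Y ∈ p, ⁅X, Y⁆ ∈ p) :
    ∀ᶠ t in 𝓝 (0 : ℝ), ∀ Y ∈ p, Ad (c t) Y ∈ p := by
  let p' : Submodule ℝ E := p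
  obtain ⟨L, hL⟩ := p'.exists_continuousLinearMap_mem_iff_eq_zero
  let n := Module.finrank ℝ p'
  let b : Module.Basis (Fin n) ℝ p' := Module.finBasis ℝ p'
  let w : Fin n → GroupLieAlgebra 𝓘(ℝ, E) G := fun i ↦ (b i : E)
  have hw : ∀ i, w i ∈ p := fun i ↦ (b i).2
  have hsum : ∀ Y (hY : Y ∈ p), Y = ∑ j, b.repr ⟨Y, hY⟩ j • w j := by
    intro Y hY
    have := congrArg (Subtype.val : p' → E) (b.sum_repr ⟨Y, hY⟩)
    rw [AddSubmonoidClass.coe_finsetSum] at this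
    exact this.symm
  have hAd : ∀ g : G, ∀ Y (hY : Y ∈ p), Ad g Y = ∑ j, b.repr ⟨Y, hY⟩ j • Ad g (w j) := by
    intro g Y hY
    conv_lhs => rw [hsum Y hY]
    have h1 := map_sum (Ad (EG := E) g) (fun j ↦ b.repr ⟨Y, hY⟩ j • w j) Finset.univ
    exact h1.trans (Finset.sum_congr rfl fun j _ ↦ map_smul (Ad (EG := E) g) _ _)
  -- `m` is the matrix of `ad X` on `𝔭`. With `𝔭 = ker L`, the functions `L(Ad(c(t)) w_i)` measure
  -- how far `Ad(c(t))` moves `𝔭` out of itself. They satisfy a linear ODE with coefficients `m` and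
  -- vanish at `t = 0`, hence vanish near `0`.
  let m : Fin n → Fin n → ℝ := fun i j ↦ b.repr ⟨(⁅X, w i⁆ :
    GroupLieAlgebra 𝓘(ℝ, E) G), hp _ (hw i)⟩ j
  let T : (Fin n → E) →L[ℝ] (Fin n → E) :=
    ContinuousLinearMap.pi fun i ↦ ∑ j, m i j • ContinuousLinearMap.proj j
  have hT : ∀ f i, T f i = ∑ j, m i j • f j := by
    intro f i
    simp [T]
  let f : ℝ → Fin n → E := fun t i ↦ L (adOrbit (w i) (c t))
  have hf : ∀ᶠ t in 𝓝 (0 : ℝ), HasDerivAt f (T (f t)) t := by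
    filter_upwards [hc] with t ht
    rw [hasDerivAt_pi]
    intro i
    have h1 : HasMFDerivAt 𝓘(ℝ, E) 𝓘(ℝ, E) (adOrbit (w i)) (c t)
        (mfderiv 𝓘(ℝ, E) 𝓘(ℝ, E) (adOrbit (w i)) (c t)) :=
      ((contMDiff_adOrbit (w i)).mdifferentiable (by simp) (c t)).hasMFDerivAt
    let V : E := mulInvariantVectorField X (c t)
    let D : ℝ →L[ℝ] E := (mfderiv 𝓘(ℝ, E) 𝓘(ℝ, E) (adOrbit (w i)) (c t)).comp
      (ContinuousLinearMap.smulRight (1 : ℝ →L[ℝ] ℝ) V)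
    have h2 : HasFDerivAt (adOrbit (w i) ∘ c) D t := (h1.comp t ht).hasFDerivAt
    have h3 : HasDerivAt (fun t ↦ L (adOrbit (w i) (c t))) _ t :=
      L.hasFDerivAt.comp_hasDerivAt t h2.hasDerivAt
    refine h3.congr_deriv ?_
    have h4 : mfderiv 𝓘(ℝ, E) 𝓘(ℝ, E) (adOrbit (w i)) (c t)
        (mulInvariantVectorField X (c t)) = Ad (c t) ⁅X, w i⁆ := mvfderiv_adOrbit (c t) X (w i)
    have h5 : L (Ad (c t) ⁅X, w i⁆ : GroupLieAlgebra 𝓘(ℝ, E) G) = ∑ j, m i j • f t j := by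
      rw [hAd (c t) _ (hp _ (hw i))]
      exact (map_sum L (fun j ↦ (m i j • Ad (c t) (w j) : E)) Finset.univ).trans
        (Finset.sum_congr rfl fun j _ ↦ L.map_smul (m i j) (Ad (c t) (w j) : E))
    rw [hT, ← h5]
    refine congrArg L (Eq.trans ?_ h4)
    change mfderiv 𝓘(ℝ, E) 𝓘(ℝ, E) (adOrbit (w i)) (c t)
      ((1 : ℝ) • mulInvariantVectorField X (c t)) = _
    rw [one_smul]
  have h0 : f =ᶠ[𝓝 0] fun _ ↦ 0 := by
    refine ODE_solution_unique_of_eventually (v := fun _ f ↦ T f) (s := fun _ ↦ univ)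
      (.of_forall fun t ↦ T.lipschitz.lipschitzOnWith) (hf.mono fun t ht ↦ ⟨ht, trivial⟩)
      (.of_forall fun t ↦ ⟨?_, trivial⟩) ?_
    · rw [map_zero]; exact hasDerivAt_const t 0
    · funext i
      refine (hL _).1 ?_
      change Ad (c 0) (w i) ∈ p
      rw [hc0, Ad_one]
      exact hw i
  filter_upwards [h0] with t ht Y hY
  rw [hAd _ _ hY]
  exact p.sum_mem fun i _ ↦ p.smul_mem _ ((hL _).2 (congrFun ht i))

theorem map_Ad_eq_of_forall_mem {g : G} {p : Submodule ℝ (GroupLieAlgebra 𝓘(ℝ, E) G)}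
    (h : ∀ Y ∈ p, Ad g Y ∈ p) : p.map (Ad g).toLinearMap = p := by
  have : FiniteDimensional ℝ (GroupLieAlgebra 𝓘(ℝ, E) G) := inferInstanceAs (FiniteDimensional ℝ E)
  refine Submodule.eq_of_le_of_finrank_eq ?_
    (LinearEquiv.finrank_map_eq (adEquiv g).toLinearEquiv p)
  rintro _ ⟨Y, hY, rfl⟩
  exact h Y hY

variable {k : ℕ} {γ : KGrading k (GroupLieAlgebra 𝓘(ℝ, E) G)}
  {EP : Type*} [NormedAddCommGroup EP] [NormedSpace ℝ EP]
  {P : Type*} [TopologicalSpace P] [ChartedSpace EP P] [Group P] [LieGroup 𝓘(ℝ, EP) ∞ P]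
  {ι : P →* G}

namespace IsParabolicSubgroup

theorem Ad_mem (hP : IsParabolicSubgroup γ EP ι) (h : P) {X : GroupLieAlgebra 𝓘(ℝ, E) G}
    (hX : X ∈ γ.parabolic) : Ad (ι h) X ∈ γ.parabolic := by
  have : ι h ∈ {g : G | γ.parabolic.map (Ad g).toLinearMap = γ.parabolic} :=
    hP.range_eq ▸ mem_range_self h
  exact this.le ⟨X, hX, rfl⟩

theorem Ad_mem_iff (hP : IsParabolicSubgroup γ EP ι) (h : P) (X : GroupLieAlgebra 𝓘(ℝ, E) G) :
    Ad (ι h) X ∈ γ.parabolic ↔ X ∈ γ.parabolic := by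
  refine ⟨fun hX ↦ ?_, hP.Ad_mem h⟩
  have := hP.Ad_mem h⁻¹ hX
  rwa [map_inv, Ad_inv_Ad] at this

theorem contMDiff (hP : IsParabolicSubgroup γ EP ι) : ContMDiff 𝓘(ℝ, EP) 𝓘(ℝ, E) ∞ ι :=
  hP.isSmoothEmbedding.contMDiff

/-- The integral curve through `1` of the left-invariant field of `X ∈ 𝔭` normalizes `𝔭` for small
times, so it runs in `P`. Lifted differentiably to `P`, its velocity at `0` is a preimage of `X`. -/
theorem le_range_lieMap (hP : IsParabolicSubgroup γ EP ι) :
    γ.parabolic ≤ LinearMap.range (lieMap ι (EG := E) (EP := EP)).toLinearMap := by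
  have : CompleteSpace E := FiniteDimensional.complete ℝ E
  intro X hX
  obtain ⟨c, hc0, hc⟩ := exists_isMIntegralCurveAt_of_contMDiffAt_boundaryless (I := 𝓘(ℝ, E)) (0 : ℝ)
    (((contMDiff_mulInvariantVectorField X).of_le (by simp)).contMDiffAt (x := (1 : G)))
  have hmem : ∀ᶠ t in 𝓝 (0 : ℝ), c t ∈ range ι := by
    filter_upwards [eventually_Ad_mem_of_isMIntegralCurveAt hc0 hc γ.parabolic fun Y hY ↦ by
      simpa using! γ.lie_mem_filtration hX hY] with t ht
    rw [hP.range_eq]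
    exact map_Ad_eq_of_forall_mem ht
  obtain ⟨r, hr, hrι⟩ := (hP.isSmoothEmbedding.isImmersion.isImmersionAt
    1).exists_mdifferentiableAt_leftInverse
  -- `d` is a pointwise lift with no regularity of its own. Because `ι` is a topological embedding
  -- it tends to `1`, which brings it into the region where `r` inverts `ι`. So `r ∘ c`, which is
  -- differentiable at `0`, also lifts `c` near `0`.
  let d : ℝ → P := fun t ↦ Function.invFun ι (c t)
  have hd : ∀ᶠ t in 𝓝 (0 : ℝ), ι (d t) = c t := hmem.mono fun t ht ↦ Function.invFun_eq ht
  have hcd := hc.hasMFDerivAt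
  have hlim : Tendsto d (𝓝 0) (𝓝 1) := by
    rw [hP.isSmoothEmbedding.isEmbedding.tendsto_nhds_iff, map_one, ← hc0]
    exact hcd.continuousAt.tendsto.congr' (hd.mono fun t ht ↦ ht.symm)
  have hdr : ∀ᶠ t in 𝓝 (0 : ℝ), ι (r (c t)) = c t := by
    filter_upwards [hd, hlim.eventually hrι] with t h1 h2
    rw [← h1, h2]
  have hr' : MDifferentiableAt 𝓘(ℝ, E) 𝓘(ℝ, EP) r (c 0) := by rw [hc0, ← map_one ι]; exact hr
  have hrc : r (c 0) = 1 := by rw [hc0, ← map_one ι]; exact hrι.self_of_nhds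
  have hrc' : MDifferentiableAt 𝓘(ℝ, ℝ) 𝓘(ℝ, EP) (fun t ↦ r (c t)) 0 :=
    hr'.comp 0 hcd.mdifferentiableAt
  have h1 := mfderiv_comp_apply_of_eq (0 : ℝ) (y := (1 : P))
    (hP.contMDiff.mdifferentiable (by simp) 1) hrc' hrc (1 : ℝ)
  refine ⟨mfderiv 𝓘(ℝ, ℝ) 𝓘(ℝ, EP) (fun t ↦ r (c t)) 0 (1 : ℝ), h1.symm.trans ?_⟩
  have h2 : mfderiv 𝓘(ℝ, ℝ) 𝓘(ℝ, E) (ι ∘ fun t ↦ r (c t)) 0 = _ :=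
    (Filter.EventuallyEq.mfderiv_eq hdr).trans hcd.mfderiv
  have h3 := DFunLike.congr_fun h2 (1 : ℝ)
  refine h3.trans ?_
  change (1 : ℝ) • mulInvariantVectorField X (c 0) = X
  rw [one_smul, hc0, mulInvariantVectorField_one]

variable [LieAlgebra.IsSemisimple ℝ (GroupLieAlgebra 𝓘(ℝ, E) G)]

/-- For the remaining inclusion, differentiate `Ad(ι h) Y ∈ 𝔭` at `h = 1`: the image of `A`
normalizes `𝔭`, hence lies in `𝔭`. -/
theorem range_lieMap (hP : IsParabolicSubgroup γ EP ι) :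
    LinearMap.range (lieMap ι (EG := E) (EP := EP)).toLinearMap = γ.parabolic := by
  have : FiniteDimensional ℝ (GroupLieAlgebra 𝓘(ℝ, E) G) := inferInstanceAs (FiniteDimensional ℝ E)
  refine le_antisymm ?_ hP.le_range_lieMap
  rintro _ ⟨A, rfl⟩
  refine γ.mem_parabolic_of_lie_mem fun Y hY ↦ ?_
  let p' : Submodule ℝ E := γ.parabolic
  obtain ⟨L, hL⟩ := p'.exists_continuousLinearMap_mem_iff_eq_zero
  refine (hL _).2 ?_
  have hι := hP.contMDiff.mdifferentiable (by simp) (1 : P)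
  have hY1 := (contMDiff_adOrbit Y).mdifferentiable (by simp) (1 : G)
  have h0 : (fun h ↦ L (adOrbit Y (ι h))) = fun _ : P ↦ (0 : E) :=
    funext fun h ↦ (hL _).1 (hP.Ad_mem h hY)
  have hcomp : MDifferentiableAt 𝓘(ℝ, EP) 𝓘(ℝ, E) (fun h ↦ adOrbit Y (ι h)) (1 : P) :=
    MDifferentiableAt.comp (1 : P) (by rw [map_one]; exact hY1) hι
  have h1 := mvfderiv_clm_comp (I := 𝓘(ℝ, EP)) (F := E) L hcomp A
  rw [h0] at h1
  have h2 : mvfderiv 𝓘(ℝ, EP) (fun h ↦ adOrbit Y (ι h)) (1 : P) A =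
      ⁅lieMap (EG := E) ι A, Y⁆ := by
    refine Eq.trans ?_ (mvfderiv_adOrbit_one (lieMap (EG := E) ι A) Y)
    exact mfderiv_comp_apply_of_eq (1 : P) (y := (1 : G)) hY1 hι (map_one ι) A
  rw [h2] at h1
  refine h1.symm.trans ?_
  change mfderiv 𝓘(ℝ, EP) 𝓘(ℝ, E) (fun _ : P ↦ (0 : E)) 1 A = 0
  rw [mfderiv_const]
  rfl

theorem Ad_mem_filtration_iff (hP : IsParabolicSubgroup γ EP ι) (h : P) {i : ℤ} (hi : i ≤ 0)
    (X : GroupLieAlgebra 𝓘(ℝ, E) G) : Ad (ι h) X ∈ γ.filtration i ↔ X ∈ γ.filtration i :=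
  have : FiniteDimensional ℝ (GroupLieAlgebra 𝓘(ℝ, E) G) := inferInstanceAs (FiniteDimensional ℝ E)
  γ.map_mem_filtration (adEquiv (ι h)) (hP.Ad_mem_iff h) hi X

end IsParabolicSubgroup

end ParabolicSubgroup

/-! ### Constant vector fields and tensoriality of the curvature. -/

namespace CartanGeometry

noncomputable section Curvature

open VectorField Set Filter Topology Bundle

variable {EG : Type*} [NormedAddCommGroup EG] [NormedSpace ℝ EG]
  {G : Type*} [TopologicalSpace G] [ChartedSpace EG G] [Group G] [LieGroup 𝓘(ℝ, EG) ∞ G]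
  {EP : Type*} [NormedAddCommGroup EP] [NormedSpace ℝ EP]
  {P : Type*} [TopologicalSpace P] [ChartedSpace EP P] [Group P] [LieGroup 𝓘(ℝ, EP) ∞ P]
  {ι : P →* G}
  {EM : Type*} [NormedAddCommGroup EM] [NormedSpace ℝ EM]
  {M : Type*} [TopologicalSpace M] [ChartedSpace EM M] [IsManifold 𝓘(ℝ, EM) ∞ M]
  {ET : Type*} [NormedAddCommGroup ET] [NormedSpace ℝ ET]
  {𝓖 : Type*} [TopologicalSpace 𝓖] [ChartedSpace ET 𝓖] [IsManifold 𝓘(ℝ, ET) ∞ 𝓖]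
  (C : CartanGeometry EG EP ι EM M ET 𝓖)

/-- The Cartan connection with values in the vector space underlying `𝔤`. -/
def formLin (u : 𝓖) : TangentSpace 𝓘(ℝ, ET) u →ₗ[ℝ] EG := (C.form u).toLinearMap

/-- The constant vector field `ω⁻¹(X)` on `𝓖`. -/
def constantField (X : EG) (u : 𝓖) : TangentSpace 𝓘(ℝ, ET) u :=
  (C.form u).symm X

theorem formLin_constantField (X : EG) (u : 𝓖) : C.formLin u (C.constantField X u) = X :=
  (C.form u).apply_symm_apply X

theorem constantField_formLin (u : 𝓖) (v : TangentSpace 𝓘(ℝ, ET) u) :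
    C.constantField (C.formLin u v) u = v :=
  (C.form u).symm_apply_apply v

theorem formLin_injective (u : 𝓖) : Function.Injective (C.formLin u) := (C.form u).injective

theorem mdifferentiableAt_formField {η : ∀ u : 𝓖, TangentSpace 𝓘(ℝ, ET) u} {u : 𝓖}
    (hη : MDiffAt (T% η) u) : MDifferentiableAt 𝓘(ℝ, ET) 𝓘(ℝ, EG) (C.formField η) u :=
  (C.contMDiff_form.mdifferentiable (by simp) _).comp u hη

theorem formField_constantField (X : EG) : C.formField (C.constantField X) = fun _ ↦ X :=
  funext (C.formLin_constantField X)

theorem mvfderiv_formField_constantField (X : EG) (u : 𝓖) (v : TangentSpace 𝓘(ℝ, ET) u) :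
    mvfderiv 𝓘(ℝ, ET) (C.formField (C.constantField X)) u v = 0 := by
  rw [formField_constantField]
  change mfderiv 𝓘(ℝ, ET) 𝓘(ℝ, EG) (fun _ : 𝓖 ↦ X) u v = 0
  rw [mfderiv_const]; rfl

theorem extDerivForm_eq (ξ η : ∀ u : 𝓖, TangentSpace 𝓘(ℝ, ET) u) (u : 𝓖) :
    (C.extDerivForm ξ η u : EG) = mvfderiv 𝓘(ℝ, ET) (C.formField η) u (ξ u) -
      mvfderiv 𝓘(ℝ, ET) (C.formField ξ) u (η u) - C.formLin u (mlieBracket 𝓘(ℝ, ET) ξ η u) :=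
  rfl

variable [FiniteDimensional ℝ ET]

/-- In a trivialization of `T𝓖` the form `ω` becomes a smooth family `Φ` of invertible operators,
and inversion of operators is smooth. -/
theorem isSmoothField_constantField (X : EG) :
    IsSmoothField (C.constantField X) := by
  intro u₀
  have : CompleteSpace ET := FiniteDimensional.complete ℝ ET
  let e := trivializationAt ET (TangentSpace 𝓘(ℝ, ET) : 𝓖 → Type _) u₀
  have hu₀ : u₀ ∈ e.baseSet := FiberBundle.mem_baseSet_trivializationAt ET _ u₀
  let Φ : 𝓖 → ET →L[ℝ] EG := fun u ↦ (C.form u).toContinuousLinearMap ∘L e.symmL ℝ u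
  have hΦv : ∀ v : ET, ContMDiffAt 𝓘(ℝ, ET) 𝓘(ℝ, EG) ∞ (fun u ↦ Φ u v) u₀ := by
    intro v
    have h1 : ContMDiffOn 𝓘(ℝ, ET) 𝓘(ℝ, ET).tangent ∞
        (fun u ↦ e.toOpenPartialHomeomorph.symm (u, v)) e.baseSet :=
      (e.contMDiffOn_symm (n := ∞) (IB := 𝓘(ℝ, ET))).comp (contMDiffOn_id.prodMk contMDiffOn_const)
        fun u hu ↦ e.mem_target.2 hu
    have h2 := (C.contMDiff_form.comp_contMDiffOn h1).contMDiffAt (e.open_baseSet.mem_nhds hu₀)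
    refine h2.congr_of_eventuallyEq ?_
    filter_upwards [e.open_baseSet.mem_nhds hu₀] with u hu
    have h3 : e.toOpenPartialHomeomorph.symm (u, v) = ⟨u, e.symmL ℝ u v⟩ := by
      rw [e.symmL_apply hu]
      exact (e.mk_symm hu v).symm
    simp only [Function.comp]
    rw [h3]
    rfl
  let b := Module.finBasis ℝ ET
  let c : Fin (Module.finrank ℝ ET) → ET →L[ℝ] ℝ := fun a ↦ (b.coord a).toContinuousLinearMap
  have hΦ : ContMDiffAt 𝓘(ℝ, ET) 𝓘(ℝ, ET →L[ℝ] EG) ∞ Φ u₀ := by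
    -- Smoothness in the space of operators is reduced to smoothness of `Φ` on the vectors of a
    -- finite basis.
    have h1 : Φ = fun u ↦ ∑ a, ContinuousLinearMap.smulRightL ℝ ET EG (c a) (Φ u (b a)) := by
      funext u
      refine ContinuousLinearMap.coe_injective (b.ext fun i ↦ ?_)
      simp [c, Finsupp.single_apply]
    rw [h1]
    refine ContMDiffAt.sum fun a _ ↦ ?_
    exact (ContinuousLinearMap.smulRightL ℝ ET EG (c a)).contMDiff.contMDiffAt.comp u₀ (hΦv (b a))
  have hΦe : ∀ u (hu : u ∈ e.baseSet),
      Φ u = (((e.continuousLinearEquivAt ℝ u hu).symm.trans (C.form u) : ET ≃L[ℝ] EG) :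
        ET →L[ℝ] EG) := by
    intro u hu
    ext v
    have h1 := congrFun (e.symm_continuousLinearEquivAt_eq (R := ℝ) hu) v
    exact congrArg (C.form u) h1.symm
  have hinv : ContMDiffAt 𝓘(ℝ, ET) 𝓘(ℝ, EG →L[ℝ] ET) ∞ (fun u ↦ (Φ u).inverse) u₀ := by
    refine ContMDiffAt.comp (I' := 𝓘(ℝ, ET →L[ℝ] EG)) u₀ (g := ContinuousLinearMap.inverse) ?_ hΦ
    rw [hΦe u₀ hu₀]
    exact (contDiffAt_map_inverse _).contMDiffAt
  refine (Bundle.contMDiffAt_section u₀).2 ?_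
  refine (hinv.clm_apply (contMDiffAt_const (M' := EG) (c := X))).congr_of_eventuallyEq ?_
  filter_upwards [e.open_baseSet.mem_nhds hu₀] with u hu
  rw [hΦe u hu, ContinuousLinearMap.inverse_equiv]
  change (e ⟨u, C.constantField X u⟩).2 = e.continuousLinearEquivAt ℝ u hu ((C.form u).symm X)
  exact (congrFun (e.continuousLinearEquivAt_apply ℝ u hu) _).symm

theorem mdifferentiableAt_constantField (X : EG) (u : 𝓖) :
    MDiffAt (T% (C.constantField X)) u :=
  (C.isSmoothField_constantField X).mdifferentiable (by simp) u

variable [FiniteDimensional ℝ EG]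

/-- `ξ·ω(η) - ω([ξ, η])` depends only on the value of `η` at the point. -/
theorem mvfderiv_formField_sub_formLin_mlieBracket {ξ η : ∀ u : 𝓖, TangentSpace 𝓘(ℝ, ET) u} {u : 𝓖}
    (hη : MDiffAt (T% η) u) :
    mvfderiv 𝓘(ℝ, ET) (C.formField η) u (ξ u) - C.formLin u (mlieBracket 𝓘(ℝ, ET) ξ η u) =
      -C.formLin u (mlieBracket 𝓘(ℝ, ET) ξ (C.constantField (C.formLin u (η u))) u) := by
  have : CompleteSpace ET := FiniteDimensional.complete ℝ ET
  let b := Module.finBasis ℝ EG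
  let c : Fin (Module.finrank ℝ EG) → EG →L[ℝ] ℝ := fun a ↦ (b.coord a).toContinuousLinearMap
  have hc : ∀ X : EG, ∑ a, c a X • b a = X := b.sum_repr
  -- Expand `η` in the global frame `ω⁻¹(b_a)`. The derivatives of the coefficients reassemble to
  -- `ξ·ω(η)`, and the remaining sum involves `η` only through its value at `u`.
  have key : ∀ η : ∀ u : 𝓖, TangentSpace 𝓘(ℝ, ET) u, MDiffAt (T% η) u →
      C.formLin u (mlieBracket 𝓘(ℝ, ET) ξ η u) = mvfderiv 𝓘(ℝ, ET) (C.formField η) u (ξ u) +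
        ∑ a, c a (C.formLin u (η u)) •
          C.formLin u (mlieBracket 𝓘(ℝ, ET) ξ (C.constantField (b a)) u) := by
    intro η hη
    have hf := C.mdifferentiableAt_formField hη
    let g : Fin (Module.finrank ℝ EG) → 𝓖 → ℝ := fun a v ↦ c a (C.formField η v)
    have hg : ∀ a, MDiffAt (g a) u := fun a ↦
      (c a).differentiableAt.mdifferentiableAt.comp u hf
    have hsum : η = ∑ a, g a • C.constantField (b a) := by
      funext v
      rw [Finset.sum_apply]
      apply C.formLin_injective v
      rw [map_sum]
      refine Eq.trans (hc (C.formLin v (η v))).symm (Finset.sum_congr rfl fun a _ ↦ ?_)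
      refine Eq.trans ?_ (map_smul (C.formLin v) (g a v) (C.constantField (b a) v)).symm
      rw [formLin_constantField]
      rfl
    have hdg : ∀ a, mvfderiv 𝓘(ℝ, ET) (g a) u (ξ u) =
        c a (mvfderiv 𝓘(ℝ, ET) (C.formField η) u (ξ u)) := fun a ↦
      mvfderiv_clm_comp (c a) hf (ξ u)
    have h1 : mlieBracket 𝓘(ℝ, ET) ξ η u = _ :=
      (congrArg (fun ζ ↦ mlieBracket 𝓘(ℝ, ET) ξ ζ u) hsum).trans
        (mlieBracket_sum_smul_right _ hg fun a ↦ C.mdifferentiableAt_constantField _ u)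
    rw [h1, map_sum]
    simp only [map_add, map_smul, formLin_constantField]
    rw [Finset.sum_add_distrib]
    congr 1
    simp only [hdg, hc]
  have h1 := key η hη
  have h2 := key _ (C.mdifferentiableAt_constantField (C.formLin u (η u)) u)
  rw [mvfderiv_formField_constantField, formLin_constantField, zero_add] at h2
  rw [h1, h2]
  abel

/-- The curvature function `K(ω⁻¹(X), ω⁻¹(Y))(u)`. -/
def curvatureFunction (u : 𝓖) (X Y : GroupLieAlgebra 𝓘(ℝ, EG) G) : GroupLieAlgebra 𝓘(ℝ, EG) G :=
  C.curvature (C.constantField X) (C.constantField Y) u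

/-- The curvature is tensorial. -/
theorem curvature_eq_curvatureFunction {ξ η : ∀ u : 𝓖, TangentSpace 𝓘(ℝ, ET) u} {u : 𝓖}
    (hξ : MDiffAt (T% ξ) u) (hη : MDiffAt (T% η) u) :
    C.curvature ξ η u = C.curvatureFunction u (C.form u (ξ u)) (C.form u (η u)) := by
  -- `h1` replaces `η` by the constant field with the same value at `u`. `h2` then does this for
  -- `ξ`, after the slots are exchanged by antisymmetry of the bracket.
  have h1 := C.mvfderiv_formField_sub_formLin_mlieBracket (ξ := ξ) hη
  have h2 := C.mvfderiv_formField_sub_formLin_mlieBracket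
    (ξ := C.constantField (C.formLin u (η u))) hξ
  rw [constantField_formLin, mlieBracket_swap_apply (W := ξ), mlieBracket_swap_apply
    (V := C.constantField (C.formLin u (η u))), map_neg, map_neg] at h2
  have h3 : (C.extDerivForm ξ η u : EG) = C.extDerivForm (C.constantField (C.formLin u (ξ u)))
      (C.constantField (C.formLin u (η u))) u := by
    rw [extDerivForm_eq, extDerivForm_eq, mvfderiv_formField_constantField,
      mvfderiv_formField_constantField]
    have h4 : mvfderiv 𝓘(ℝ, ET) (C.formField ξ) u (η u) = _ := eq_sub_of_add_eq
      ((sub_neg_eq_add _ _).symm.trans h2)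
    rw [h4, sub_right_comm, h1]
    abel
  rw [curvature, curvatureFunction, curvature]
  refine congrArg₂ (fun x y : GroupLieAlgebra 𝓘(ℝ, EG) G ↦ x + y) h3 ?_
  exact congrArg₂ (fun x y : GroupLieAlgebra 𝓘(ℝ, EG) G ↦ ⁅x, y⁆)
    (C.formLin_constantField _ u).symm (C.formLin_constantField _ u).symm

end Curvature

end CartanGeometry

open VectorField Set Filter Topology Bundle

/-! ### Local sections, vertical vectors and lifts in a principal bundle. -/

namespace PrincipalBundle

variable {EP : Type*} [NormedAddCommGroup EP] [NormedSpace ℝ EP]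
  {P : Type*} [TopologicalSpace P] [ChartedSpace EP P] [Group P] [LieGroup 𝓘(ℝ, EP) ∞ P]
  {EM : Type*} [NormedAddCommGroup EM] [NormedSpace ℝ EM]
  {M : Type*} [TopologicalSpace M] [ChartedSpace EM M] [IsManifold 𝓘(ℝ, EM) ∞ M]
  {ET : Type*} [NormedAddCommGroup ET] [NormedSpace ℝ ET]
  {𝓖 : Type*} [TopologicalSpace 𝓖] [ChartedSpace ET 𝓖] [IsManifold 𝓘(ℝ, ET) ∞ 𝓖]
  (B : PrincipalBundle EP P EM M ET 𝓖)

theorem proj_act (u : 𝓖) (h : P) : B.proj (B.act u h) = B.proj u := by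
  obtain ⟨U, -, hx, φ, -, -, -, -, hφ⟩ := B.locallyTrivial (B.proj u)
  obtain ⟨h1, h2⟩ := hφ u hx
  rw [← (hφ _ (h2 h).1).1, (h2 h).2, h1]

theorem exists_act_eq {u v : 𝓖} (h : B.proj u = B.proj v) : ∃ g : P, B.act u g = v := by
  obtain ⟨U, -, hx, φ, hs, -, -, -, hφ⟩ := B.locallyTrivial (B.proj u)
  have hv : v ∈ B.proj ⁻¹' U := by rw [mem_preimage, ← h]; exact hx
  obtain ⟨h1, h2⟩ := hφ u hx
  refine ⟨(φ u).2⁻¹ * (φ v).2, φ.injOn (by rw [hs]; exact (h2 _).1) (by rw [hs]; exact hv) ?_⟩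
  rw [(h2 _).2, mul_inv_cancel_left, h1, h, ← (hφ v hv).1]

/-- Near every point of the base there are smooth local sections of the bundle. -/
theorem exists_localSection (u : 𝓖) : ∃ U : Set M, IsOpen U ∧ B.proj u ∈ U ∧ ∃ σ : M → 𝓖,
    ContMDiffOn 𝓘(ℝ, EM) 𝓘(ℝ, ET) ∞ σ U ∧ (∀ y ∈ U, B.proj (σ y) = y) ∧ σ (B.proj u) = u := by
  obtain ⟨U, hU, hx, φ, hs, ht, -, hφs, hφ⟩ := B.locallyTrivial (B.proj u)
  have hmem : ∀ y ∈ U, (y, (φ u).2) ∈ φ.target := fun y hy ↦ by rw [ht]; exact ⟨hy, trivial⟩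
  refine ⟨U, hU, hx, fun y ↦ φ.symm (y, (φ u).2), ?_, fun y hy ↦ ?_, ?_⟩
  · exact hφs.comp (contMDiffOn_id.prodMk contMDiffOn_const) hmem
  · have hsrc := φ.map_target (hmem y hy)
    rw [hs] at hsrc
    rw [← (hφ _ hsrc).1, φ.right_inv (hmem y hy)]
  · have h1 : (B.proj u, (φ u).2) = φ u := Prod.ext (hφ u hx).1.symm rfl
    change φ.symm (B.proj u, (φ u).2) = u
    rw [h1, φ.left_inv (by rw [hs]; exact hx)]

theorem mfderiv_proj_surjective (u : 𝓖) :
    Function.Surjective (mfderiv 𝓘(ℝ, ET) 𝓘(ℝ, EM) B.proj u) := by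
  intro v
  obtain ⟨U, hU, hx, σ, hσ, hpσ, hσu⟩ := B.exists_localSection u
  have hd : MDifferentiableAt 𝓘(ℝ, EM) 𝓘(ℝ, ET) σ (B.proj u) :=
    (hσ.contMDiffAt (hU.mem_nhds hx)).mdifferentiableAt (by simp)
  have h1 := mfderiv_comp_apply_of_eq (B.proj u) (y := u)
    (B.contMDiff_proj.mdifferentiable (by simp) u) hd hσu v
  have h2 : B.proj ∘ σ =ᶠ[𝓝 (B.proj u)] id := by
    filter_upwards [hU.mem_nhds hx] with y hy using hpσ y hy
  refine ⟨_, h1.symm.trans ?_⟩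
  have h3 := DFunLike.congr_fun (h2.mfderiv_eq (I := 𝓘(ℝ, EM)) (I' := 𝓘(ℝ, EM))) v
  exact h3.trans (by rw [mfderiv_id]; rfl)

theorem mdifferentiableAt_act_left (u : 𝓖) (h : P) :
    MDifferentiableAt 𝓘(ℝ, ET) 𝓘(ℝ, ET) (fun w ↦ B.act w h) u :=
  (B.contMDiff_act.comp (contMDiff_id.prodMk contMDiff_const)).mdifferentiable (by simp) u

theorem mdifferentiableAt_act_right (u : 𝓖) (h : P) :
    MDifferentiableAt 𝓘(ℝ, EP) 𝓘(ℝ, ET) (fun k ↦ B.act u k) h :=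
  (B.contMDiff_act.comp (contMDiff_const.prodMk contMDiff_id)).mdifferentiable (by simp) h

theorem mfderiv_proj_mfderiv_act (u : 𝓖) (h : P) (v : TangentSpace 𝓘(ℝ, ET) u) :
    mfderiv 𝓘(ℝ, ET) 𝓘(ℝ, EM) B.proj (B.act u h)
      (mfderiv 𝓘(ℝ, ET) 𝓘(ℝ, ET) (fun w ↦ B.act w h) u v) =
    mfderiv 𝓘(ℝ, ET) 𝓘(ℝ, EM) B.proj u v := by
  have h1 := mfderiv_comp_apply_of_eq u (y := B.act u h)
    (B.contMDiff_proj.mdifferentiable (by simp) (B.act u h)) (B.mdifferentiableAt_act_left u h)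
    rfl v
  have h2 : B.proj ∘ (fun w ↦ B.act w h) = B.proj := funext fun w ↦ B.proj_act w h
  rw [h2] at h1
  exact h1.symm

theorem mfderiv_proj_fundamentalField (A : GroupLieAlgebra 𝓘(ℝ, EP) P) (u : 𝓖) :
    mfderiv 𝓘(ℝ, ET) 𝓘(ℝ, EM) B.proj u (B.fundamentalField A u) = 0 := by
  have h1 := mfderiv_comp_apply_of_eq (1 : P) (y := u)
    (B.contMDiff_proj.mdifferentiable (by simp) u) (B.mdifferentiableAt_act_right u 1)
    (B.act_one u) A
  have h2 : B.proj ∘ (fun h ↦ B.act u h) = fun _ : P ↦ B.proj u := funext fun w ↦ B.proj_act u w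
  rw [h2, mfderiv_const] at h1
  exact h1.symm

/-- The vertical tangent vectors are the values of the fundamental vector fields. -/
theorem exists_fundamentalField_eq {u : 𝓖} {v : TangentSpace 𝓘(ℝ, ET) u}
    (hv : mfderiv 𝓘(ℝ, ET) 𝓘(ℝ, EM) B.proj u v = 0) : ∃ A, B.fundamentalField A u = v := by
  obtain ⟨U, hU, hx, φ, hs, ht, hφ1, hφs, hφ⟩ := B.locallyTrivial (B.proj u)
  have hmem : ∀ y ∈ U, ∀ h : P, (y, h) ∈ φ.target := fun y hy h ↦ by rw [ht]; exact ⟨hy, trivial⟩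
  have hsrc : ∀ y ∈ U, ∀ h : P, φ.symm (y, h) ∈ B.proj ⁻¹' U := fun y hy h ↦ by
    rw [← hs]; exact φ.map_target (hmem y hy h)
  let σ : M → 𝓖 := fun y ↦ φ.symm (y, (φ u).2)
  -- Near `u` every point is `w = σ(p(w))·τ(w)`, with `τ(u) = 1`. Differentiating along a vertical
  -- `v` kills the first factor and leaves the fundamental vector generated by `dτ(v)`.
  let τ : 𝓖 → P := fun w ↦ (φ u).2⁻¹ * (φ w).2
  have hpre : B.proj ⁻¹' U ∈ 𝓝 u := (hU.preimage B.contMDiff_proj.continuous).mem_nhds hx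
  have hστ : ∀ w ∈ B.proj ⁻¹' U, B.act (σ (B.proj w)) (τ w) = w := by
    intro w hw
    obtain ⟨h1, h2⟩ := hφ _ (hsrc (B.proj w) hw (φ u).2)
    refine φ.injOn (by rw [hs]; exact (h2 _).1) (by rw [hs]; exact hw) ?_
    rw [(h2 _).2, φ.right_inv (hmem _ hw _), mul_inv_cancel_left, ← (hφ w hw).1]
  have hσ : MDifferentiableAt 𝓘(ℝ, EM) 𝓘(ℝ, ET) σ (B.proj u) :=
    ((hφs.comp (contMDiffOn_id.prodMk contMDiffOn_const) fun y hy ↦ hmem y hy _).contMDiffAt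
      (hU.mem_nhds hx)).mdifferentiableAt (n := ∞) (by simp)
  have hτ : MDifferentiableAt 𝓘(ℝ, ET) 𝓘(ℝ, EP) τ u := by
    have h1 : ContMDiffAt 𝓘(ℝ, ET) (𝓘(ℝ, EM).prod 𝓘(ℝ, EP)) ∞ φ u :=
      hφ1.contMDiffAt (by rw [hs]; exact hpre)
    exact (contMDiffAt_const.mul (contMDiff_snd.contMDiffAt.comp u h1)).mdifferentiableAt
      (n := ∞) (by simp)
  have hp := B.contMDiff_proj.mdifferentiable (by simp) u
  have hσp := MDifferentiableAt.comp u hσ hp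
  have hact := B.contMDiff_act.mdifferentiable (n := ∞) (by simp)
  have hσu : σ (B.proj u) = u := by
    have h1 : (B.proj u, (φ u).2) = φ u := Prod.ext (hφ u hx).1.symm rfl
    change φ.symm (B.proj u, (φ u).2) = u
    rw [h1, φ.left_inv (by rw [hs]; exact hx)]
  have hτu : τ u = 1 := inv_mul_cancel _
  have h1 := mfderiv_comp_apply_of_eq u (y := (u, (1 : P))) (hact (u, 1)) (hσp.prodMk hτ)
    (Prod.ext hσu hτu) v
  have h2 : (fun q : 𝓖 × P ↦ B.act q.1 q.2) ∘ (fun w ↦ ((σ ∘ B.proj) w, τ w)) =ᶠ[𝓝 u] id := by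
    filter_upwards [hpre] with w hw using hστ w hw
  have h3 : mfderiv 𝓘(ℝ, ET) 𝓘(ℝ, ET)
      ((fun q : 𝓖 × P ↦ B.act q.1 q.2) ∘ (fun w ↦ ((σ ∘ B.proj) w, τ w))) u v = v :=
    (DFunLike.congr_fun (h2.mfderiv_eq (I := 𝓘(ℝ, ET)) (I' := 𝓘(ℝ, ET))) v).trans
      (by rw [mfderiv_id]; rfl)
  have h4 : mfderiv 𝓘(ℝ, ET) 𝓘(ℝ, ET) (σ ∘ B.proj) u v = 0 := by
    have := mfderiv_comp_apply_of_eq u (y := B.proj u) hσ hp rfl v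
    rw [hv, map_zero] at this
    exact this
  refine ⟨mfderiv 𝓘(ℝ, ET) 𝓘(ℝ, EP) τ u v, ?_⟩
  refine Eq.trans ?_ (h1.symm.trans h3)
  have h5 := mfderiv_prodMk hσp hτ
  have h6 := DFunLike.congr_fun h5 v
  let w : EP := mfderiv 𝓘(ℝ, ET) 𝓘(ℝ, EP) τ u v
  have h7 : (mfderiv 𝓘(ℝ, ET) (𝓘(ℝ, ET).prod 𝓘(ℝ, EP)) (fun w ↦ ((σ ∘ B.proj) w, τ w)) u v :
      ET × EP) = ((0 : ET), w) := h6.trans (Prod.ext h4 rfl)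
  have h8 := mfderiv_prod_eq_add_apply (hact (u, (1 : P))) (v := ((0 : ET), w))
  refine Eq.trans ?_ (congrArg
    (mfderiv (𝓘(ℝ, ET).prod 𝓘(ℝ, EP)) 𝓘(ℝ, ET) (fun q : 𝓖 × P ↦ B.act q.1 q.2) (u, 1)) h7).symm
  refine Eq.trans ?_ h8.symm
  exact ((congrArg (fun z : ET ↦ z + _) (map_zero _)).trans (zero_add _)).symm

/-- Smooth vector fields on the base can be lifted locally. -/
theorem exists_lift [CompleteSpace ET] {ξ : ∀ x : M, TangentSpace 𝓘(ℝ, EM) x}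
    (hξ : IsSmoothField ξ) (u : 𝓖) :
    ∃ ξ' : ∀ v : 𝓖, TangentSpace 𝓘(ℝ, ET) v, MDiffAt (T% ξ') u ∧
      ∀ᶠ v in 𝓝 u, mfderiv 𝓘(ℝ, ET) 𝓘(ℝ, EM) B.proj v (ξ' v) = ξ (B.proj v) := by
  obtain ⟨U, hU, hx, φ, hs, -, hφ1, hφs, hφ⟩ := B.locallyTrivial (B.proj u)
  have hpre : φ.source ∈ 𝓝 u := by
    rw [hs]; exact (hU.preimage B.contMDiff_proj.continuous).mem_nhds hx
  have hd : φ.MDifferentiable 𝓘(ℝ, ET) (𝓘(ℝ, EM).prod 𝓘(ℝ, EP)) :=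
    ⟨hφ1.mdifferentiableOn (by simp), hφs.mdifferentiableOn (by simp)⟩
  have hinv : ∀ v ∈ φ.source,
      (mfderiv 𝓘(ℝ, ET) (𝓘(ℝ, EM).prod 𝓘(ℝ, EP)) φ v).IsInvertible := fun v hv ↦ ⟨hd.mfderiv hv, rfl⟩
  have h0 : ContMDiff 𝓘(ℝ, EP) 𝓘(ℝ, EP).tangent (1 : ℕ)
      (T% (0 : ∀ g : P, TangentSpace 𝓘(ℝ, EP) g)) :=
    Bundle.contMDiff_zeroSection ℝ (TangentSpace 𝓘(ℝ, EP) : P → Type _)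
  -- The lift is the field `(ξ, 0)` of a local trivialization. Outside the trivializing set its
  -- values are irrelevant.
  refine ⟨mpullback 𝓘(ℝ, ET) (𝓘(ℝ, EM).prod 𝓘(ℝ, EP)) φ (prodField ξ 0), ?_, ?_⟩
  · exact (mdifferentiableAt_prodField one_ne_zero (hξ.of_le (by simp)) h0
      (φ u)).mpullback_vectorField (n := ∞) (hφ1.contMDiffAt hpre)
      (hinv u (mem_of_mem_nhds hpre)) (by norm_cast)
  · filter_upwards [hpre, eventually_mem_nhds_iff.2 hpre] with v hv hv'
    have h1 : Prod.fst ∘ φ =ᶠ[𝓝 v] B.proj := by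
      filter_upwards [hv'] with w hw
      rw [hs] at hw
      exact (hφ w hw).1
    have h2 := mfderiv_comp_apply_of_eq v (y := φ v)
      (mdifferentiableAt_fst (I := 𝓘(ℝ, EM)) (I' := 𝓘(ℝ, EP)))
      ((hd.1 v hv).mdifferentiableAt (φ.open_source.mem_nhds hv)) rfl
      (mpullback 𝓘(ℝ, ET) (𝓘(ℝ, EM).prod 𝓘(ℝ, EP)) φ (prodField ξ 0) v)
    have h3 := DFunLike.congr_fun (h1.mfderiv_eq (I := 𝓘(ℝ, ET)) (I' := 𝓘(ℝ, EM)))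
      (mpullback 𝓘(ℝ, ET) (𝓘(ℝ, EM).prod 𝓘(ℝ, EP)) φ (prodField ξ 0) v)
    refine h3.symm.trans (h2.trans ?_)
    have h4 : mfderiv 𝓘(ℝ, ET) (𝓘(ℝ, EM).prod 𝓘(ℝ, EP)) φ v
        (mpullback 𝓘(ℝ, ET) (𝓘(ℝ, EM).prod 𝓘(ℝ, EP)) φ (prodField ξ 0) v) =
        prodField (I' := 𝓘(ℝ, EP)) ξ 0 (φ v) := (hinv v hv).self_apply_inverse _
    rw [h4, mfderiv_fst]
    have h5 : ∀ y z : M, y = z → (ξ y : EM) = ξ z := by rintro y _ rfl; rfl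
    rw [hs] at hv
    exact h5 _ _ (hφ v hv).1

end PrincipalBundle

/-! ### The induced filtration of the tangent bundle. -/

namespace CartanGeometry

noncomputable section Filtration

open VectorField Set Filter Topology Bundle

variable {EG : Type*} [NormedAddCommGroup EG] [NormedSpace ℝ EG]
  {G : Type*} [TopologicalSpace G] [ChartedSpace EG G] [Group G] [LieGroup 𝓘(ℝ, EG) ∞ G]
  {EP : Type*} [NormedAddCommGroup EP] [NormedSpace ℝ EP]
  {P : Type*} [TopologicalSpace P] [ChartedSpace EP P] [Group P] [LieGroup 𝓘(ℝ, EP) ∞ P]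
  {ι : P →* G}
  {EM : Type*} [NormedAddCommGroup EM] [NormedSpace ℝ EM]
  {M : Type*} [TopologicalSpace M] [ChartedSpace EM M] [IsManifold 𝓘(ℝ, EM) ∞ M]
  {ET : Type*} [NormedAddCommGroup ET] [NormedSpace ℝ ET]
  {𝓖 : Type*} [TopologicalSpace 𝓖] [ChartedSpace ET 𝓖] [IsManifold 𝓘(ℝ, ET) ∞ 𝓖]
  (C : CartanGeometry EG EP ι EM M ET 𝓖)

/-- The map `𝔤 → T_x M`, `X ↦ T_u p (ω(u)⁻¹ X)`. -/
def anchor {x : M} (u : 𝓖) (hu : C.proj u = x) :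
    GroupLieAlgebra 𝓘(ℝ, EG) G →ₗ[ℝ] TangentSpace 𝓘(ℝ, EM) x :=
  (C.tangentProj u hu).toLinearMap ∘ₗ (C.form u).symm.toLinearMap

theorem anchor_form {x : M} (u : 𝓖) (hu : C.proj u = x) (v : TangentSpace 𝓘(ℝ, ET) u) :
    C.anchor u hu (C.form u v) = C.tangentProj u hu v :=
  congrArg (C.tangentProj u hu) ((C.form u).symm_apply_apply v)

theorem anchor_surjective {x : M} (u : 𝓖) (hu : C.proj u = x) :
    Function.Surjective (C.anchor u hu) := by
  subst hu
  intro v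
  obtain ⟨w, hw⟩ := C.mfderiv_proj_surjective u v
  exact ⟨C.form u w, (C.anchor_form u rfl w).trans hw⟩

/-- Equivariance of `ω` combined with `p(u·h) = p(u)`. This governs every change of the point over
`x`. -/
theorem anchor_act {x : M} (u : 𝓖) (hu : C.proj u = x) (h : P) (hu' : C.proj (C.act u h) = x)
    (X : GroupLieAlgebra 𝓘(ℝ, EG) G) : C.anchor (C.act u h) hu' X = C.anchor u hu (Ad (ι h) X) := by
  subst hu
  let v : TangentSpace 𝓘(ℝ, ET) u := (C.form u).symm (Ad (ι h) X)
  have h1 : X = C.form (C.act u h) (mfderiv 𝓘(ℝ, ET) 𝓘(ℝ, ET) (fun w ↦ C.act w h) u v) := by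
    rw [C.form_act, (C.form u).apply_symm_apply, Ad_inv_Ad]
  conv_lhs => rw [h1]
  rw [anchor_form]
  exact C.mfderiv_proj_mfderiv_act u h v

variable [FiniteDimensional ℝ EG] {k : ℕ} {γ : KGrading k (GroupLieAlgebra 𝓘(ℝ, EG) G)}

theorem anchor_mem_tangentFiltration {x : M} (u : 𝓖) (hu : C.proj u = x) {i : ℤ}
    {X : GroupLieAlgebra 𝓘(ℝ, EG) G} (hX : X ∈ γ.filtration i) :
    C.anchor u hu X ∈ C.tangentFiltration γ i x := by
  refine (le_iSup₂_of_le (f := fun (u : 𝓖) (hu : C.proj u = x) ↦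
    ((γ.filtration i).comap (C.form u).toLinearMap).map (C.tangentProj u hu).toLinearMap)
    u hu le_rfl) ⟨(C.form u).symm X, ?_, rfl⟩
  change C.form u ((C.form u).symm X) ∈ γ.filtration i
  rwa [(C.form u).apply_symm_apply]

theorem tangentFiltration_antitone (x : M) {i j : ℤ} (hij : i ≤ j) :
    C.tangentFiltration γ j x ≤ C.tangentFiltration γ i x :=
  iSup₂_mono fun _ _ ↦ Submodule.map_mono (Submodule.comap_mono (γ.filtration_antitone hij))

theorem tangentFiltration_eq_top (x : M) {i : ℤ} (hi : i ≤ -(k : ℤ)) :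
    C.tangentFiltration γ i x = ⊤ := by
  obtain ⟨u, hu⟩ := C.proj_surjective x
  rw [eq_top_iff]
  intro v _
  obtain ⟨X, rfl⟩ := C.anchor_surjective u hu v
  refine C.anchor_mem_tangentFiltration u hu ?_
  rw [γ.filtration_eq_top hi]
  trivial

variable [LieAlgebra.IsSemisimple ℝ (GroupLieAlgebra 𝓘(ℝ, EG) G)]

/-- Vertical vectors are values of fundamental fields, `ω` returns their generators, and these
generators fill out `𝔭` by `range_lieMap`. -/
theorem anchor_eq_zero_iff (hP : IsParabolicSubgroup γ EP ι) {x : M} (u : 𝓖) (hu : C.proj u = x)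
    (X : GroupLieAlgebra 𝓘(ℝ, EG) G) : C.anchor u hu X = 0 ↔ X ∈ γ.parabolic := by
  subst hu
  rw [← hP.range_lieMap]
  constructor
  · intro h
    obtain ⟨A, hA⟩ := C.exists_fundamentalField_eq h
    refine ⟨A, (C.form_fundamental A u).symm.trans ?_⟩
    rw [hA]
    exact (C.form u).apply_symm_apply X
  · rintro ⟨A, rfl⟩
    have h1 := C.anchor_form u rfl (C.fundamentalField A u)
    rw [form_fundamental] at h1
    exact h1.trans (C.mfderiv_proj_fundamentalField A u)

/-- All terms of the supremum defining `T^i_x M` coincide, since another point over `x` changes `X`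
by some `Ad(h)`, which preserves `𝔤^i`. The ambiguity in `X` is the kernel `𝔭`, contained in `𝔤^i`
because `i ≤ 0`. -/
theorem anchor_mem_tangentFiltration_iff (hP : IsParabolicSubgroup γ EP ι) {x : M} (u : 𝓖)
    (hu : C.proj u = x) {i : ℤ} (hi : i ≤ 0) (X : GroupLieAlgebra 𝓘(ℝ, EG) G) :
    C.anchor u hu X ∈ C.tangentFiltration γ i x ↔ X ∈ γ.filtration i := by
  refine ⟨fun h ↦ ?_, C.anchor_mem_tangentFiltration u hu⟩
  have hle : C.tangentFiltration γ i x ≤ (γ.filtration i).map (C.anchor u hu) := by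
    refine iSup₂_le fun u' hu' ↦ ?_
    rintro _ ⟨v, hv, rfl⟩
    obtain ⟨h, rfl⟩ := C.exists_act_eq (hu.trans hu'.symm)
    refine ⟨Ad (ι h) (C.form _ v), (hP.Ad_mem_filtration_iff h hi _).2 hv, ?_⟩
    rw [← C.anchor_act u hu h hu']
    exact C.anchor_form _ hu' v
  obtain ⟨Y, hY, hYX⟩ := hle h
  have h1 : X - Y ∈ γ.parabolic := by
    rw [← C.anchor_eq_zero_iff hP u hu, map_sub, hYX, sub_self]
  have h2 := γ.filtration_antitone hi h1
  simpa using add_mem h2 hY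

theorem exists_anchor_eq (hP : IsParabolicSubgroup γ EP ι) {x : M} (u : 𝓖) (hu : C.proj u = x)
    {i : ℤ} (hi : i ≤ 0) {v : TangentSpace 𝓘(ℝ, EM) x} (hv : v ∈ C.tangentFiltration γ i x) :
    ∃ X ∈ γ.filtration i, C.anchor u hu X = v := by
  obtain ⟨X, rfl⟩ := C.anchor_surjective u hu v
  exact ⟨X, (C.anchor_mem_tangentFiltration_iff hP u hu hi X).1 hv, rfl⟩

theorem tangentFiltration_eq_bot (hP : IsParabolicSubgroup γ EP ι) (x : M) {i : ℤ} (hi : 0 ≤ i) :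
    C.tangentFiltration γ i x = ⊥ := by
  rw [eq_bot_iff]
  refine iSup₂_le fun u hu ↦ ?_
  rintro _ ⟨v, hv, rfl⟩
  have h1 := (C.anchor_eq_zero_iff hP u hu _).2 (γ.filtration_antitone hi hv)
  exact (C.anchor_form u hu v).symm.trans h1

variable [FiniteDimensional ℝ ET]

/-- A basis of a complement `W` of `𝔭` in `𝔤^i` gives constant fields on `𝓖`. Restricted to a local
section and projected to `M`, they form a smooth frame of `T^i M`. -/
theorem isSmoothSubbundle_tangentFiltration (hP : IsParabolicSubgroup γ EP ι) {i : ℤ} (hi : i ≤ 0) :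
    IsSmoothSubbundle (C.tangentFiltration γ i) := by
  have : FiniteDimensional ℝ (GroupLieAlgebra 𝓘(ℝ, EG) G) := inferInstanceAs (FiniteDimensional ℝ EG)
  intro x₀
  obtain ⟨u, rfl⟩ := C.proj_surjective x₀
  obtain ⟨U, hU, hx, σ, hσ, hpσ, -⟩ := C.exists_localSection u
  obtain ⟨q, hq⟩ := γ.parabolic.exists_isCompl
  let W := q ⊓ γ.filtration i
  have hWp : W ⊓ γ.parabolic = ⊥ := by
    rw [eq_bot_iff, ← hq.inf_eq_bot]
    exact le_inf inf_le_right (inf_le_left.trans inf_le_left)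
  -- By the modular law, intersecting a complement of `𝔭` in `𝔤` with `𝔤^i ⊇ 𝔭` yields a complement
  -- of `𝔭` in `𝔤^i`.
  have hsup : γ.parabolic ⊔ W = γ.filtration i := by
    have hle : γ.parabolic ≤ γ.filtration i := γ.filtration_antitone hi
    rw [← sup_inf_assoc_of_le q hle, hq.sup_eq_top, top_inf_eq]
  let b := Module.finBasis ℝ W
  let s : Fin (Module.finrank ℝ W) → ∀ x : M, TangentSpace 𝓘(ℝ, EM) x := fun a y ↦
    (mfderiv 𝓘(ℝ, ET) 𝓘(ℝ, EM) C.proj (σ y)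
      (C.constantField ((b a : W) : GroupLieAlgebra 𝓘(ℝ, EG) G) (σ y)) : EM)
  have hs : ∀ a, ∀ y (hy : y ∈ U), s a y = C.anchor (σ y) (hpσ y hy) (b a) := fun _ _ _ ↦ rfl
  refine ⟨U, hU, hx, Module.finrank ℝ W, s, fun a ↦ ?_, fun y hy ↦ ⟨?_, ?_⟩⟩
  · have h1 : ContMDiff 𝓘(ℝ, ET).tangent 𝓘(ℝ, EM).tangent ∞
        (tangentMap 𝓘(ℝ, ET) 𝓘(ℝ, EM) C.proj) := C.contMDiff_proj.contMDiff_tangentMap (by simp)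
    have h2 := (h1.comp (C.isSmoothField_constantField
      ((b a : W) : GroupLieAlgebra 𝓘(ℝ, EG) G))).comp_contMDiffOn hσ
    refine h2.congr fun y hy ↦ ?_
    have h3 : ∀ (z : M) (v : EM), z = y →
        (⟨y, v⟩ : TangentBundle 𝓘(ℝ, EM) M) = ⟨z, v⟩ := by
      rintro z v rfl; rfl
    exact h3 _ _ (hpσ y hy)
  · have h1 : LinearIndependent ℝ (C.anchor (σ y) (hpσ y hy) ∘ W.subtype ∘ b) := by
      refine (b.linearIndependent.map' W.subtype W.ker_subtype).map ?_
      rw [range_comp, Submodule.span_image, b.span_eq, Submodule.map_subtype_top, disjoint_iff,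
        eq_bot_iff, ← hWp]
      exact inf_le_inf_left _ fun X hX ↦ (C.anchor_eq_zero_iff hP _ _ X).1 hX
    exact h1
  · have h1 : (range fun a ↦ s a y) = C.anchor (σ y) (hpσ y hy) '' (W.subtype '' (range b)) := by
      rw [← range_comp, ← range_comp]; rfl
    rw [h1, Submodule.span_image, Submodule.span_image, b.span_eq, Submodule.map_subtype_top]
    refine le_antisymm ?_ fun v hv ↦ ?_
    · rintro _ ⟨X, hX, rfl⟩
      exact C.anchor_mem_tangentFiltration _ _ hX.2
    · obtain ⟨X, hX, rfl⟩ := C.exists_anchor_eq hP (σ y) (hpσ y hy) hi hv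
      rw [← hsup] at hX
      obtain ⟨Y, hY, Z, hZ, rfl⟩ := Submodule.mem_sup.1 hX
      refine ⟨Z, hZ, ?_⟩
      rw [map_add, (C.anchor_eq_zero_iff hP _ _ Y).2 hY, zero_add]

end Filtration

end CartanGeometry

/-! ### Comparison of the Levi bracket, the algebraic bracket and the curvature. -/

open VectorField Set Filter Topology Bundle

theorem mvfderiv_mem_of_eventually_mem {E : Type*} [NormedAddCommGroup E] [NormedSpace ℝ E]
    {H : Type*} [TopologicalSpace H] {I : ModelWithCorners ℝ E H}
    {M : Type*} [TopologicalSpace M] [ChartedSpace H M]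
    {F : Type*} [NormedAddCommGroup F] [NormedSpace ℝ F] [FiniteDimensional ℝ F] {f : M → F} {x : M}
    (hf : MDiffAt f x) (p : Submodule ℝ F) (hp : ∀ᶠ y in 𝓝 x, f y ∈ p) (v : TangentSpace I x) :
    mvfderiv I f x v ∈ p := by
  obtain ⟨L, hL⟩ := p.exists_continuousLinearMap_mem_iff_eq_zero
  rw [hL, ← mvfderiv_clm_comp L hf]
  have h1 : (fun y ↦ L (f y)) =ᶠ[𝓝 x] fun _ ↦ 0 := hp.mono fun y hy ↦ (hL _).1 hy
  exact (DFunLike.congr_fun (h1.mfderiv_eq (I := I) (I' := 𝓘(ℝ, F))) v).trans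
    (by rw [mfderiv_const]; rfl)

theorem Gr.mk_eq_mk_iff {E : Type*} [NormedAddCommGroup E] [NormedSpace ℝ E]
    {M : Type*} [TopologicalSpace M] [ChartedSpace E M] {F : TangentFiltration E M} {x : M} {i : ℤ}
    {v w : TangentSpace 𝓘(ℝ, E) x} (hv : v ∈ F i x) (hw : w ∈ F i x) :
    Gr.mk F x i ⟨v, hv⟩ = Gr.mk F x i ⟨w, hw⟩ ↔ v - w ∈ F (i + 1) x :=
  Submodule.Quotient.eq ((F (i + 1) x).submoduleOf (F i x))

namespace CartanGeometry

noncomputable section Bracket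

variable {EG : Type*} [NormedAddCommGroup EG] [NormedSpace ℝ EG] [FiniteDimensional ℝ EG]
  {G : Type*} [TopologicalSpace G] [ChartedSpace EG G] [Group G] [LieGroup 𝓘(ℝ, EG) ∞ G]
  [LieAlgebra.IsSemisimple ℝ (GroupLieAlgebra 𝓘(ℝ, EG) G)]
  {k : ℕ} {γ : KGrading k (GroupLieAlgebra 𝓘(ℝ, EG) G)}
  {EP : Type*} [NormedAddCommGroup EP] [NormedSpace ℝ EP]
  {P : Type*} [TopologicalSpace P] [ChartedSpace EP P] [Group P] [LieGroup 𝓘(ℝ, EP) ∞ P]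
  {ι : P →* G}
  {EM : Type*} [NormedAddCommGroup EM] [NormedSpace ℝ EM]
  {M : Type*} [TopologicalSpace M] [ChartedSpace EM M] [IsManifold 𝓘(ℝ, EM) ∞ M]
  {ET : Type*} [NormedAddCommGroup ET] [NormedSpace ℝ ET]
  {𝓖 : Type*} [TopologicalSpace 𝓖] [ChartedSpace ET 𝓖] [IsManifold 𝓘(ℝ, ET) ∞ 𝓖]
  (C : CartanGeometry EG EP ι EM M ET 𝓖)

theorem mk_anchor_eq_iff (hP : IsParabolicSubgroup γ EP ι) {x : M} (u : 𝓖) (hu : C.proj u = x)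
    {i : ℤ} (hi : i < 0) {X Y : GroupLieAlgebra 𝓘(ℝ, EG) G} (hX : X ∈ γ.filtration i)
    (hY : Y ∈ γ.filtration i) :
    Gr.mk (C.tangentFiltration γ) x i ⟨_, C.anchor_mem_tangentFiltration u hu hX⟩ =
      Gr.mk (C.tangentFiltration γ) x i ⟨_, C.anchor_mem_tangentFiltration u hu hY⟩ ↔
    X - Y ∈ γ.filtration (i + 1) := by
  rw [Gr.mk_eq_mk_iff, ← map_sub, C.anchor_mem_tangentFiltration_iff hP u hu (by omega)]

theorem grFrame_proj (hP : IsParabolicSubgroup γ EP ι) {x : M} (u : 𝓖) (hu : C.proj u = x)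
    {i : ℤ} (hi : i < 0) {X : GroupLieAlgebra 𝓘(ℝ, EG) G} (hX : X ∈ γ.filtration i) :
    C.grFrame γ u hu i ⟨γ.proj i X, γ.proj_mem i X⟩ =
      Gr.mk (C.tangentFiltration γ) x i ⟨_, C.anchor_mem_tangentFiltration u hu hX⟩ :=
  Eq.symm <| (C.mk_anchor_eq_iff hP u hu hi hX
    (γ.component_le_filtration i (γ.proj_mem i X))).2 (γ.sub_proj_mem_filtration hX)

/-- This is `𝔤^i = 𝔤_i ⊕ 𝔤^{i+1}` transported to `T_x M`. It also shows that `Function.invFun` in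
`algBracket` is a true inverse. -/
theorem grFrame_bijective (hP : IsParabolicSubgroup γ EP ι) {x : M} (u : 𝓖) (hu : C.proj u = x)
    {i : ℤ} (hi : i < 0) : Function.Bijective (C.grFrame γ u hu i) := by
  constructor
  · rintro ⟨X, hX⟩ ⟨Y, hY⟩ h
    have h1 := (C.mk_anchor_eq_iff hP u hu hi (γ.component_le_filtration i hX)
      (γ.component_le_filtration i hY)).1 h
    have h2 := γ.mem_filtration_iff.1 h1 i (by omega)
    rw [γ.proj_of_mem (sub_mem hX hY), sub_eq_zero] at h2
    exact Subtype.ext h2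
  · intro a
    obtain ⟨⟨v, hv⟩, rfl⟩ := Submodule.mkQ_surjective _ a
    obtain ⟨X, hX, rfl⟩ := C.exists_anchor_eq hP u hu hi.le hv
    exact ⟨_, C.grFrame_proj hP u hu hi hX⟩

/-- Makes `algBracket` computable at any point over `x` and on any representatives in `𝔤^i`, `𝔤^j`.
Passing from the chosen point to `u` applies an automorphism `Ad(h)` that respects the filtration,
and the bracket modulo `𝔤^{i+j+1}` sees only leading components. -/
theorem algBracket_mk_anchor (hP : IsParabolicSubgroup γ EP ι) {x : M} (u : 𝓖) (hu : C.proj u = x)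
    {i j : ℤ} (hi : i < 0) (hj : j < 0) {X Y : GroupLieAlgebra 𝓘(ℝ, EG) G}
    (hX : X ∈ γ.filtration i) (hY : Y ∈ γ.filtration j) :
    C.algBracket γ
        (Gr.mk (C.tangentFiltration γ) x i ⟨_, C.anchor_mem_tangentFiltration u hu hX⟩)
        (Gr.mk (C.tangentFiltration γ) x j ⟨_, C.anchor_mem_tangentFiltration u hu hY⟩) =
      Gr.mk (C.tangentFiltration γ) x (i + j)
        ⟨_, C.anchor_mem_tangentFiltration u hu (γ.lie_mem_filtration hX hY)⟩ := by
  let br : γ.component i → γ.component j → γ.component (i + j) := fun A B ↦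
    ⟨⁅(A : GroupLieAlgebra 𝓘(ℝ, EG) G), (B : GroupLieAlgebra 𝓘(ℝ, EG) G)⁆,
      γ.lie_mem i j A A.2 B B.2⟩
  obtain ⟨u₀, hu₀, hdef⟩ : ∃ (u₀ : 𝓖) (hu₀ : C.proj u₀ = x), ∀ a b,
      C.algBracket γ (x := x) (i := i) (j := j) a b = C.grFrame γ u₀ hu₀ (i + j)
        (br (Function.invFun (C.grFrame γ u₀ hu₀ i) a)
          (Function.invFun (C.grFrame γ u₀ hu₀ j) b)) :=
    ⟨_, (C.proj_surjective x).choose_spec, fun _ _ ↦ rfl⟩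
  rw [hdef]
  obtain ⟨h, rfl⟩ := C.exists_act_eq (hu₀.trans hu.symm)
  have hX' := (hP.Ad_mem_filtration_iff h hi.le X).2 hX
  have hY' := (hP.Ad_mem_filtration_iff h hj.le Y).2 hY
  have hmk : ∀ {l : ℤ} {Z : GroupLieAlgebra 𝓘(ℝ, EG) G} (hZ : Z ∈ γ.filtration l)
      (hZ' : Ad (ι h) Z ∈ γ.filtration l),
      Gr.mk (C.tangentFiltration γ) x l ⟨_, C.anchor_mem_tangentFiltration _ hu hZ⟩ =
        Gr.mk (C.tangentFiltration γ) x l ⟨_, C.anchor_mem_tangentFiltration u₀ hu₀ hZ'⟩ :=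
    fun _ _ ↦ congrArg _ (Subtype.ext (C.anchor_act u₀ hu₀ h hu _))
  have key : ∀ {l : ℤ} (_ : l < 0) {Z : GroupLieAlgebra 𝓘(ℝ, EG) G} (hZ : Z ∈ γ.filtration l)
      (_ : Ad (ι h) Z ∈ γ.filtration l),
      Function.invFun (C.grFrame γ u₀ hu₀ l) (Gr.mk (C.tangentFiltration γ) x l
        ⟨_, C.anchor_mem_tangentFiltration _ hu hZ⟩) = ⟨γ.proj l (Ad (ι h) Z), γ.proj_mem l _⟩ :=
    fun hl Z hZ hZ' ↦
      (congrArg _ ((hmk hZ hZ').trans (C.grFrame_proj hP u₀ hu₀ hl hZ').symm)).trans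
        (Function.leftInverse_invFun (C.grFrame_bijective hP u₀ hu₀ hl).1 _)
  rw [key hi hX hX', key hj hY hY']
  have hXY : Ad (ι h) ⁅X, Y⁆ ∈ γ.filtration (i + j) := by
    rw [Ad_lie]; exact γ.lie_mem_filtration hX' hY'
  refine Eq.trans ?_ (hmk (γ.lie_mem_filtration hX hY) hXY).symm
  refine Eq.symm ((C.mk_anchor_eq_iff hP u₀ hu₀ (by omega) hXY
    (γ.component_le_filtration _ (γ.lie_mem i j _ (γ.proj_mem i _) _ (γ.proj_mem j _)))).2 ?_)
  rw [Ad_lie]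
  exact γ.lie_sub_lie_mem_filtration hX' (γ.component_le_filtration j (γ.proj_mem j _))
    (γ.sub_proj_mem_filtration hX') (γ.sub_proj_mem_filtration hY')

variable [FiniteDimensional ℝ ET]

/-- A smooth vector field on `M` has a local lift with prescribed value at a point. -/
theorem exists_lift_form_eq (hP : IsParabolicSubgroup γ EP ι)
    {ξ : ∀ x : M, TangentSpace 𝓘(ℝ, EM) x} (hξ : IsSmoothField ξ) (u : 𝓖)
    {X : GroupLieAlgebra 𝓘(ℝ, EG) G} (hX : C.anchor u rfl X = ξ (C.proj u)) :
    ∃ ξ' : ∀ v : 𝓖, TangentSpace 𝓘(ℝ, ET) v, MDiffAt (T% ξ') u ∧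
      (∀ᶠ v in 𝓝 u, mfderiv 𝓘(ℝ, ET) 𝓘(ℝ, EM) C.proj v (ξ' v) = ξ (C.proj v)) ∧
      C.form u (ξ' u) = X := by
  have : CompleteSpace ET := FiniteDimensional.complete ℝ ET
  obtain ⟨ξ₀, h1, h2⟩ := C.exists_lift hξ u
  -- The discrepancy at `u` lies in `𝔭`, so the constant field `ω⁻¹(Z)` is vertical everywhere and
  -- may be added without spoiling the lift.
  let Z : GroupLieAlgebra 𝓘(ℝ, EG) G := X - C.form u (ξ₀ u)
  have hZ : Z ∈ γ.parabolic := by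
    rw [← C.anchor_eq_zero_iff hP u rfl, map_sub, hX, anchor_form, sub_eq_zero]
    exact h2.self_of_nhds.symm
  refine ⟨ξ₀ + C.constantField Z, mdifferentiableAt_add_section h1
    (C.mdifferentiableAt_constantField Z u), ?_, ?_⟩
  · filter_upwards [h2] with v hv
    have h3 : mfderiv 𝓘(ℝ, ET) 𝓘(ℝ, EM) C.proj v (C.constantField Z v) = 0 :=
      (C.anchor_eq_zero_iff hP v rfl Z).2 hZ
    rw [Pi.add_apply, map_add, hv, h3, add_zero]
  · have h3 : C.form u (C.constantField Z u) = Z := C.formLin_constantField Z u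
    rw [Pi.add_apply, map_add, h3]
    exact add_sub_cancel _ _

/-- Tensoriality turns a condition on vector fields into one on the curvature function at each
point. Constant fields supply the forward direction. -/
theorem isRegular_iff (hP : IsParabolicSubgroup γ EP ι) : C.IsRegular γ ↔
    ∀ i j : ℤ, i < 0 → j < 0 → ∀ u : 𝓖, ∀ X ∈ γ.filtration i, ∀ Y ∈ γ.filtration j,
      C.curvatureFunction u X Y ∈ γ.filtration (i + j + 1) := by
  constructor
  · intro h i j hi hj u X hX Y hY
    exact h i j hi hj _ _ (C.isSmoothField_constantField X) (C.isSmoothField_constantField Y) u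
      (C.anchor_mem_tangentFiltration u rfl hX) (C.anchor_mem_tangentFiltration u rfl hY)
  · intro h i j hi hj ξ η hξ hη u hξu hηu
    rw [C.curvature_eq_curvatureFunction (hξ.mdifferentiable (by simp) u)
      (hη.mdifferentiable (by simp) u)]
    rw [← anchor_form, C.anchor_mem_tangentFiltration_iff hP _ _ hi.le] at hξu
    rw [← anchor_form, C.anchor_mem_tangentFiltration_iff hP _ _ hj.le] at hηu
    exact h i j hi hj u _ hξu _ hηu

variable [FiniteDimensional ℝ EM]

/-- The Lie bracket of sections of the filtration components, modulo `T^{i+j+1} M`. -/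
theorem exists_anchor_eq_mlieBracket (hP : IsParabolicSubgroup γ EP ι) {i j : ℤ} (hi : i < 0)
    (hj : j < 0) (ξ : Sections (C.tangentFiltration γ i)) (η : Sections (C.tangentFiltration γ j))
    (u : 𝓖) {X Y : GroupLieAlgebra 𝓘(ℝ, EG) G} (hX : C.anchor u rfl X = ξ.1 (C.proj u))
    (hY : C.anchor u rfl Y = η.1 (C.proj u)) :
    ∃ Z, Z - (⁅X, Y⁆ - C.curvatureFunction u X Y) ∈ γ.filtration (i + j + 1) ∧
      C.anchor u rfl Z = mlieBracket 𝓘(ℝ, EM) ξ.1 η.1 (C.proj u) := by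
  have : CompleteSpace ET := FiniteDimensional.complete ℝ ET
  have : CompleteSpace EM := FiniteDimensional.complete ℝ EM
  obtain ⟨ξ', hξ1, hξ2, hξ3⟩ := C.exists_lift_form_eq hP ξ.2.1 u hX
  obtain ⟨η', hη1, hη2, hη3⟩ := C.exists_lift_form_eq hP η.2.1 u hY
  refine ⟨C.form u (mlieBracket 𝓘(ℝ, ET) ξ' η' u), ?_, ?_⟩
  -- Along a lift of a section of `T^l M`, `ω` takes values in the fixed subspace `𝔤^l`, so its
  -- derivatives do too. For `l = i` and `l = j` this lies in `𝔤^{i+j+1}`, as the other index is at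
  -- most `-1`.
  · have hmem : ∀ {l m : ℤ} (_ : l < 0) (_ : m ≤ l) (θ : Sections (C.tangentFiltration γ l))
        {θ' : ∀ v : 𝓖, TangentSpace 𝓘(ℝ, ET) v}, MDiffAt (T% θ') u →
        (∀ᶠ v in 𝓝 u, mfderiv 𝓘(ℝ, ET) 𝓘(ℝ, EM) C.proj v (θ' v) = θ.1 (C.proj v)) →
        ∀ w : TangentSpace 𝓘(ℝ, ET) u,
          (mvfderiv 𝓘(ℝ, ET) (C.formField θ') u w : EG) ∈ (γ.filtration m : Submodule ℝ EG) := by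
      intro l m hl hm θ θ' h1 h2 w
      refine mvfderiv_mem_of_eventually_mem (C.mdifferentiableAt_formField h1) _ ?_ w
      filter_upwards [h2] with v hv
      refine γ.filtration_antitone hm
        ((C.anchor_mem_tangentFiltration_iff hP v rfl hl.le _).1 ?_)
      have h3 := (C.anchor_form v rfl (θ' v)).trans hv
      exact h3.symm ▸ θ.2.2 (C.proj v)
    have h1 := hmem (m := i + j + 1) hj (by omega) η hη1 hη2 (ξ' u)
    have h2 := hmem (m := i + j + 1) hi (by omega) ξ hξ1 hξ2 (η' u)
    have h3 : C.curvatureFunction u X Y = C.extDerivForm ξ' η' u + ⁅X, Y⁆ := by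
      rw [← hξ3, ← hη3, ← C.curvature_eq_curvatureFunction hξ1 hη1, curvature]
    rw [h3, sub_add_cancel_right, sub_neg_eq_add]
    have h4 := sub_mem h1 h2
    refine (congrArg (· ∈ (γ.filtration (i + j + 1) : Submodule ℝ EG)) ?_).mpr h4
    refine (congrArg (fun z : EG ↦ (C.formLin u (mlieBracket 𝓘(ℝ, ET) ξ' η' u)) + z)
      (C.extDerivForm_eq ξ' η' u)).trans ?_
    abel
  · rw [anchor_form]
    exact mfderiv_mlieBracket_of_related (C.contMDiff_proj.contMDiffAt.of_le (by norm_cast))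
      hξ1 hη1 (ξ.2.1.mdifferentiable (by simp) _) (η.2.1.mdifferentiable (by simp) _) hξ2 hη2

/-- Only the bracket condition uses regularity: it puts `[X, Y] - K(X, Y)` in `𝔤^{i+j}`. -/
theorem isFilteredManifold (hP : IsParabolicSubgroup γ EP ι) (h : C.IsRegular γ) :
    IsFilteredManifold k (C.tangentFiltration γ) where
  antitone x _ _ hij := C.tangentFiltration_antitone x hij
  eq_top x _ hi := C.tangentFiltration_eq_top x hi
  eq_bot x _ hi := C.tangentFiltration_eq_bot hP x hi
  isSmoothSubbundle i hi := C.isSmoothSubbundle_tangentFiltration hP hi.le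
  lieBracket_mem := by
    intro i j hi hj ξ η x
    obtain ⟨u, rfl⟩ := C.proj_surjective x
    obtain ⟨X, hX, hXξ⟩ := C.exists_anchor_eq hP u rfl hi.le (ξ.2.2 (C.proj u))
    obtain ⟨Y, hY, hYη⟩ := C.exists_anchor_eq hP u rfl hj.le (η.2.2 (C.proj u))
    obtain ⟨Z, hZ, hZb⟩ := C.exists_anchor_eq_mlieBracket hP hi hj ξ η u hXξ hYη
    rw [← hZb]
    refine C.anchor_mem_tangentFiltration u rfl ?_
    have hle := γ.filtration_antitone (show i + j ≤ i + j + 1 by omega)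
    have hK := (C.isRegular_iff hP).1 h i j hi hj u X hX Y hY
    have := add_mem (hle hZ) (sub_mem (γ.lie_mem_filtration hX hY) (hle hK))
    rwa [sub_add_cancel] at this

variable [T2Space M]

theorem leviBracket_eq_algBracket (hP : IsParabolicSubgroup γ EP ι) (h : C.IsRegular γ)
    (hF : IsFilteredManifold k (C.tangentFiltration γ)) (x : M) {i j : ℤ} (hi : i < 0) (hj : j < 0)
    (a : Gr (C.tangentFiltration γ) x i) (b : Gr (C.tangentFiltration γ) x j) :
    hF.leviBracket hi hj a b = C.algBracket γ a b := by
  obtain ⟨u, rfl⟩ := C.proj_surjective x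
  obtain ⟨ξ, rfl⟩ := hF.exists_cls_eq hi a
  obtain ⟨η, rfl⟩ := hF.exists_cls_eq hj b
  obtain ⟨X, hX, hXξ⟩ := C.exists_anchor_eq hP u rfl hi.le (ξ.2.2 (C.proj u))
  obtain ⟨Y, hY, hYη⟩ := C.exists_anchor_eq hP u rfl hj.le (η.2.2 (C.proj u))
  obtain ⟨Z, hZ, hZb⟩ := C.exists_anchor_eq_mlieBracket hP hi hj ξ η u hXξ hYη
  have hK := (C.isRegular_iff hP).1 h i j hi hj u X hX Y hY
  rw [hF.leviBracket_cls]
  simp only [Sections.cls, ← hXξ, ← hYη]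
  rw [C.algBracket_mk_anchor hP u rfl hi hj hX hY, Gr.mk_eq_mk_iff, ← hZb, ← map_sub]
  refine C.anchor_mem_tangentFiltration u rfl ?_
  have := sub_mem hZ hK
  rwa [sub_sub, sub_add_cancel] at this

/-- Every pair `X ∈ 𝔤^i`, `Y ∈ 𝔤^j` is realized by global sections at `p(u)`. If `Z` represents
their bracket, equality of the two brackets gives `Z - [X, Y] ∈ 𝔤^{i+j+1}`, while `Z - [X, Y] + K(X,
Y)` always lies there. The difference is `K(X, Y)`. -/
theorem isRegular_of_leviBracket_eq (hP : IsParabolicSubgroup γ EP ι)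
    (hF : IsFilteredManifold k (C.tangentFiltration γ))
    (h : ∀ (x : M) (i j : ℤ) (hi : i < 0) (hj : j < 0)
      (a : Gr (C.tangentFiltration γ) x i) (b : Gr (C.tangentFiltration γ) x j),
      hF.leviBracket hi hj a b = C.algBracket γ a b) : C.IsRegular γ := by
  rw [C.isRegular_iff hP]
  intro i j hi hj u X hX Y hY
  obtain ⟨ξ, hξ⟩ := (hF.isSmoothSubbundle i hi).exists_section (C.proj u) _
    (C.anchor_mem_tangentFiltration u rfl hX)
  obtain ⟨η, hη⟩ := (hF.isSmoothSubbundle j hj).exists_section (C.proj u) _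
    (C.anchor_mem_tangentFiltration u rfl hY)
  obtain ⟨Z, hZ, hZb⟩ := C.exists_anchor_eq_mlieBracket hP hi hj ξ η u hξ.symm hη.symm
  have h1 := h (C.proj u) i j hi hj (ξ.cls _) (η.cls _)
  rw [hF.leviBracket_cls] at h1
  simp only [Sections.cls, hξ, hη] at h1
  rw [C.algBracket_mk_anchor hP u rfl hi hj hX hY, Gr.mk_eq_mk_iff, ← hZb, ← map_sub,
    C.anchor_mem_tangentFiltration_iff hP u rfl (by omega)] at h1
  have := sub_mem hZ h1
  rwa [show Z - (⁅X, Y⁆ - C.curvatureFunction u X Y) - (Z - ⁅X, Y⁆) = C.curvatureFunction u X Y by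
    abel] at this

/-- The symbol algebra of a regular parabolic geometry is isomorphic to `𝔤_-`. -/
def symbolAlgebraIso (hP : IsParabolicSubgroup γ EP ι) (h : C.IsRegular γ)
    (hF : IsFilteredManifold k (C.tangentFiltration γ)) {x : M} (u : 𝓖) (hu : C.proj u = x) :
    SymbolAlgebraIso hF x γ where
  equiv i hi := (LinearEquiv.ofBijective _ (C.grFrame_bijective hP u hu hi)).symm
  map_bracket := by
    intro i j hi hj a b
    obtain ⟨X, rfl⟩ := (C.grFrame_bijective hP u hu hi).2 a
    obtain ⟨Y, rfl⟩ := (C.grFrame_bijective hP u hu hj).2 b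
    have hs : ∀ {l : ℤ} (hl : l < 0) (Z : γ.component l),
        (LinearEquiv.ofBijective _ (C.grFrame_bijective hP u hu hl)).symm (C.grFrame γ u hu l Z) =
          Z := fun hl Z ↦ LinearEquiv.ofBijective_symm_apply_apply _ Z
    have h1 : hF.leviBracket hi hj (C.grFrame γ u hu i X) (C.grFrame γ u hu j Y) =
        C.grFrame γ u hu (i + j) ⟨_, γ.lie_mem i j X X.2 Y Y.2⟩ :=
      (C.leviBracket_eq_algBracket hP h hF x hi hj _ _).trans
        (C.algBracket_mk_anchor hP u hu hi hj (γ.component_le_filtration i X.2)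
          (γ.component_le_filtration j Y.2))
    rw [h1, hs (by omega), hs hi, hs hj]

end Bracket

end CartanGeometry

end ParabolicGeometry

open ParabolicGeometry in
theorem proposition2p7
    {EG : Type*} [NormedAddCommGroup EG] [NormedSpace ℝ EG] [FiniteDimensional ℝ EG]
    {G : Type*} [TopologicalSpace G] [ChartedSpace EG G] [Group G] [LieGroup 𝓘(ℝ, EG) ∞ G]
    [LieAlgebra.IsSemisimple ℝ (GroupLieAlgebra 𝓘(ℝ, EG) G)]
    {k : ℕ} (γ : KGrading k (GroupLieAlgebra 𝓘(ℝ, EG) G))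
    {EP : Type*} [NormedAddCommGroup EP] [NormedSpace ℝ EP] [FiniteDimensional ℝ EP]
    {P : Type*} [TopologicalSpace P] [ChartedSpace EP P] [Group P] [LieGroup 𝓘(ℝ, EP) ∞ P]
    (ι : P →* G) (hP : IsParabolicSubgroup γ EP ι)
    {EM : Type*} [NormedAddCommGroup EM] [NormedSpace ℝ EM] [FiniteDimensional ℝ EM]
    {M : Type*} [TopologicalSpace M] [ChartedSpace EM M] [IsManifold 𝓘(ℝ, EM) ∞ M] [T2Space M]
    {ET : Type*} [NormedAddCommGroup ET] [NormedSpace ℝ ET] [FiniteDimensional ℝ ET]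
    {𝓖 : Type*} [TopologicalSpace 𝓖] [ChartedSpace ET 𝓖] [IsManifold 𝓘(ℝ, ET) ∞ 𝓖]
    (C : CartanGeometry EG EP ι EM M ET 𝓖) :
    (C.IsRegular γ ↔
      ∃ hF : IsFilteredManifold k (C.tangentFiltration γ),
        ∀ (x : M) (i j : ℤ) (hi : i < 0) (hj : j < 0)
          (a : Gr (C.tangentFiltration γ) x i) (b : Gr (C.tangentFiltration γ) x j),
          hF.leviBracket hi hj a b = C.algBracket γ a b) ∧
    (C.IsRegular γ →
      ∃ hF : IsFilteredManifold k (C.tangentFiltration γ),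
        ∀ x : M, Nonempty (SymbolAlgebraIso hF x γ)) := by
  have key := fun h : C.IsRegular γ ↦ C.isFilteredManifold hP h
  refine ⟨⟨fun h ↦ ⟨key h, fun x i j hi hj a b ↦
    C.leviBracket_eq_algBracket hP h (key h) x hi hj a b⟩, fun ⟨hF, h⟩ ↦
    C.isRegular_of_leviBracket_eq hP hF h⟩, fun h ↦ ⟨key h, fun x ↦ ?_⟩⟩
  obtain ⟨u, hu⟩ := C.proj_surjective x
  exact ⟨C.symbolAlgebraIso hP h (key h) u hu⟩
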